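/- Let $X$ be a finite $T_0$-space. For $Y\subseteq X$ let $\overline Y$ be its closure and $\widetilde Y$ the smallest open set containing $Y$. Write $x\le y$ if $\overline{\{x\}}\subseteq\overline{\{y\}}$, and $y\to x$ if $x<y$ and no $z$ satisfies $x<z<y$. A path from $y$ to $x$ is a finite sequence $y=z_n\to\dots\to z_1=x$ ($n\ge 1$). The space $X$ is a *unique path space* if for all $x,y$ there is at most one path from $y$ to $x$. A *boundary pair* is a pair $(U,C)$ where $U$ is a relatively open subset of some locally closed $Y\subseteq X$ and $C=Y\setminus U$. It is *elementary* if $U$ is open, $C$ is closed, both are (non-empty and) connected, $U\subseteq\widetilde C$ and $C\subseteq\overline U$. An *EBP space* is a unique path space in which every elementary boundary pair is of the form $(\widetilde{\{x\}},\overline{\{y\}})$ for points $x\to y$. Composites are written in diagrammatic order: $fg$ means first $f$, then $g$. Let $\mathcal{ST}$ be the universal pre-additive category with objects $(Y,j)$, where $Y\subseteq X$ is locally closed and $j\in\{0,1\}=\mathbb Z/2$, generated, for each $j$, by morphisms $i_U^Y\colon(U,j)\to(Y,j)$ for $U$ relatively open in $Y$, $r_Y^C\colon(Y,j)\to(C,j)$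 for $C$ relatively closed in $Y$, and $\delta_C^U\colon(C,j)\to(U,j+1)$ for each boundary pair $(U,C)$, subject to the following relations in all degrees: 1. $i_Y^Y=r_Y^Y=\mathrm{id}$. 2. $r_{Y\cup Z}^Y i_Y^{Y\cup Z}+r_{Y\cup Z}^Z i_Z^{Y\cup Z}=\mathrm{id}$ if $Y,Z$ are topologically disjoint, that is, $\overline Y\cap Z=Y\cap\overline Z=\emptyset$. 3. $i_U^V i_V^Y=i_U^Y$ for $U\subseteq V\subseteq Y$ relatively open. 4. $r_Y^D r_D^C=r_Y^C$ for $C\subseteq D\subseteq Y$ relatively closed. 5. $i_U^Y r_Y^C=r_U^{U\cap C}i_{U\cap C}^C$ for $U$ relatively open and $C$ relatively closed in $Y$. 6. $i_{C'}^C\delta_C^U=\delta_{C'}^U$ for a boundary pair $(U,C)$ and $C'\subseteq C$ relatively open. 7. $\delta_C^U r_U^{U'}=\delta_C^{U'}$ for a boundary pair $(U,C)$ and $U'\subseteq U$ relatively closed. 8. $\delta_Y^{W\setminus Y}i_{W\setminus Y}^Z=r_Y^{W\setminus Z}\delta_{W\setminus Z}^Z$ for locally closed $Y,Z,W$ such that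 $Y\cup W$ is locally closed with $Y,W$ relatively closed in it, $Z\cup W$ is locally closed with $Z,W$ relatively open in it, and $W\subseteq Y\cup Z$. Let $\mathcal B$ be the universal pre-additive category with two objects $c_x$ and $o_x$ for each $x\in X$ (standing for $\overline{\{x\}}$ and $\widetilde{\{x\}}$), generated by morphisms $r_x^y\colon c_x\to c_y$, $\delta_y^x\colon c_y\to o_x$ and $i_x^y\colon o_x\to o_y$ whenever $x\to y$, subject to $$\sum_{x\to y}r_x^y\,\delta_y^x=\sum_{z\to x}\delta_x^z\,i_z^x\qquad(x\in X).$$ A *module* over one of these categories is an additive functor to abelian groups; module homomorphisms are natural transformations. An $\mathcal{ST}$-module $M$ is *exact* if for every locally closed $Y$, every relatively open $U\subseteq Y$ and $C=Y\setminus U$, the cyclic six-term sequence $$M(U,0)\xrightarrow{i}M(Y,0)\xrightarrow{r}M(C,0)\xrightarrow{\delta}M(U,1)\xrightarrow{i}M(Y,1)\xrightarrow{r}M(C,1)\xrightarrow{\delta}M(U,0)$$ is exact; it is *real-rank-zero-like* if all the maps $\delta\colon M(C,0)\to M(U,1)$ vanish. A $\mathcal B$-module $N$ is *exact* if for every $x\in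 X$ the sequence $$N(c_x)\xrightarrow{(r_x^y,\,-\delta_x^z)}\bigoplus_{x\to y}N(c_y)\oplus\bigoplus_{z\to x}N(o_z)\xrightarrow{(\delta_y^x,\,i_z^x)}N(o_x)$$ is exact. For a unique path space $X$, the assignment $c_x\mapsto(\overline{\{x\}},1)$, $o_x\mapsto(\widetilde{\{x\}},0)$, $r_x^y\mapsto r_{\overline{\{x\}}}^{\overline{\{y\}}}$, $\delta_y^x\mapsto\delta_{\overline{\{y\}}}^{\widetilde{\{x\}}}$, $i_x^y\mapsto i_{\widetilde{\{x\}}}^{\widetilde{\{y\}}}$ defines an additive functor $\mathcal B\to\mathcal{ST}$. Let $\mathfrak F\colon\mathfrak{Mod}(\mathcal{ST})\to\mathfrak{Mod}(\mathcal B)$ be the restriction functor along it. **Theorem.** Let $X$ be an EBP space. Then $\mathfrak F$ maps exact real-rank-zero-like $\mathcal{ST}$-modules to exact $\mathcal B$-modules, and it restricts to an equivalence between the full subcategory of exact real-rank-zero-like $\mathcal{ST}$-modules and the full subcategory of exact $\mathcal B$-modules. -/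

import Mathlib

open CategoryTheory

universe w u

namespace FilteredK

/-! ## Pre-additive categories given by generators and relations -/

section Presentation

/-- The smallest additive congruence on a pre-additive category containing a given relation
between parallel morphisms. -/
inductive AddCongruence {C : Type*} [Category* C] [Preadditive C] (ρ : HomRel C) : HomRel C
  | of {a b : C} {f g : a ⟶ b} : ρ f g → AddCongruence ρ f g
  | refl {a b : C} (f : a ⟶ b) : AddCongruence ρ f f
  | symm {a b : C} {f g : a ⟶ b} : AddCongruence ρ f g → AddCongruence ρ g f
  | trans {a b : C} {f g h : a ⟶ b} :
      AddCongruence ρ f g → AddCongruence ρ g h → AddCongruence ρ f h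
  | add {a b : C} {f₁ f₂ g₁ g₂ : a ⟶ b} :
      AddCongruence ρ f₁ f₂ → AddCongruence ρ g₁ g₂ → AddCongruence ρ (f₁ + g₁) (f₂ + g₂)
  | comp_left {a b c : C} (f : a ⟶ b) {g g' : b ⟶ c} :
      AddCongruence ρ g g' → AddCongruence ρ (f ≫ g) (f ≫ g')
  | comp_right {a b c : C} {f f' : a ⟶ b} (g : b ⟶ c) :
      AddCongruence ρ f f' → AddCongruence ρ (f ≫ g) (f' ≫ g)

instance {C : Type*} [Category* C] [Preadditive C] (ρ : HomRel C) :
    Congruence (AddCongruence ρ) where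
  comp_left f _ _ h := .comp_left f h
  comp_right g h := .comp_right g h
  equivalence := ⟨.refl, .symm, .trans⟩

/-- The free pre-additive category on a quiver `V`: its objects are the vertices, and its
morphisms from `a` to `b` are the formal `ℤ`-linear combinations of paths from `a` to `b`. -/
structure FreePreadd (V : Type u) : Type u where
  /-- A vertex as an object of the free pre-additive category. -/
  obj ::
  vertex : V

namespace FreePreadd

variable {V : Type u} [Quiver.{u} V]

/-- Composition: the bilinear extension of the concatenation of paths. -/
noncomputable def comp (a b c : V) :
    FreeAbelianGroup (Quiver.Path a b) →+ FreeAbelianGroup (Quiver.Path b c) →+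
      FreeAbelianGroup (Quiver.Path a c) :=
  FreeAbelianGroup.lift fun p => FreeAbelianGroup.lift fun q => FreeAbelianGroup.of (p.comp q)

@[simp]
theorem comp_of_of {a b c : V} (p : Quiver.Path a b) (q : Quiver.Path b c) :
    comp a b c (FreeAbelianGroup.of p) (FreeAbelianGroup.of q) =
      FreeAbelianGroup.of (p.comp q) := by
  simp [comp]

theorem comp_add_left (a b c : V) (f f' : FreeAbelianGroup (Quiver.Path a b))
    (g : FreeAbelianGroup (Quiver.Path b c)) :
    comp a b c (f + f') g = comp a b c f g + comp a b c f' g := by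
  rw [map_add, AddMonoidHom.add_apply]

theorem comp_add_right (a b c : V) (f : FreeAbelianGroup (Quiver.Path a b))
    (g g' : FreeAbelianGroup (Quiver.Path b c)) :
    comp a b c f (g + g') = comp a b c f g + comp a b c f g' := by
  rw [map_add]

noncomputable instance : Category.{u} (FreePreadd V) where
  Hom a b := FreeAbelianGroup (Quiver.Path a.vertex b.vertex)
  id a := FreeAbelianGroup.of Quiver.Path.nil
  comp {a b c} f g := comp a.vertex b.vertex c.vertex f g
  id_comp {a b} f := by
    induction f using FreeAbelianGroup.induction_on with
    | zero => simp
    | of p => simp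
    | neg p ih => simp
    | add f g hf hg => rw [map_add, hf, hg]
  comp_id {a b} f := by
    induction f using FreeAbelianGroup.induction_on with
    | zero => simp
    | of p => simp
    | neg p ih => simp
    | add f g hf hg => rw [map_add, AddMonoidHom.add_apply, hf, hg]
  assoc {a b c d} f g h := by
    induction f using FreeAbelianGroup.induction_on with
    | zero => simp
    | neg p ih => simp only [map_neg, AddMonoidHom.neg_apply, ih]
    | add f f' hf hf' => simp only [map_add, AddMonoidHom.add_apply, hf, hf']
    | of p =>
      induction g using FreeAbelianGroup.induction_on with
      | zero => simp
      | neg p ih => simp only [map_neg, AddMonoidHom.neg_apply, ih]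
      | add f f' hf hf' => simp only [map_add, AddMonoidHom.add_apply, hf, hf']
      | of q =>
        induction h using FreeAbelianGroup.induction_on with
        | zero => simp
        | neg p ih => simp only [map_neg, ih]
        | add f f' hf hf' => simp only [map_add, hf, hf']
        | of r => simp

noncomputable instance : Preadditive (FreePreadd V) where
  homGroup a b := inferInstanceAs (AddCommGroup (FreeAbelianGroup (Quiver.Path a.vertex b.vertex)))
  add_comp a b c := comp_add_left a.vertex b.vertex c.vertex
  comp_add a b c := comp_add_right a.vertex b.vertex c.vertex

/-- A path of the quiver as a morphism of the free pre-additive category. -/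
def ofPath {a b : V} (p : Quiver.Path a b) : obj a ⟶ obj b := FreeAbelianGroup.of p

/-- An arrow of the quiver as a morphism of the free pre-additive category. -/
def arr {a b : V} (e : a ⟶ b) : obj a ⟶ obj b := ofPath e.toPath

variable {D : Type*} [Category* D]

/-- The value of an assignment on the quiver at a path. -/
def pathMap (φ : V ⥤q D) {a : V} : {b : V} → Quiver.Path a b → (φ.obj a ⟶ φ.obj b)
  | _, .nil => 𝟙 _
  | _, .cons p e => pathMap φ p ≫ φ.map e

theorem pathMap_comp (φ : V ⥤q D) {a b c : V} (p : Quiver.Path a b) (q : Quiver.Path b c) :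
    pathMap φ (p.comp q) = pathMap φ p ≫ pathMap φ q := by
  induction q with
  | nil => simp [pathMap]
  | cons q e ih => simp [pathMap, ih]

variable [Preadditive D]

/-- The universal property of the free pre-additive category: an assignment on the quiver
extends to an additive functor. -/
noncomputable def lift (φ : V ⥤q D) : FreePreadd V ⥤ D where
  obj a := φ.obj a.vertex
  map {a b} f := FreeAbelianGroup.lift (fun p : Quiver.Path a.vertex b.vertex => pathMap φ p) f
  map_id a := FreeAbelianGroup.lift_apply_of _ _
  map_comp {a b c} f g := by
    change FreeAbelianGroup.lift _ (comp _ _ _ f g) = _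
    induction f using FreeAbelianGroup.induction_on with
    | zero => simp
    | neg p ih => simp only [map_neg, AddMonoidHom.neg_apply, ih, Preadditive.neg_comp]
    | add f f' hf hf' => simp only [map_add, AddMonoidHom.add_apply, hf, hf', Preadditive.add_comp]
    | of p =>
      induction g using FreeAbelianGroup.induction_on with
      | zero => simp
      | neg p ih => simp only [map_neg, ih, Preadditive.comp_neg]
      | add f f' hf hf' => simp only [map_add, hf, hf', Preadditive.comp_add]
      | of q => simp [pathMap_comp]

instance (φ : V ⥤q D) : (lift φ).Additive where
  map_add {a b f g} := map_add (FreeAbelianGroup.lift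
    (fun p : Quiver.Path a.vertex b.vertex => pathMap φ p)) f g

theorem lift_arr (φ : V ⥤q D) {a b : V} (e : a ⟶ b) : (lift φ).map (arr e) = φ.map e := by
  refine (FreeAbelianGroup.lift_apply_of _ _).trans ?_
  exact Category.id_comp _

end FreePreadd

variable {V : Type u} [Quiver.{u} V]

/-- The universal pre-additive category generated by the quiver `V` subject to the
relations `ρ`. -/
abbrev Presented (ρ : HomRel (FreePreadd V)) : Type u := Quotient (AddCongruence ρ)

noncomputable instance (ρ : HomRel (FreePreadd V)) : Preadditive (Presented ρ) :=
  Quotient.preadditive _ fun _ _ _ _ _ _ h₁ h₂ => .add h₁ h₂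

namespace Presented

/-- A generating object of the presented category. -/
noncomputable abbrev obj (ρ : HomRel (FreePreadd V)) (a : V) : Presented ρ :=
  (Quotient.functor (AddCongruence ρ)).obj (FreePreadd.obj a)

/-- A generating morphism of the presented category. -/
noncomputable abbrev arr (ρ : HomRel (FreePreadd V)) {a b : V} (e : a ⟶ b) :
    obj ρ a ⟶ obj ρ b :=
  (Quotient.functor (AddCongruence ρ)).map (FreePreadd.arr e)

instance (ρ : HomRel (FreePreadd V)) : (Quotient.functor (AddCongruence ρ)).Additive :=
  Quotient.functor_additive _ fun _ _ _ _ _ _ h₁ h₂ => .add h₁ h₂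

/-- Two related morphisms become equal in the presented category. -/
theorem sound {ρ : HomRel (FreePreadd V)} {a b : FreePreadd V} {f g : a ⟶ b} (h : ρ f g) :
    (Quotient.functor (AddCongruence ρ)).map f = (Quotient.functor (AddCongruence ρ)).map g :=
  CategoryTheory.Quotient.sound _ (.of h)

variable {D : Type*} [Category* D] [Preadditive D]

theorem lift_respects (ρ : HomRel (FreePreadd V)) (φ : V ⥤q D)
    (h : ∀ ⦃a b : FreePreadd V⦄ (f g : a ⟶ b), ρ f g →
      (FreePreadd.lift φ).map f = (FreePreadd.lift φ).map g)
    {a b : FreePreadd V} {f g : a ⟶ b} (hfg : AddCongruence ρ f g) :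
    (FreePreadd.lift φ).map f = (FreePreadd.lift φ).map g := by
  induction hfg with
  | of hr => exact h _ _ hr
  | refl => rfl
  | symm _ ih => exact ih.symm
  | trans _ _ ih₁ ih₂ => exact ih₁.trans ih₂
  | add _ _ ih₁ ih₂ => simp only [Functor.map_add, ih₁, ih₂]
  | comp_left f _ ih => simp only [Functor.map_comp, ih]
  | comp_right g _ ih => simp only [Functor.map_comp, ih]

/-- The universal property: an assignment on objects and generating morphisms that respects
the relations defines a functor on the presented category. -/
noncomputable def lift (ρ : HomRel (FreePreadd V)) (φ : V ⥤q D)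
    (h : ∀ ⦃a b : FreePreadd V⦄ (f g : a ⟶ b), ρ f g →
      (FreePreadd.lift φ).map f = (FreePreadd.lift φ).map g) : Presented ρ ⥤ D :=
  CategoryTheory.Quotient.lift _ (FreePreadd.lift φ)
    fun _ _ _ _ hfg => lift_respects ρ φ h hfg

instance (ρ : HomRel (FreePreadd V)) (φ : V ⥤q D)
    (h : ∀ ⦃a b : FreePreadd V⦄ (f g : a ⟶ b), ρ f g →
      (FreePreadd.lift φ).map f = (FreePreadd.lift φ).map g) : (lift ρ φ h).Additive where
  map_add := by
    rintro ⟨a⟩ ⟨b⟩ ⟨f⟩ ⟨g⟩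
    exact (FreePreadd.lift φ).map_add (f := f) (g := g)

end Presented

/-- Restriction of modules (additive functors to abelian groups) along an additive functor. -/
def restrictAlong {C D : Type*} [Category* C] [Category* D] [Preadditive C] [Preadditive D]
    (Φ : C ⥤ D) [Φ.Additive] : (D ⥤+ AddCommGrpCat.{w}) ⥤ (C ⥤+ AddCommGrpCat.{w}) :=
  ObjectProperty.lift _
    (AdditiveFunctor.forget D AddCommGrpCat.{w} ⋙
      (Functor.whiskeringLeft C D AddCommGrpCat.{w}).obj Φ)
    (fun M => by
      change (Φ ⋙ M.obj).Additive
      infer_instance)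

end Presentation

/-! ## Finite `T₀`-spaces -/

section Spaces

variable {X : Type u} [TopologicalSpace X]

/-- `x ≤ y` when the closure of `x` is contained in the closure of `y`. -/
def PtLE (x y : X) : Prop := closure {x} ⊆ closure {y}

/-- `x < y`. -/
def PtLT (x y : X) : Prop := PtLE x y ∧ x ≠ y

/-- `y → x`: one has `x < y` and there is nothing strictly in between. -/
def Arrow (y x : X) : Prop := PtLT x y ∧ ∀ z, ¬ (PtLT x z ∧ PtLT z y)

/-- `l` lists the points of a path from `y` to `x` (starting with `y`). -/
def IsPath (y x : X) (l : List X) : Prop :=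
  l.IsChain Arrow ∧ l.head? = some y ∧ l.getLast? = some x

/-- The set `U` is a relatively open subset of `Y`. -/
def IsRelOpen (U Y : Set X) : Prop := ∃ O, IsOpen O ∧ U = O ∩ Y

/-- The set `C` is a relatively closed subset of `Y`. -/
def IsRelClosed (C Y : Set X) : Prop := ∃ K, IsClosed K ∧ C = K ∩ Y

/-- `(U, C)` is a boundary pair: `U` is a relatively open subset of a locally closed set `Y`,
and `C = Y \ U`. -/
def IsBoundaryPair (U C : Set X) : Prop :=
  ∃ Y, IsLocallyClosed Y ∧ IsRelOpen U Y ∧ C = Y \ U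

/-- `Y` and `Z` are topologically disjoint: neither meets the closure of the other (so that
`Y ∪ Z` is the topological disjoint union of `Y` and `Z`). -/
def TopDisjoint (Y Z : Set X) : Prop := Disjoint (closure Y) Z ∧ Disjoint Y (closure Z)

/-- Elementary boundary pairs. Connected sets are non-empty; `nhdsKer S` is the smallest open
set containing `S` (in a finite space). -/
structure IsElementary (U C : Set X) : Prop where
  boundaryPair : IsBoundaryPair U C
  connected_left : IsConnected U
  connected_right : IsConnected C
  isOpen : IsOpen U
  isClosed : IsClosed C
  subset_nhdsKer : U ⊆ nhdsKer C
  subset_closure : C ⊆ closure U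

variable (X) in
/-- Unique path spaces: between any two points there is at most one path. -/
def UniquePath : Prop :=
  ∀ (x y : X) (l l' : List X), IsPath y x l → IsPath y x l' → l = l'

variable (X) in
/-- EBP spaces: unique path spaces in which every elementary boundary pair consists of the
smallest neighbourhood of a point `x` and the closure of a point `y` with `x → y`. -/
structure IsEBP : Prop where
  uniquePath : UniquePath X
  elementary : ∀ U C : Set X, IsElementary U C →
    ∃ x y : X, Arrow x y ∧ U = nhdsKer {x} ∧ C = closure {y}

variable (X) in
/-- The locally closed subsets of `X`. -/
abbrev LC : Type u := {Y : Set X // IsLocallyClosed Y}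

end Spaces

/-! ## Elementary facts about finite spaces

They are needed only to see that the categories `𝒮𝒯` and `ℬ` and the functor between them are
well defined. -/

section Geometry

variable {X : Type u} [TopologicalSpace X]

theorem ptLE_iff {x y : X} : PtLE x y ↔ y ⤳ x := specializes_iff_closure_subset.symm

theorem PtLE.refl (x : X) : PtLE x x := subset_rfl

theorem PtLE.trans {x y z : X} (h : PtLE x y) (h' : PtLE y z) : PtLE x z := Set.Subset.trans h h'

theorem PtLE.antisymm [T0Space X] {x y : X} (h : PtLE x y) (h' : PtLE y x) : x = y :=
  ((ptLE_iff.1 h').antisymm (ptLE_iff.1 h)).eq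

theorem mem_closure_pt {x y : X} : x ∈ closure {y} ↔ PtLE x y := by
  rw [ptLE_iff, specializes_iff_mem_closure]

theorem mem_nhdsKer_pt {x y : X} : x ∈ nhdsKer {y} ↔ PtLE y x := by
  rw [ptLE_iff, mem_nhdsKer_singleton]

theorem isOpen_iff_ptLE [Finite X] {U : Set X} :
    IsOpen U ↔ ∀ x y, PtLE x y → x ∈ U → y ∈ U := by
  rw [isOpen_iff_forall_specializes]
  simp only [ptLE_iff]
  exact ⟨fun h x y hxy hx => h y x hxy hx, fun h x y hxy hx => h y x hxy hx⟩

theorem isClosed_iff_ptLE [Finite X] {C : Set X} :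
    IsClosed C ↔ ∀ x y, PtLE x y → y ∈ C → x ∈ C := by
  rw [← isOpen_compl_iff, isOpen_iff_ptLE]
  exact ⟨fun h x y hxy hy => by_contra fun hx => h x y hxy hx hy,
    fun h x y hxy hx hy => hx (h x y hxy hy)⟩

theorem isRelOpen_iff [Finite X] {U Y : Set X} :
    IsRelOpen U Y ↔ U ⊆ Y ∧ ∀ x y, PtLE x y → x ∈ U → y ∈ Y → y ∈ U := by
  constructor
  · rintro ⟨O, hO, rfl⟩
    exact ⟨Set.inter_subset_right,
      fun x y hxy hx hy => ⟨isOpen_iff_ptLE.1 hO x y hxy hx.1, hy⟩⟩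
  · rintro ⟨hUY, h⟩
    refine ⟨{y | ∃ x ∈ U, PtLE x y}, isOpen_iff_ptLE.2 ?_, ?_⟩
    · rintro x y hxy ⟨z, hz, hzx⟩
      exact ⟨z, hz, hzx.trans hxy⟩
    · ext y
      exact ⟨fun hy => ⟨⟨y, hy, .refl y⟩, hUY hy⟩, fun ⟨⟨x, hx, hxy⟩, hy⟩ => h x y hxy hx hy⟩

theorem isRelClosed_iff [Finite X] {C Y : Set X} :
    IsRelClosed C Y ↔ C ⊆ Y ∧ ∀ x y, PtLE x y → y ∈ C → x ∈ Y → x ∈ C := by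
  constructor
  · rintro ⟨K, hK, rfl⟩
    exact ⟨Set.inter_subset_right,
      fun x y hxy hx hy => ⟨isClosed_iff_ptLE.1 hK x y hxy hx.1, hy⟩⟩
  · rintro ⟨hCY, h⟩
    refine ⟨{x | ∃ y ∈ C, PtLE x y}, isClosed_iff_ptLE.2 ?_, ?_⟩
    · rintro x y hxy ⟨z, hz, hzx⟩
      exact ⟨z, hz, hxy.trans hzx⟩
    · ext y
      exact ⟨fun hy => ⟨⟨y, hy, .refl y⟩, hCY hy⟩, fun ⟨⟨x, hx, hxy⟩, hy⟩ => h y x hxy hx hy⟩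

theorem isLocallyClosed_iff_ptLE [Finite X] {Y : Set X} :
    IsLocallyClosed Y ↔ ∀ a b c, PtLE a b → PtLE b c → a ∈ Y → c ∈ Y → b ∈ Y := by
  constructor
  · rintro ⟨O, K, hO, hK, rfl⟩ a b c hab hbc ha hc
    exact ⟨isOpen_iff_ptLE.1 hO a b hab ha.1, isClosed_iff_ptLE.1 hK b c hbc hc.2⟩
  · intro h
    refine ⟨{y | ∃ x ∈ Y, PtLE x y}, {x | ∃ y ∈ Y, PtLE x y}, isOpen_iff_ptLE.2 ?_,
      isClosed_iff_ptLE.2 ?_, ?_⟩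
    · rintro x y hxy ⟨z, hz, hzx⟩
      exact ⟨z, hz, hzx.trans hxy⟩
    · rintro x y hxy ⟨z, hz, hzx⟩
      exact ⟨z, hz, hxy.trans hzx⟩
    · ext y
      exact ⟨fun hy => ⟨⟨y, hy, .refl y⟩, ⟨y, hy, .refl y⟩⟩,
        fun ⟨⟨a, ha, hay⟩, ⟨c, hc, hyc⟩⟩ => h a y c hay hyc ha hc⟩

theorem isBoundaryPair_iff [Finite X] {U C : Set X} :
    IsBoundaryPair U C ↔ IsLocallyClosed (U ∪ C) ∧ Disjoint U C ∧
      ∀ x y, PtLE x y → x ∈ U → y ∉ C := by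
  constructor
  · rintro ⟨Y, hY, hU, rfl⟩
    rw [isRelOpen_iff] at hU
    rw [Set.union_sdiff_cancel hU.1]
    exact ⟨hY, Set.disjoint_sdiff_right, fun x y hxy hx hy => hy.2 (hU.2 x y hxy hx hy.1)⟩
  · rintro ⟨hY, hd, h⟩
    refine ⟨U ∪ C, hY, isRelOpen_iff.2 ⟨Set.subset_union_left, ?_⟩, ?_⟩
    · rintro x y hxy hx (hy | hy)
      · exact hy
      · exact absurd hy (h x y hxy hx)
    · rw [Set.union_sdiff_left, hd.sdiff_eq_right]

theorem topDisjoint_iff [Finite X] {Y Z : Set X} :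
    TopDisjoint Y Z ↔ ∀ y ∈ Y, ∀ z ∈ Z, ¬ PtLE y z ∧ ¬ PtLE z y := by
  have key : ∀ S : Set X, closure S = {x | ∃ y ∈ S, PtLE x y} := by
    intro S
    refine subset_antisymm (closure_minimal (fun y hy => ⟨y, hy, .refl y⟩)
      (isClosed_iff_ptLE.2 ?_)) ?_
    · rintro x y hxy ⟨z, hz, hyz⟩
      exact ⟨z, hz, hxy.trans hyz⟩
    · rintro x ⟨y, hy, hxy⟩
      exact closure_mono (Set.singleton_subset_iff.2 hy) (mem_closure_pt.2 hxy)
  simp only [TopDisjoint, key, Set.disjoint_left, Set.mem_ofPred_eq]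
  constructor
  · rintro ⟨h₁, h₂⟩ y hy z hz
    exact ⟨fun h => h₂ hy ⟨z, hz, h⟩, fun h => h₁ ⟨y, hy, h⟩ hz⟩
  · intro h
    exact ⟨fun z ⟨y, hy, hzy⟩ hz => (h y hy z hz).2 hzy,
      fun y hy ⟨z, hz, hyz⟩ => (h y hy z hz).1 hyz⟩

theorem IsPath.singleton (x : X) : IsPath x x [x] := by simp [IsPath]

theorem IsPath.cons {x y z : X} {l : List X} (h : Arrow x y) (hl : IsPath y z l) :
    IsPath x z (x :: l) := by
  obtain ⟨h₁, h₂, h₃⟩ := hl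
  cases l with
  | nil => simp at h₂
  | cons a l =>
    obtain rfl : a = y := by simpa using h₂
    exact ⟨List.isChain_cons_cons.2 ⟨h, h₁⟩, rfl, by simpa using h₃⟩

theorem exists_arrow_right [Finite X] [T0Space X] {x y : X} (h : PtLT x y) :
    ∃ z, Arrow y z ∧ PtLE x z := by
  let po : PartialOrder X :=
    { le := PtLE
      le_refl := PtLE.refl
      le_trans := fun _ _ _ => PtLE.trans
      le_antisymm := fun _ _ => PtLE.antisymm }
  have lt_iff : ∀ a b : X, a < b ↔ PtLT a b := fun a b => lt_iff_le_and_ne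
  obtain ⟨z, hxz, hzy⟩ := exists_le_covBy_of_lt ((lt_iff _ _).2 h)
  exact ⟨z, ⟨(lt_iff _ _).1 hzy.1, fun w hw =>
    hzy.2 ((lt_iff _ _).2 hw.1) ((lt_iff _ _).2 hw.2)⟩, hxz⟩

theorem exists_arrow_left [Finite X] [T0Space X] {x y : X} (h : PtLT x y) :
    ∃ z, Arrow z x ∧ PtLE z y := by
  let po : PartialOrder X :=
    { le := PtLE
      le_refl := PtLE.refl
      le_trans := fun _ _ _ => PtLE.trans
      le_antisymm := fun _ _ => PtLE.antisymm }
  have lt_iff : ∀ a b : X, a < b ↔ PtLT a b := fun a b => lt_iff_le_and_ne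
  obtain ⟨z, hxz, hzy⟩ := exists_covBy_le_of_lt ((lt_iff _ _).2 h)
  exact ⟨z, ⟨(lt_iff _ _).1 hxz.1, fun w hw =>
    hxz.2 ((lt_iff _ _).2 hw.1) ((lt_iff _ _).2 hw.2)⟩, hzy⟩

theorem exists_path_of_ptLE [Finite X] [T0Space X] {x y : X} (h : PtLE x y) :
    ∃ l, IsPath y x l := by
  have wf : WellFounded (PtLT (X := X)) := by
    have : IsTrans X PtLT := ⟨fun a b c hab hbc =>
      ⟨hab.1.trans hbc.1, fun hac => hab.2 (hab.1.antisymm (hac ▸ hbc.1))⟩⟩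
    have : Std.Irrefl (PtLT (X := X)) := ⟨fun a h => h.2 rfl⟩
    exact Finite.wellFounded_of_trans_of_irrefl _
  induction y using wf.induction with
  | _ y ih =>
    by_cases hxy : x = y
    · subst hxy
      exact ⟨_, .singleton x⟩
    · obtain ⟨z, hyz, hxz⟩ := exists_arrow_right ⟨h, hxy⟩
      obtain ⟨l, hl⟩ := ih z hyz.1 hxz
      exact ⟨_, .cons hyz hl⟩

theorem IsPath.append {d b a : X} {l l' : List X} (h : IsPath d b l) (h' : IsPath b a l') :
    ∃ m, IsPath d a m ∧ b ∈ m := by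
  induction l generalizing d with
  | nil => simp [IsPath] at h
  | cons c l ih =>
    obtain ⟨h₁, h₂, h₃⟩ := h
    obtain rfl : c = d := by simpa using h₂
    cases l with
    | nil =>
      obtain rfl : c = b := by simpa using h₃
      refine ⟨l', h', List.mem_of_mem_head? ?_⟩
      rw [h'.2.1]
      rfl
    | cons e l =>
      rw [List.isChain_cons_cons] at h₁
      obtain ⟨m, hm, hb⟩ := ih ⟨h₁.2, rfl, by simpa using h₃⟩
      exact ⟨c :: m, .cons h₁.1 hm, List.mem_cons_of_mem _ hb⟩

theorem IsPath.comparable {d a b c : X} {l : List X} (h : IsPath d a l) (hb : b ∈ l)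
    (hc : c ∈ l) : PtLE b c ∨ PtLE c b := by
  have : Trans (fun x y : X => PtLE y x) (fun x y : X => PtLE y x) (fun x y : X => PtLE y x) :=
    ⟨fun h h' => PtLE.trans h' h⟩
  have h₁ : l.IsChain (fun x y : X => PtLE y x) := h.1.imp fun _ _ h => h.1.1
  have h₂ := h₁.pairwise
  obtain ⟨m, hm, rfl⟩ := List.getElem_of_mem hb
  obtain ⟨n, hn, rfl⟩ := List.getElem_of_mem hc
  rw [List.pairwise_iff_getElem] at h₂
  rcases lt_trichotomy m n with h | h | h
  · exact .inr (h₂ m n hm hn h)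
  · subst h
    exact .inl (.refl _)
  · exact .inl (h₂ n m hn hm h)

/-- In a unique path space, every interval is totally ordered. -/
theorem UniquePath.comparable [Finite X] [T0Space X] (hX : UniquePath X) {a b c d : X}
    (hab : PtLE a b) (hbd : PtLE b d) (hac : PtLE a c) (hcd : PtLE c d) :
    PtLE b c ∨ PtLE c b := by
  obtain ⟨l₁, h₁⟩ := exists_path_of_ptLE hab
  obtain ⟨l₂, h₂⟩ := exists_path_of_ptLE hbd
  obtain ⟨l₃, h₃⟩ := exists_path_of_ptLE hac
  obtain ⟨l₄, h₄⟩ := exists_path_of_ptLE hcd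
  obtain ⟨m, hm, hb⟩ := h₂.append h₁
  obtain ⟨m', hm', hc⟩ := h₄.append h₃
  rw [hX _ _ _ _ hm' hm] at hc
  exact hm.comparable hb hc

theorem Arrow.eq_or_eq {x y w : X} (h : Arrow x y) (hyw : PtLE y w) (hwx : PtLE w x) :
    w = y ∨ w = x := by
  by_contra! hc
  exact h.2 w ⟨⟨hyw, hc.1.symm⟩, ⟨hwx, hc.2⟩⟩

variable [Finite X] [T0Space X]

theorem UniquePath.lc_star (hX : UniquePath X) (x : X) :
    IsLocallyClosed (nhdsKer {x} ∪ closure {x}) := by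
  rw [isLocallyClosed_iff_ptLE]
  simp only [Set.mem_union, mem_nhdsKer_pt, mem_closure_pt]
  rintro a b c hab hbc (ha | ha) (hc | hc)
  · exact .inl (ha.trans hab)
  · exact .inl (ha.trans hab)
  · exact (hX.comparable hab hbc ha hc).symm
  · exact .inr (hbc.trans hc)

theorem UniquePath.boundaryPair (hX : UniquePath X) {x y : X} (h : Arrow x y) :
    IsBoundaryPair (nhdsKer {x}) (closure {y}) := by
  have hxy : ¬ PtLE x y := fun h' => h.1.2 (h.1.1.antisymm h')
  rw [isBoundaryPair_iff, isLocallyClosed_iff_ptLE, Set.disjoint_left]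
  simp only [Set.mem_union, mem_nhdsKer_pt, mem_closure_pt]
  refine ⟨?_, fun a ha ha' => hxy (ha.trans ha'), fun a b hab ha hb => hxy (ha.trans (hab.trans hb))⟩
  rintro a b c hab hbc (ha | ha) (hc | hc)
  · exact .inl (ha.trans hab)
  · exact .inl (ha.trans hab)
  · rcases hX.comparable hab hbc (ha.trans h.1.1) hc with hb | hb
    · rcases hX.comparable hab hbc ha (h.1.1.trans hc) with hb' | hb'
      · exact .inr hb'
      · rcases h.eq_or_eq hb' hb with rfl | rfl
        · exact .inr (.refl _)
        · exact .inl (.refl _)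
    · exact .inl hb
  · exact .inr (hbc.trans hc)

theorem UniquePath.topDisjoint_cl (hX : UniquePath X) {x y y' : X} (h : Arrow x y)
    (h' : Arrow x y') (hne : y ≠ y') : TopDisjoint (closure {y}) (closure {y'}) := by
  have key : ∀ a, PtLE a y → PtLE a y' → False := by
    intro a ha ha'
    rcases hX.comparable ha h.1.1 ha' h'.1.1 with hc | hc
    · rcases h.eq_or_eq hc h'.1.1 with rfl | rfl
      · exact hne rfl
      · exact h'.1.2 rfl
    · rcases h'.eq_or_eq hc h.1.1 with rfl | rfl
      · exact hne rfl
      · exact h.1.2 rfl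
  rw [topDisjoint_iff]
  simp only [mem_closure_pt]
  exact fun a ha b hb => ⟨fun hab => key a ha (hab.trans hb), fun hba => key b (hba.trans ha) hb⟩

theorem UniquePath.topDisjoint_nb (hX : UniquePath X) {x z z' : X} (h : Arrow z x)
    (h' : Arrow z' x) (hne : z ≠ z') : TopDisjoint (nhdsKer {z}) (nhdsKer {z'}) := by
  have key : ∀ a, PtLE z a → PtLE z' a → False := by
    intro a ha ha'
    rcases hX.comparable h.1.1 ha h'.1.1 ha' with hc | hc
    · rcases h'.eq_or_eq h.1.1 hc with rfl | rfl
      · exact h.1.2 rfl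
      · exact hne rfl
    · rcases h.eq_or_eq h'.1.1 hc with rfl | rfl
      · exact h'.1.2 rfl
      · exact hne rfl
  rw [topDisjoint_iff]
  simp only [mem_nhdsKer_pt]
  exact fun a ha b hb => ⟨fun hab => key b (ha.trans hab) hb, fun hba => key a ha (hb.trans hba)⟩

theorem diff_singleton_eq_iUnion_cl (x : X) :
    closure {x} \ {x} = ⋃ y : {y : X // Arrow x y}, closure {y.1} := by
  ext a
  simp only [Set.mem_sdiff, Set.mem_singleton_iff, Set.mem_iUnion, mem_closure_pt, Subtype.exists,
    exists_prop]
  constructor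
  · exact fun h => exists_arrow_right h
  · rintro ⟨y, h, hay⟩
    refine ⟨hay.trans h.1.1, ?_⟩
    rintro rfl
    exact h.1.2 (h.1.1.antisymm hay)

theorem diff_singleton_eq_iUnion_nb (x : X) :
    nhdsKer {x} \ {x} = ⋃ z : {z : X // Arrow z x}, nhdsKer {z.1} := by
  ext a
  simp only [Set.mem_sdiff, Set.mem_singleton_iff, Set.mem_iUnion, mem_nhdsKer_pt, Subtype.exists,
    exists_prop]
  constructor
  · exact fun h => exists_arrow_left ⟨h.1, fun e => h.2 e.symm⟩
  · rintro ⟨z, h, hza⟩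
    refine ⟨h.1.1.trans hza, ?_⟩
    rintro rfl
    exact h.1.2 (h.1.1.antisymm hza)

end Geometry

/-! The next facts show that all the morphisms in the relations of `𝒮𝒯` below are defined. -/

section SideConditions

variable {X : Type u} [TopologicalSpace X] [Finite X]

theorem TopDisjoint.side {Y Z W : LC X} (hd : TopDisjoint Y.1 Z.1) (hW : W.1 = Y.1 ∪ Z.1) :
    IsRelClosed Y.1 W.1 ∧ IsRelOpen Y.1 W.1 ∧ IsRelClosed Z.1 W.1 ∧ IsRelOpen Z.1 W.1 := by
  rw [topDisjoint_iff] at hd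
  simp only [isRelClosed_iff, isRelOpen_iff, hW]
  grind

theorem TopDisjoint.isLocallyClosed_union {Y Z : LC X} (hd : TopDisjoint Y.1 Z.1) :
    IsLocallyClosed (Y.1 ∪ Z.1) := by
  have hY := isLocallyClosed_iff_ptLE.1 Y.2
  have hZ := isLocallyClosed_iff_ptLE.1 Z.2
  have ht := @PtLE.trans X _
  rw [topDisjoint_iff] at hd
  rw [isLocallyClosed_iff_ptLE]
  rintro a b c hab hbc (ha | ha) (hc | hc)
  · exact .inl (hY a b c hab hbc ha hc)
  · exact absurd (hab.trans hbc) (hd a ha c hc).1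
  · exact absurd (hab.trans hbc) (hd c hc a ha).2
  · exact .inr (hZ a b c hab hbc ha hc)

theorem IsRelOpen.trans {U V Y : LC X} (hUV : IsRelOpen U.1 V.1) (hVY : IsRelOpen V.1 Y.1) :
    IsRelOpen U.1 Y.1 := by
  simp only [isRelOpen_iff] at *
  grind

theorem IsRelClosed.trans {C D Y : LC X} (hCD : IsRelClosed C.1 D.1)
    (hDY : IsRelClosed D.1 Y.1) : IsRelClosed C.1 Y.1 := by
  simp only [isRelClosed_iff] at *
  grind

theorem IsRelOpen.side {U C Y V : LC X} (hU : IsRelOpen U.1 Y.1) (hC : IsRelClosed C.1 Y.1)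
    (hV : V.1 = U.1 ∩ C.1) : IsRelClosed V.1 U.1 ∧ IsRelOpen V.1 C.1 := by
  simp only [isRelOpen_iff, isRelClosed_iff, hV] at *
  grind

theorem IsBoundaryPair.side_left {U C C' : LC X} (h : IsBoundaryPair U.1 C.1)
    (hC' : IsRelOpen C'.1 C.1) : IsBoundaryPair U.1 C'.1 := by
  simp only [isRelOpen_iff, isBoundaryPair_iff, isLocallyClosed_iff_ptLE,
    Set.disjoint_left] at *
  grind

theorem IsBoundaryPair.side_right {U C U' : LC X} (h : IsBoundaryPair U.1 C.1)
    (hU' : IsRelClosed U'.1 U.1) : IsBoundaryPair U'.1 C.1 := by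
  simp only [isRelClosed_iff, isBoundaryPair_iff, isLocallyClosed_iff_ptLE,
    Set.disjoint_left] at *
  grind

theorem side_r_δ_i {Y Z W : LC X}
    (hYW : IsLocallyClosed (Y.1 ∪ W.1)) (hY : IsRelClosed Y.1 (Y.1 ∪ W.1))
    (hW : IsRelClosed W.1 (Y.1 ∪ W.1))
    (hZW : IsLocallyClosed (Z.1 ∪ W.1)) (hZ : IsRelOpen Z.1 (Z.1 ∪ W.1))
    (hW' : IsRelOpen W.1 (Z.1 ∪ W.1)) (hWYZ : W.1 ⊆ Y.1 ∪ Z.1) :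
    IsLocallyClosed (W.1 \ Y.1) ∧ IsLocallyClosed (W.1 \ Z.1) ∧
    IsBoundaryPair (W.1 \ Y.1) Y.1 ∧ IsRelOpen (W.1 \ Y.1) Z.1 ∧
      IsRelClosed (W.1 \ Z.1) Y.1 ∧ IsBoundaryPair Z.1 (W.1 \ Z.1) := by
  have h1 := isLocallyClosed_iff_ptLE.1 W.2
  have h2 := isLocallyClosed_iff_ptLE.1 Y.2
  have h3 := isLocallyClosed_iff_ptLE.1 Z.2
  rw [isLocallyClosed_iff_ptLE] at hYW hZW
  rw [isRelClosed_iff] at hY hW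
  rw [isRelOpen_iff] at hZ hW'
  have ht := @PtLE.trans X _
  simp only [isRelOpen_iff, isRelClosed_iff, isBoundaryPair_iff, isLocallyClosed_iff_ptLE,
    Set.disjoint_left, Set.sdiff_union_self, Set.union_sdiff_self]
  refine ⟨?_, ?_, ⟨?_, ?_, ?_⟩, ⟨?_, ?_⟩, ⟨?_, ?_⟩, ?_, ?_, ?_⟩ <;> grind

theorem boundaryPair_side {U Y C : LC X} (hU : IsRelOpen U.1 Y.1) (hC : C.1 = Y.1 \ U.1) :
    IsRelClosed C.1 Y.1 ∧ IsBoundaryPair U.1 C.1 := by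
  refine ⟨?_, ⟨Y.1, Y.2, hU, hC⟩⟩
  simp only [isRelOpen_iff, isRelClosed_iff, hC] at *
  grind

end SideConditions

/-! ## The category `𝒮𝒯` -/

section ST

variable (X : Type u) [TopologicalSpace X]

/-- The objects of `𝒮𝒯`: a locally closed subset together with a degree `0` or `1`. -/
structure STObj : Type u where
  carrier : LC X
  deg : ZMod 2

variable {X}

/-- The generating morphisms of `𝒮𝒯`: the degree-preserving `i_U^Y` and `r_Y^C`, and the
degree-shifting `δ_C^U`. -/
inductive STGen : STObj X → STObj X → Type u
  | i {U Y : LC X} (h : IsRelOpen U.1 Y.1) (j : ZMod 2) : STGen ⟨U, j⟩ ⟨Y, j⟩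
  | r {Y C : LC X} (h : IsRelClosed C.1 Y.1) (j : ZMod 2) : STGen ⟨Y, j⟩ ⟨C, j⟩
  | δ {U C : LC X} (h : IsBoundaryPair U.1 C.1) {j k : ZMod 2} (hjk : k = j + 1) :
      STGen ⟨C, j⟩ ⟨U, k⟩

instance : Quiver.{u} (STObj X) := ⟨STGen⟩

namespace FreeST

/-- `i_U^Y` in the free pre-additive category. -/
noncomputable def i {U Y : LC X} (h : IsRelOpen U.1 Y.1) (j : ZMod 2) :
    FreePreadd.obj (⟨U, j⟩ : STObj X) ⟶ FreePreadd.obj (⟨Y, j⟩ : STObj X) :=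
  FreePreadd.arr (STGen.i h j)

/-- `r_Y^C` in the free pre-additive category. -/
noncomputable def r {Y C : LC X} (h : IsRelClosed C.1 Y.1) (j : ZMod 2) :
    FreePreadd.obj (⟨Y, j⟩ : STObj X) ⟶ FreePreadd.obj (⟨C, j⟩ : STObj X) :=
  FreePreadd.arr (STGen.r h j)

/-- `δ_C^U` in the free pre-additive category. -/
noncomputable def δ {U C : LC X} (h : IsBoundaryPair U.1 C.1) {j k : ZMod 2} (hjk : k = j + 1) :
    FreePreadd.obj (⟨C, j⟩ : STObj X) ⟶ FreePreadd.obj (⟨U, k⟩ : STObj X) :=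
  FreePreadd.arr (STGen.δ h hjk)

end FreeST

open FreeST in
/-- The defining relations of `𝒮𝒯`, in every degree. Auxiliary sets such as `U ∩ C` appear as
variables constrained by an equation. The proofs that the morphisms occurring in a relation are
defined also appear as variables; such proofs always exist under the other hypotheses of the
relation, see `TopDisjoint.side`, `IsRelOpen.trans`, `IsRelClosed.trans`,
`IsRelOpen.side`, `IsBoundaryPair.side_left`, `IsBoundaryPair.side_right` and `side_r_δ_i`. -/
inductive STRel : HomRel (FreePreadd (STObj X))
  | i_self {Y : LC X} (h : IsRelOpen Y.1 Y.1) (j : ZMod 2) : STRel (i h j) (𝟙 _)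
  | r_self {Y : LC X} (h : IsRelClosed Y.1 Y.1) (j : ZMod 2) : STRel (r h j) (𝟙 _)
  | biproduct {Y Z W : LC X} (hd : TopDisjoint Y.1 Z.1) (hW : W.1 = Y.1 ∪ Z.1)
      (rY : IsRelClosed Y.1 W.1) (iY : IsRelOpen Y.1 W.1)
      (rZ : IsRelClosed Z.1 W.1) (iZ : IsRelOpen Z.1 W.1) (j : ZMod 2) :
      STRel (r rY j ≫ i iY j + r rZ j ≫ i iZ j) (𝟙 _)
  | i_i {U V Y : LC X} (hUV : IsRelOpen U.1 V.1) (hVY : IsRelOpen V.1 Y.1)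
      (hUY : IsRelOpen U.1 Y.1) (j : ZMod 2) : STRel (i hUV j ≫ i hVY j) (i hUY j)
  | r_r {C D Y : LC X} (hDY : IsRelClosed D.1 Y.1) (hCD : IsRelClosed C.1 D.1)
      (hCY : IsRelClosed C.1 Y.1) (j : ZMod 2) : STRel (r hDY j ≫ r hCD j) (r hCY j)
  | i_r {U C Y V : LC X} (hU : IsRelOpen U.1 Y.1) (hC : IsRelClosed C.1 Y.1)
      (hV : V.1 = U.1 ∩ C.1) (hVU : IsRelClosed V.1 U.1) (hVC : IsRelOpen V.1 C.1)
      (j : ZMod 2) : STRel (i hU j ≫ r hC j) (r hVU j ≫ i hVC j)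
  | i_δ {U C C' : LC X} (h : IsBoundaryPair U.1 C.1) (hC' : IsRelOpen C'.1 C.1)
      (h' : IsBoundaryPair U.1 C'.1) {j k : ZMod 2} (hjk : k = j + 1) :
      STRel (i hC' j ≫ δ h hjk) (δ h' hjk)
  | δ_r {U C U' : LC X} (h : IsBoundaryPair U.1 C.1) (hU' : IsRelClosed U'.1 U.1)
      (h' : IsBoundaryPair U'.1 C.1) {j k : ZMod 2} (hjk : k = j + 1) :
      STRel (δ h hjk ≫ r hU' k) (δ h' hjk)
  | r_δ_i {Y Z W A B : LC X}
      (hYW : IsLocallyClosed (Y.1 ∪ W.1)) (hY : IsRelClosed Y.1 (Y.1 ∪ W.1))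
      (hW : IsRelClosed W.1 (Y.1 ∪ W.1))
      (hZW : IsLocallyClosed (Z.1 ∪ W.1)) (hZ : IsRelOpen Z.1 (Z.1 ∪ W.1))
      (hW' : IsRelOpen W.1 (Z.1 ∪ W.1))
      (hWYZ : W.1 ⊆ Y.1 ∪ Z.1) (hA : A.1 = W.1 \ Y.1) (hB : B.1 = W.1 \ Z.1)
      (hAY : IsBoundaryPair A.1 Y.1) (hAZ : IsRelOpen A.1 Z.1)
      (hBY : IsRelClosed B.1 Y.1) (hZB : IsBoundaryPair Z.1 B.1) {j k : ZMod 2}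
      (hjk : k = j + 1) :
      STRel (δ hAY hjk ≫ i hAZ k) (r hBY j ≫ δ hZB hjk)

variable (X) in
/-- The category `𝒮𝒯`. -/
abbrev ST : Type u := Presented (STRel (X := X))

namespace ST

/-- The object `(Y, j)` of `𝒮𝒯`. -/
noncomputable abbrev obj (Y : LC X) (j : ZMod 2) : ST X := Presented.obj STRel (⟨Y, j⟩ : STObj X)

/-- `i_U^Y` in degree `j`. -/
noncomputable def i {U Y : LC X} (h : IsRelOpen U.1 Y.1) (j : ZMod 2) : obj U j ⟶ obj Y j :=
  Presented.arr STRel (STGen.i h j)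

/-- `r_Y^C` in degree `j`. -/
noncomputable def r {Y C : LC X} (h : IsRelClosed C.1 Y.1) (j : ZMod 2) : obj Y j ⟶ obj C j :=
  Presented.arr STRel (STGen.r h j)

/-- `δ_C^U` from degree `j` to the other degree `k`. -/
noncomputable def δ {U C : LC X} (h : IsBoundaryPair U.1 C.1) {j k : ZMod 2} (hjk : k = j + 1) :
    obj C j ⟶ obj U k :=
  Presented.arr STRel (STGen.δ h hjk)

end ST

variable (X) in
/-- The category of `𝒮𝒯`-modules, that is, additive functors from `𝒮𝒯` to abelian groups. -/
abbrev STMod := ST X ⥤+ AddCommGrpCat.{w}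

/-- Exact `𝒮𝒯`-modules: for `U` relatively open in `Y` and `C = Y \ U`, the cyclic six-term
sequence is exact (at each of its six places, as `j` ranges over the two degrees). -/
def STExact (M : STMod.{w} X) : Prop :=
  ∀ (U Y C : LC X) (hU : IsRelOpen U.1 Y.1) (hC : IsRelClosed C.1 Y.1)
    (hUC : IsBoundaryPair U.1 C.1), C.1 = Y.1 \ U.1 → ∀ (j k : ZMod 2) (hjk : k = j + 1),
    Function.Exact (M.obj.map (ST.i hU j)) (M.obj.map (ST.r hC j)) ∧
    Function.Exact (M.obj.map (ST.r hC j)) (M.obj.map (ST.δ hUC hjk)) ∧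
    Function.Exact (M.obj.map (ST.δ hUC hjk)) (M.obj.map (ST.i hU k))

/-- Real-rank-zero-like `𝒮𝒯`-modules: all `δ` from degree `0` to degree `1` vanish. -/
def STRealRankZeroLike (M : STMod.{w} X) : Prop :=
  ∀ (U C : LC X) (h : IsBoundaryPair U.1 C.1),
    M.obj.map (ST.δ h (j := 0) (k := 1) (by decide)) = 0

end ST

/-! ## The category `ℬ` -/

section B

variable (X : Type u)

/-- The objects of `ℬ`: two for each point `x`, one for the closure of `x` and one for the
smallest neighbourhood of `x`. -/
inductive BObj : Type u
  | cl (x : X)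
  | nb (x : X)

variable {X} [TopologicalSpace X]

/-- The generating morphisms of `ℬ`, for `x → y`. -/
inductive BGen : BObj X → BObj X → Type u
  | r {x y : X} (h : Arrow x y) : BGen (.cl x) (.cl y)
  | δ {x y : X} (h : Arrow x y) : BGen (.cl y) (.nb x)
  | i {x y : X} (h : Arrow x y) : BGen (.nb x) (.nb y)

instance : Quiver.{u} (BObj X) := ⟨BGen⟩

noncomputable instance [Finite X] (x : X) : Fintype {y : X // Arrow x y} := Fintype.ofFinite _

noncomputable instance [Finite X] (x : X) : Fintype {z : X // Arrow z x} := Fintype.ofFinite _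

namespace FreeB

/-- The generator `r` in the free pre-additive category. -/
noncomputable def r {x y : X} (h : Arrow x y) :
    FreePreadd.obj (BObj.cl x) ⟶ FreePreadd.obj (BObj.cl y) := FreePreadd.arr (BGen.r h)

/-- The generator `δ` in the free pre-additive category. -/
noncomputable def δ {x y : X} (h : Arrow x y) :
    FreePreadd.obj (BObj.cl y) ⟶ FreePreadd.obj (BObj.nb x) := FreePreadd.arr (BGen.δ h)

/-- The generator `i` in the free pre-additive category. -/
noncomputable def i {x y : X} (h : Arrow x y) :
    FreePreadd.obj (BObj.nb x) ⟶ FreePreadd.obj (BObj.nb y) := FreePreadd.arr (BGen.i h)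

end FreeB

variable [Finite X]

open FreeB in
/-- The defining relations of `ℬ`, one for each point. -/
inductive BRel : HomRel (FreePreadd (BObj X))
  | rel (x : X) : BRel (∑ y : {y : X // Arrow x y}, r y.2 ≫ δ y.2)
      (∑ z : {z : X // Arrow z x}, δ z.2 ≫ i z.2)

variable (X) in
/-- The category `ℬ`. -/
abbrev BCat : Type u := Presented (BRel (X := X))

namespace BCat

/-- The object of `ℬ` given by the closure of `x`. -/
noncomputable abbrev cl (x : X) : BCat X := Presented.obj BRel (BObj.cl x)

/-- The object of `ℬ` given by the smallest neighbourhood of `x`. -/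
noncomputable abbrev nb (x : X) : BCat X := Presented.obj BRel (BObj.nb x)

/-- The generator `r` of `ℬ`. -/
noncomputable def r {x y : X} (h : Arrow x y) : cl x ⟶ cl y := Presented.arr BRel (BGen.r h)

/-- The generator `δ` of `ℬ`. -/
noncomputable def δ {x y : X} (h : Arrow x y) : cl y ⟶ nb x := Presented.arr BRel (BGen.δ h)

/-- The generator `i` of `ℬ`. -/
noncomputable def i {x y : X} (h : Arrow x y) : nb x ⟶ nb y := Presented.arr BRel (BGen.i h)

end BCat

variable (X) in
/-- The category of `ℬ`-modules, that is, additive functors from `ℬ` to abelian groups. -/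
abbrev BMod := BCat X ⥤+ AddCommGrpCat.{w}

/-- The map `(r, -δ)` from `M(cl x)` to `(⨁_{x → y} M(cl y)) ⊕ (⨁_{z → x} M(nb z))`; finite
direct sums are written as products. -/
noncomputable def BMod.fst (M : BMod.{w} X) (x : X) (m : M.obj.obj (BCat.cl x)) :
    ((y : {y : X // Arrow x y}) → M.obj.obj (BCat.cl y.1)) ×
      ((z : {z : X // Arrow z x}) → M.obj.obj (BCat.nb z.1)) :=
  (fun y => M.obj.map (BCat.r y.2) m, fun z => - M.obj.map (BCat.δ z.2) m)

/-- The map with components `δ` and `i` from `(⨁_{x → y} M(cl y)) ⊕ (⨁_{z → x} M(nb z))` to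
`M(nb x)`. -/
noncomputable def BMod.snd (M : BMod.{w} X) (x : X)
    (p : ((y : {y : X // Arrow x y}) → M.obj.obj (BCat.cl y.1)) ×
      ((z : {z : X // Arrow z x}) → M.obj.obj (BCat.nb z.1))) : M.obj.obj (BCat.nb x) :=
  ∑ y : {y : X // Arrow x y}, M.obj.map (BCat.δ y.2) (p.1 y) +
    ∑ z : {z : X // Arrow z x}, M.obj.map (BCat.i z.2) (p.2 z)

/-- Exact `ℬ`-modules. -/
def BExact (M : BMod.{w} X) : Prop := ∀ x : X, Function.Exact (BMod.fst M x) (BMod.snd M x)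

end B

/-! ## The functor from `ℬ` to `𝒮𝒯` -/

section Functor

variable {X : Type u} [TopologicalSpace X]

namespace ST

theorem i_self {Y : LC X} (h : IsRelOpen Y.1 Y.1) (j : ZMod 2) : i h j = 𝟙 _ :=
  (Presented.sound (STRel.i_self h j)).trans ((Quotient.functor (AddCongruence STRel)).map_id _)

theorem r_self {Y : LC X} (h : IsRelClosed Y.1 Y.1) (j : ZMod 2) : r h j = 𝟙 _ :=
  (Presented.sound (STRel.r_self h j)).trans ((Quotient.functor (AddCongruence STRel)).map_id _)

theorem biproduct {Y Z W : LC X} (hd : TopDisjoint Y.1 Z.1) (hW : W.1 = Y.1 ∪ Z.1)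
    (rY : IsRelClosed Y.1 W.1) (iY : IsRelOpen Y.1 W.1)
    (rZ : IsRelClosed Z.1 W.1) (iZ : IsRelOpen Z.1 W.1) (j : ZMod 2) :
    r rY j ≫ i iY j + r rZ j ≫ i iZ j = 𝟙 _ := by
  have := Presented.sound (STRel.biproduct hd hW rY iY rZ iZ j)
  rw [Functor.map_add, Functor.map_comp, Functor.map_comp, CategoryTheory.Functor.map_id] at this
  exact this

theorem i_i {U V Y : LC X} (hUV : IsRelOpen U.1 V.1) (hVY : IsRelOpen V.1 Y.1)
    (hUY : IsRelOpen U.1 Y.1) (j : ZMod 2) : i hUV j ≫ i hVY j = i hUY j :=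
  (Functor.map_comp _ _ _).symm.trans (Presented.sound (STRel.i_i hUV hVY hUY j))

theorem r_r {C D Y : LC X} (hDY : IsRelClosed D.1 Y.1) (hCD : IsRelClosed C.1 D.1)
    (hCY : IsRelClosed C.1 Y.1) (j : ZMod 2) : r hDY j ≫ r hCD j = r hCY j :=
  (Functor.map_comp _ _ _).symm.trans (Presented.sound (STRel.r_r hDY hCD hCY j))

theorem i_δ {U C C' : LC X} (h : IsBoundaryPair U.1 C.1) (hC' : IsRelOpen C'.1 C.1)
    (h' : IsBoundaryPair U.1 C'.1) {j k : ZMod 2} (hjk : k = j + 1) :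
    i hC' j ≫ δ h hjk = δ h' hjk :=
  (Functor.map_comp _ _ _).symm.trans (Presented.sound (STRel.i_δ h hC' h' hjk))

theorem δ_r {U C U' : LC X} (h : IsBoundaryPair U.1 C.1) (hU' : IsRelClosed U'.1 U.1)
    (h' : IsBoundaryPair U'.1 C.1) {j k : ZMod 2} (hjk : k = j + 1) :
    δ h hjk ≫ r hU' k = δ h' hjk :=
  (Functor.map_comp _ _ _).symm.trans (Presented.sound (STRel.δ_r h hU' h' hjk))

theorem r_δ_i {Y Z W A B : LC X}
    (hYW : IsLocallyClosed (Y.1 ∪ W.1)) (hY : IsRelClosed Y.1 (Y.1 ∪ W.1))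
    (hW : IsRelClosed W.1 (Y.1 ∪ W.1))
    (hZW : IsLocallyClosed (Z.1 ∪ W.1)) (hZ : IsRelOpen Z.1 (Z.1 ∪ W.1))
    (hW' : IsRelOpen W.1 (Z.1 ∪ W.1))
    (hWYZ : W.1 ⊆ Y.1 ∪ Z.1) (hA : A.1 = W.1 \ Y.1) (hB : B.1 = W.1 \ Z.1)
    (hAY : IsBoundaryPair A.1 Y.1) (hAZ : IsRelOpen A.1 Z.1)
    (hBY : IsRelClosed B.1 Y.1) (hZB : IsBoundaryPair Z.1 B.1) {j k : ZMod 2}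
    (hjk : k = j + 1) : δ hAY hjk ≫ i hAZ k = r hBY j ≫ δ hZB hjk :=
  (Functor.map_comp _ _ _).symm.trans ((Presented.sound (STRel.r_δ_i hYW hY hW hZW hZ hW' hWYZ
    hA hB hAY hAZ hBY hZB hjk)).trans (Functor.map_comp _ _ _))

variable [Finite X]

/-- A locally closed set that is a finite union of pairwise topologically disjoint locally closed
sets is their biproduct in `𝒮𝒯`. -/
theorem sum_r_i {ι : Type*} [Fintype ι] (Y : ι → LC X) (W : LC X)
    (hY : Pairwise fun a b => TopDisjoint (Y a).1 (Y b).1) (hW : W.1 = ⋃ a, (Y a).1)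
    (hr : ∀ a, IsRelClosed (Y a).1 W.1) (hi : ∀ a, IsRelOpen (Y a).1 W.1) (j : ZMod 2) :
    ∑ a, r (hr a) j ≫ i (hi a) j = 𝟙 (obj W j) := by
  classical
  have key : ∀ (s : Finset ι) (S : LC X) (_ : S.1 = ⋃ a ∈ s, (Y a).1)
      (hrS : IsRelClosed S.1 W.1) (hiS : IsRelOpen S.1 W.1),
      ∑ a ∈ s, r (hr a) j ≫ i (hi a) j = r hrS j ≫ i hiS j := by
    intro s
    induction s using Finset.induction_on with
    | empty =>
      intro S hS hrS hiS
      have hS' : S.1 = ∅ := by simpa using hS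
      have h₁ : IsRelClosed S.1 S.1 := isRelClosed_iff.2 ⟨subset_rfl, fun _ _ _ _ h => h⟩
      have h₂ : IsRelOpen S.1 S.1 := isRelOpen_iff.2 ⟨subset_rfl, fun _ _ _ _ h => h⟩
      have h₃ := biproduct (Y := S) (Z := S) (W := S) (by simp [topDisjoint_iff, hS'])
        (Set.union_self _).symm h₁ h₂ h₁ h₂ j
      have h₄ : (𝟙 (obj S j)) = 0 := by
        rw [r_self, i_self, Category.comp_id] at h₃
        simpa using h₃
      rw [Finset.sum_empty, ← Category.id_comp (i hiS j), h₄]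
      simp
    | insert a s ha ih =>
      intro S hS hrS hiS
      have hTS : (⋃ b ∈ s, (Y b).1) ⊆ S.1 := by
        rw [hS]
        exact Set.biUnion_mono (fun b hb => Finset.mem_insert_of_mem hb) fun _ _ => subset_rfl
      have hSW := (isRelOpen_iff.1 hiS).1
      have hrT : IsRelClosed (⋃ b ∈ s, (Y b).1) W.1 := by
        refine isRelClosed_iff.2 ⟨hTS.trans hSW, fun x y hxy hy hx => ?_⟩
        simp only [Set.mem_iUnion] at hy ⊢
        obtain ⟨b, hb, hy⟩ := hy
        exact ⟨b, hb, (isRelClosed_iff.1 (hr b)).2 x y hxy hy hx⟩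
      have hiT : IsRelOpen (⋃ b ∈ s, (Y b).1) W.1 := by
        refine isRelOpen_iff.2 ⟨hTS.trans hSW, fun x y hxy hy hx => ?_⟩
        simp only [Set.mem_iUnion] at hy ⊢
        obtain ⟨b, hb, hy⟩ := hy
        exact ⟨b, hb, (isRelOpen_iff.1 (hi b)).2 x y hxy hy hx⟩
      have hT : IsLocallyClosed (⋃ b ∈ s, (Y b).1) := by
        refine isLocallyClosed_iff_ptLE.2 fun p q t hpq hqt hp ht => ?_
        have hq : q ∈ W.1 := isLocallyClosed_iff_ptLE.1 W.2 p q t hpq hqt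
          (hSW (hTS hp)) (hSW (hTS ht))
        exact (isRelOpen_iff.1 hiT).2 p q hpq hp hq
      let T : LC X := ⟨_, hT⟩
      have hYS : (Y a).1 ⊆ S.1 := by
        rw [hS]
        exact Set.subset_biUnion_of_mem (u := fun b => (Y b).1) (Finset.mem_insert_self a s)
      have cl : ∀ Z : Set X, Z ⊆ S.1 → IsRelClosed Z W.1 → IsRelClosed Z S.1 := fun Z hZ h =>
        isRelClosed_iff.2 ⟨hZ, fun x y hxy hy hx =>
          (isRelClosed_iff.1 h).2 x y hxy hy (hSW hx)⟩
      have op : ∀ Z : Set X, Z ⊆ S.1 → IsRelOpen Z W.1 → IsRelOpen Z S.1 := fun Z hZ h =>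
        isRelOpen_iff.2 ⟨hZ, fun x y hxy hy hx => (isRelOpen_iff.1 h).2 x y hxy hy (hSW hx)⟩
      have hd : TopDisjoint (Y a).1 T.1 := by
        rw [topDisjoint_iff]
        intro y hy z hz
        simp only [T, Set.mem_iUnion] at hz
        obtain ⟨b, hb, hz⟩ := hz
        exact topDisjoint_iff.1 (hY (fun h : a = b => ha (h ▸ hb))) y hy z hz
      have hST : S.1 = (Y a).1 ∪ T.1 := by rw [hS, Finset.set_biUnion_insert]
      have h := biproduct hd hST (cl _ hYS (hr a)) (op _ hYS (hi a)) (cl T.1 hTS hrT)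
        (op T.1 hTS hiT) j
      rw [Finset.sum_insert ha, ih T rfl hrT hiT, ← Category.id_comp (i hiS j), ← h,
        ← r_r hrS (cl _ hYS (hr a)) (hr a), ← r_r hrS (cl T.1 hTS hrT) hrT,
        ← i_i (op _ hYS (hi a)) hiS (hi a), ← i_i (op T.1 hTS hiT) hiS hiT]
      simp
  have hr' : IsRelClosed W.1 W.1 := isRelClosed_iff.2 ⟨subset_rfl, fun _ _ _ _ h => h⟩
  have hi' : IsRelOpen W.1 W.1 := isRelOpen_iff.2 ⟨subset_rfl, fun _ _ _ _ h => h⟩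
  rw [key Finset.univ W (by simpa using hW) hr' hi', r_self, i_self, Category.comp_id]

end ST

variable [Finite X]

/-- The closure of a point, as a locally closed set. -/
def clLC (x : X) : LC X := ⟨closure {x}, isClosed_closure.isLocallyClosed⟩

/-- The smallest neighbourhood of a point, as a locally closed set. -/
def nbLC (x : X) : LC X := ⟨nhdsKer {x}, isOpen_nhdsKer.isLocallyClosed⟩

theorem clLC_rel {x y : X} (h : Arrow x y) : IsRelClosed (clLC y).1 (clLC x).1 :=
  isRelClosed_iff.2 ⟨h.1.1, fun _ _ hab hb _ =>
    mem_closure_pt.2 (hab.trans (mem_closure_pt.1 hb))⟩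

theorem nbLC_rel {x y : X} (h : Arrow x y) : IsRelOpen (nbLC x).1 (nbLC y).1 :=
  isRelOpen_iff.2 ⟨fun _ ha => mem_nhdsKer_pt.2 (h.1.1.trans (mem_nhdsKer_pt.1 ha)),
    fun _ _ hab ha _ => mem_nhdsKer_pt.2 ((mem_nhdsKer_pt.1 ha).trans hab)⟩

variable [T0Space X]

/-- The defining relations of `ℬ` hold in `𝒮𝒯`. -/
theorem ST.base_relation (hX : UniquePath X) (x : X) :
    ∑ y : {y : X // Arrow x y}, ST.r (clLC_rel y.2) 1 ≫
        ST.δ (U := nbLC x) (C := clLC y.1) (hX.boundaryPair y.2) (k := 0) (by decide) =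
      ∑ z : {z : X // Arrow z x},
        ST.δ (U := nbLC z.1) (C := clLC x) (hX.boundaryPair z.2) (by decide) ≫
          ST.i (nbLC_rel z.2) 0 := by
  have hstar := hX.lc_star x
  have ltcl : ∀ a b : X, PtLE a b → b ∈ closure {x} \ {x} → a ∈ closure {x} \ {x} := by
    simp only [Set.mem_sdiff, Set.mem_singleton_iff, mem_closure_pt]
    rintro a b hab ⟨hb, hne⟩
    exact ⟨hab.trans hb, fun e => hne (hb.antisymm (e ▸ hab))⟩
  have gtnb : ∀ a b : X, PtLE a b → a ∈ nhdsKer {x} \ {x} → b ∈ nhdsKer {x} \ {x} := by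
    simp only [Set.mem_sdiff, Set.mem_singleton_iff, mem_nhdsKer_pt]
    rintro a b hab ⟨ha, hne⟩
    exact ⟨ha.trans hab, fun e => hne ((e ▸ hab : PtLE a x).antisymm ha)⟩
  let B : LC X := ⟨closure {x} \ {x},
    (isClosed_iff_ptLE.2 ltcl).isLocallyClosed⟩
  let A : LC X := ⟨nhdsKer {x} \ {x},
    (isOpen_iff_ptLE.2 gtnb).isLocallyClosed⟩
  let W : LC X := ⟨nhdsKer {x} ∪ closure {x}, hstar⟩
  have hB : B.1 = W.1 \ (nbLC x).1 := by
    ext a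
    simp only [B, W, nbLC, Set.mem_sdiff, Set.mem_singleton_iff, Set.mem_union, mem_closure_pt,
      mem_nhdsKer_pt]
    constructor
    · exact fun h => ⟨.inr h.1, fun h' => h.2 (h.1.antisymm h')⟩
    · rintro ⟨h | h, h'⟩
      · exact absurd h h'
      · exact ⟨h, fun e => h' (e ▸ .refl _)⟩
  have hA : A.1 = W.1 \ (clLC x).1 := by
    ext a
    simp only [A, W, clLC, Set.mem_sdiff, Set.mem_singleton_iff, Set.mem_union, mem_closure_pt,
      mem_nhdsKer_pt]
    constructor
    · exact fun h => ⟨.inl h.1, fun h' => h.2 (h'.antisymm h.1)⟩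
    · rintro ⟨h | h, h'⟩
      · exact ⟨h, fun e => h' (e ▸ .refl _)⟩
      · exact absurd h h'
  have hclW : (clLC x).1 ∪ W.1 = W.1 := Set.union_eq_right.2 Set.subset_union_right
  have hnbW : (nbLC x).1 ∪ W.1 = W.1 := Set.union_eq_right.2 Set.subset_union_left
  have hBcl : IsRelClosed B.1 (clLC x).1 :=
    isRelClosed_iff.2 ⟨Set.sdiff_subset, fun a b hab hb _ => ltcl a b hab hb⟩
  have hAnb : IsRelOpen A.1 (nbLC x).1 :=
    isRelOpen_iff.2 ⟨Set.sdiff_subset, fun a b hab ha _ => gtnb a b hab ha⟩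
  have hnbo : IsRelOpen (nbLC x).1 W.1 := ⟨nhdsKer {x}, isOpen_nhdsKer,
    (Set.inter_eq_left.2 Set.subset_union_left).symm⟩
  have hclc : IsRelClosed (clLC x).1 W.1 := ⟨closure {x}, isClosed_closure,
    (Set.inter_eq_left.2 Set.subset_union_right).symm⟩
  have hWo : IsRelOpen W.1 W.1 := isRelOpen_iff.2 ⟨subset_rfl, fun _ _ _ _ h => h⟩
  have hWc : IsRelClosed W.1 W.1 := isRelClosed_iff.2 ⟨subset_rfl, fun _ _ _ _ h => h⟩
  have hnbB : IsBoundaryPair (nbLC x).1 B.1 := ⟨W.1, W.2, hnbo, hB⟩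
  have hAcl : IsBoundaryPair A.1 (clLC x).1 := by
    refine ⟨W.1, W.2, isRelOpen_iff.2 ⟨hA ▸ Set.sdiff_subset, fun a b hab ha _ => gtnb a b hab ha⟩,
      ?_⟩
    rw [hA, Set.sdiff_sdiff_cancel_left]
    exact Set.subset_union_right
  have hBU : B.1 = ⋃ y : {y : X // Arrow x y}, (clLC y.1).1 := diff_singleton_eq_iUnion_cl x
  have hAU : A.1 = ⋃ z : {z : X // Arrow z x}, (nbLC z.1).1 := diff_singleton_eq_iUnion_nb x
  have rB : ∀ y : {y : X // Arrow x y}, IsRelClosed (clLC y.1).1 B.1 := fun y =>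
    ⟨closure {y.1}, isClosed_closure, (Set.inter_eq_left.2
      (hBU ▸ Set.subset_iUnion (fun y : {y : X // Arrow x y} => (clLC y.1).1) y)).symm⟩
  have iA : ∀ z : {z : X // Arrow z x}, IsRelOpen (nbLC z.1).1 A.1 := fun z =>
    ⟨nhdsKer {z.1}, isOpen_nhdsKer, (Set.inter_eq_left.2
      (hAU ▸ Set.subset_iUnion (fun z : {z : X // Arrow z x} => (nbLC z.1).1) z)).symm⟩
  have dB : Pairwise fun y y' : {y : X // Arrow x y} =>
      TopDisjoint (clLC y.1).1 (clLC y'.1).1 := fun y y' h =>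
    hX.topDisjoint_cl y.2 y'.2 fun e => h (Subtype.ext e)
  have dA : Pairwise fun z z' : {z : X // Arrow z x} =>
      TopDisjoint (nbLC z.1).1 (nbLC z'.1).1 := fun z z' h =>
    hX.topDisjoint_nb z.2 z'.2 fun e => h (Subtype.ext e)
  have iB : ∀ y : {y : X // Arrow x y}, IsRelOpen (clLC y.1).1 B.1 := fun y => by
    refine isRelOpen_iff.2 ⟨(isRelClosed_iff.1 (rB y)).1, fun a b hab ha hb => ?_⟩
    rw [hBU, Set.mem_iUnion] at hb
    obtain ⟨y', hb⟩ := hb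
    by_cases hyy : y = y'
    · exact hyy ▸ hb
    · exact absurd hab (topDisjoint_iff.1 (dB hyy) a ha b hb).1
  have rA : ∀ z : {z : X // Arrow z x}, IsRelClosed (nbLC z.1).1 A.1 := fun z => by
    refine isRelClosed_iff.2 ⟨(isRelOpen_iff.1 (iA z)).1, fun a b hab hb ha => ?_⟩
    rw [hAU, Set.mem_iUnion] at ha
    obtain ⟨z', ha⟩ := ha
    by_cases hzz : z = z'
    · exact hzz ▸ ha
    · exact absurd hab (topDisjoint_iff.1 (dA hzz) b hb a ha).2
  have e10 : (0 : ZMod 2) = 1 + 1 := by decide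
  have hl : ∀ y : {y : X // Arrow x y}, ST.r (clLC_rel y.2) 1 ≫
      ST.δ (U := nbLC x) (C := clLC y.1) (hX.boundaryPair y.2) e10 =
      ST.r hBcl 1 ≫ (ST.r (rB y) 1 ≫ ST.i (iB y) 1) ≫ ST.δ hnbB e10 := fun y => by
    rw [← ST.r_r hBcl (rB y) (clLC_rel y.2), ← ST.i_δ hnbB (iB y) (hX.boundaryPair y.2) e10]
    simp only [Category.assoc]
  have hr : ∀ z : {z : X // Arrow z x},
      ST.δ (U := nbLC z.1) (C := clLC x) (hX.boundaryPair z.2) e10 ≫ ST.i (nbLC_rel z.2) 0 =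
      ST.δ hAcl e10 ≫ (ST.r (rA z) 0 ≫ ST.i (iA z) 0) ≫ ST.i hAnb 0 := fun z => by
    rw [← ST.i_i (iA z) hAnb (nbLC_rel z.2), ← ST.δ_r hAcl (rA z) (hX.boundaryPair z.2) e10]
    simp only [Category.assoc]
  rw [Finset.sum_congr rfl fun y _ => hl y, Finset.sum_congr rfl fun z _ => hr z,
    ← Preadditive.comp_sum, ← Preadditive.sum_comp, ← Preadditive.comp_sum, ← Preadditive.sum_comp,
    ST.sum_r_i _ B dB hBU rB iB, ST.sum_r_i _ A dA hAU rA iA, Category.id_comp, Category.id_comp]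
  exact (ST.r_δ_i (by rw [hclW]; exact W.2) (by rw [hclW]; exact hclc) (by rw [hclW]; exact hWc)
    (by rw [hnbW]; exact W.2) (by rw [hnbW]; exact hnbo) (by rw [hnbW]; exact hWo)
    (Set.union_comm _ _).subset hA hB hAcl hAnb hBcl hnbB e10).symm

/-- The assignment on generators underlying the functor from `ℬ` to `𝒮𝒯`. -/
noncomputable def baseGen (hX : UniquePath X) : BObj X ⥤q ST X where
  obj
    | .cl x => ST.obj (clLC x) 1
    | .nb x => ST.obj (nbLC x) 0
  map
    | .r h => ST.r (clLC_rel h) 1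
    | .δ h => ST.δ (hX.boundaryPair h) (by decide)
    | .i h => ST.i (nbLC_rel h) 0

/-- The functor from `ℬ` to `𝒮𝒯` for a unique path space. -/
noncomputable def baseFunctor (hX : UniquePath X) : BCat X ⥤ ST X :=
  Presented.lift BRel (baseGen hX) (by
    rintro _ _ _ _ ⟨x⟩
    simp only [Functor.map_sum, Functor.map_comp]
    refine (Finset.sum_congr rfl fun y _ => congrArg₂ (· ≫ ·)
      (FreePreadd.lift_arr _ _) (FreePreadd.lift_arr _ _)).trans
      ((ST.base_relation hX x).trans
      (Finset.sum_congr rfl fun z _ => congrArg₂ (· ≫ ·)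
      (FreePreadd.lift_arr _ _) (FreePreadd.lift_arr _ _)).symm))

instance (hX : UniquePath X) : (baseFunctor hX).Additive := by
  unfold baseFunctor
  infer_instance

theorem baseFunctor_map_r (hX : UniquePath X) {x y : X} (h : Arrow x y) :
    (baseFunctor hX).map (BCat.r h) = ST.r (clLC_rel h) 1 := FreePreadd.lift_arr _ _

theorem baseFunctor_map_δ (hX : UniquePath X) {x y : X} (h : Arrow x y) :
    (baseFunctor hX).map (BCat.δ h) =
      ST.δ (U := nbLC x) (C := clLC y) (hX.boundaryPair h) (by decide) :=
  FreePreadd.lift_arr _ _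

theorem baseFunctor_map_i (hX : UniquePath X) {x y : X} (h : Arrow x y) :
    (baseFunctor hX).map (BCat.i h) = ST.i (nbLC_rel h) 0 := FreePreadd.lift_arr _ _

/-- The restriction functor from `𝒮𝒯`-modules to `ℬ`-modules. -/
noncomputable def restrictToBase (hX : UniquePath X) : STMod.{w} X ⥤ BMod.{w} X :=
  restrictAlong (baseFunctor hX)

variable (X) in
/-- The exact real-rank-zero-like `𝒮𝒯`-modules, as a full subcategory. -/
def STExactRRZ : ObjectProperty (STMod.{w} X) := fun M => STExact M ∧ STRealRankZeroLike M

variable (X) in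
/-- The exact `ℬ`-modules, as a full subcategory. -/
def BExactMod : ObjectProperty (BMod.{w} X) := fun M => BExact M

end Functor

end FilteredK

/-! A quasi-inverse of the restriction functor is built explicitly. A `ℬ`-module `N` is extended to
a locally closed set `Y` by a limit in degree 1 and a colimit in degree 0: the degree-1 value
consists of families of elements of `N(cl x)`, for `x ∈ Y`, compatible with `r` (`BMod.sections`),
and the degree-0 value is the direct sum of the groups `N(nb x)` modulo the identification of `n`
with `i n` (`BMod.cosections`). The boundary from degree 0 is zero, and the boundary from degree 1
sends a family `m` to the sum of the classes of `δ (m b)` over all arrows `a → b`. The defining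
relation of `ℬ` is what relation 8 of `𝒮𝒯` demands of this sum (`BMod.extδ_extI`), so every `N`
yields an `𝒮𝒯`-module `BMod.ext`.

Exactness. Four of the six positions of the six-term sequence for `BMod.ext` are formal, limits
being left exact and these colimits right exact. The other two, at `M(C, 1)` and `M(U, 0)`, are
reduced by chasing three-step filtrations and induction on the size of `Y` to two cases: `U` is a
maximal point of `Y`, or `C` is a minimal point of `Y` (`lifts_and_bounds`). Each of these is
exactness of `N` at that point. Conversely, for an exact `𝒮𝒯`-module the sequence of `ℬ` at `x` is a
Mayer–Vietoris sequence for the set of points comparable to `x`, cut into the points above `x`, the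
point `x` and the points below `x` (`exists_of_δ_add_i_eq_zero`, `restrict_bExact`).

Restricting after extending gives back `N` because paths are unique: the closure of `x` without `x`
is the disjoint union of the closures of the points `y` with `x → y`, so a section over the closure
of `x` is the same as its value at `x`, and dually for smallest neighbourhoods
(`BMod.restrictExtIso`).

Extending after restricting gives back an exact real-rank-zero-like `M`. There are canonical
comparison maps `toSections` and `ofCosections`. That they commute with boundary maps is where the
EBP condition enters: every `δ` in `𝒮𝒯` is the sum over all arrows of composites through the
generators of `ℬ` (`ST.δ_eq_baseδ`), by reduction to elementary boundary pairs. On one-point sets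
the comparison maps are bijective by exactness and the vanishing of `δ` from degree 0. A five-lemma
argument, adding one maximal point at a time, gives all `Y` (`comparisonBijective`). -/

namespace FilteredK

/-! ### Natural transformations between functors on presented categories -/

namespace Presented

variable {V : Type u} [Quiver.{u} V] {ρ : HomRel (FreePreadd V)} {D : Type*} [Category* D]
  [Preadditive D]

/-- Naturality of a family of morphisms between additive functors on a presented category need only
be checked on generators. -/
theorem naturality_of_arr (Φ Ψ : Presented ρ ⥤ D) [Φ.Additive] [Ψ.Additive]
    (τ : ∀ a : V, Φ.obj (obj ρ a) ⟶ Ψ.obj (obj ρ a))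
    (h : ∀ {a b : V} (e : a ⟶ b), Φ.map (arr ρ e) ≫ τ b = τ a ≫ Ψ.map (arr ρ e))
    {a b : V} (f : obj ρ a ⟶ obj ρ b) : Φ.map f ≫ τ b = τ a ≫ Ψ.map f := by
  -- The quotient functor is full, so `f` comes from an integral combination of paths; naturality is
  -- additive in the morphism and stable under composition.
  obtain ⟨f, rfl⟩ := (Quotient.functor (AddCongruence ρ)).map_surjective f
  change FreeAbelianGroup (Quiver.Path a b) at f
  induction f using FreeAbelianGroup.induction_on with
  | zero =>
    have : (Quotient.functor (AddCongruence ρ)).map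
        (0 : FreePreadd.obj a ⟶ FreePreadd.obj b) = 0 := Functor.map_zero _ _ _
    change Φ.map ((Quotient.functor (AddCongruence ρ)).map
        (0 : FreePreadd.obj a ⟶ FreePreadd.obj b)) ≫ _ = _ ≫ Ψ.map
        ((Quotient.functor (AddCongruence ρ)).map (0 : FreePreadd.obj a ⟶ FreePreadd.obj b))
    rw [this]
    simp
  | neg p ih =>
    have : (Quotient.functor (AddCongruence ρ)).map (-(FreePreadd.ofPath p)) =
        - (Quotient.functor (AddCongruence ρ)).map (FreePreadd.ofPath p) := Functor.map_neg _
    change Φ.map ((Quotient.functor (AddCongruence ρ)).map (-(FreePreadd.ofPath p))) ≫ _ =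
      _ ≫ Ψ.map ((Quotient.functor (AddCongruence ρ)).map (-(FreePreadd.ofPath p)))
    rw [this, Functor.map_neg, Functor.map_neg, Preadditive.neg_comp, Preadditive.comp_neg]
    exact congrArg _ ih
  | add f g hf hg =>
    have : (Quotient.functor (AddCongruence ρ)).map
        ((show FreePreadd.obj a ⟶ FreePreadd.obj b from f) + g) =
        (Quotient.functor (AddCongruence ρ)).map (show FreePreadd.obj a ⟶ FreePreadd.obj b from f) +
        (Quotient.functor (AddCongruence ρ)).map (show FreePreadd.obj a ⟶ FreePreadd.obj b from g) :=
      Functor.map_add _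
    change Φ.map ((Quotient.functor (AddCongruence ρ)).map
        ((show FreePreadd.obj a ⟶ FreePreadd.obj b from f) + g)) ≫ _ =
      _ ≫ Ψ.map ((Quotient.functor (AddCongruence ρ)).map
        ((show FreePreadd.obj a ⟶ FreePreadd.obj b from f) + g))
    rw [this, Functor.map_add, Functor.map_add, Preadditive.add_comp, Preadditive.comp_add]
    exact congrArg₂ _ hf hg
  | of p =>
    change Φ.map ((Quotient.functor (AddCongruence ρ)).map (FreePreadd.ofPath p)) ≫ _ =
      _ ≫ Ψ.map ((Quotient.functor (AddCongruence ρ)).map (FreePreadd.ofPath p))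
    induction p with
    | nil =>
      have : (Quotient.functor (AddCongruence ρ)).map
          (FreePreadd.ofPath (Quiver.Path.nil : Quiver.Path a a)) = 𝟙 (obj ρ a) :=
        CategoryTheory.Functor.map_id _ _
      rw [this]
      simp
    | cons p e ih =>
      have h₁ : FreePreadd.ofPath (p.cons e) = FreePreadd.ofPath p ≫ FreePreadd.arr e :=
        (FreePreadd.comp_of_of p e.toPath).symm
      rw [h₁, Functor.map_comp, Functor.map_comp, Functor.map_comp, Category.assoc, h e,
        ← Category.assoc, ih, Category.assoc]

/-- A natural transformation between additive functors on a presented category, given by its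
components at the generating objects. -/
noncomputable def natTrans (Φ Ψ : Presented ρ ⥤ D) [Φ.Additive] [Ψ.Additive]
    (τ : ∀ a : V, Φ.obj (obj ρ a) ⟶ Ψ.obj (obj ρ a))
    (h : ∀ {a b : V} (e : a ⟶ b), Φ.map (arr ρ e) ≫ τ b = τ a ≫ Ψ.map (arr ρ e)) : Φ ⟶ Ψ where
  app a := τ a.as.vertex
  naturality _ _ f := naturality_of_arr Φ Ψ τ h f

/-- A natural isomorphism between additive functors on a presented category, given by its
components at the generating objects. -/
noncomputable def natIso (Φ Ψ : Presented ρ ⥤ D) [Φ.Additive] [Ψ.Additive]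
    (τ : ∀ a : V, Φ.obj (obj ρ a) ≅ Ψ.obj (obj ρ a))
    (h : ∀ {a b : V} (e : a ⟶ b),
      Φ.map (arr ρ e) ≫ (τ b).hom = (τ a).hom ≫ Ψ.map (arr ρ e)) : Φ ≅ Ψ :=
  NatIso.ofComponents (fun a => τ a.as.vertex)
    (fun f => naturality_of_arr Φ Ψ (fun a => (τ a).hom) h f)

end Presented

/-! ### Evaluating additive functors on elements -/

section Apply

variable {C : Type*} [Category* C] [Preadditive C] (M : C ⥤+ AddCommGrpCat.{w})

theorem map_map_apply {a b c : C} (f : a ⟶ b) (g : b ⟶ c) (m : M.obj.obj a) :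
    M.obj.map g (M.obj.map f m) = M.obj.map (f ≫ g) m := by
  rw [Functor.map_comp]; rfl

theorem map_id_apply {a : C} (m : M.obj.obj a) : M.obj.map (𝟙 a) m = m := by
  rw [CategoryTheory.Functor.map_id]; rfl

theorem map_add_apply {a b : C} (f g : a ⟶ b) (m : M.obj.obj a) :
    M.obj.map (f + g) m = M.obj.map f m + M.obj.map g m := by
  rw [Functor.map_add]; rfl

theorem map_zero_apply {a b : C} (m : M.obj.obj a) : M.obj.map (0 : a ⟶ b) m = 0 := by
  rw [Functor.map_zero]; rfl

theorem map_sum_apply {a b : C} {ι : Type*} (s : Finset ι) (f : ι → (a ⟶ b)) (m : M.obj.obj a) :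
    M.obj.map (∑ k ∈ s, f k) m = ∑ k ∈ s, M.obj.map (f k) m := by
  classical
  induction s using Finset.induction_on with
  | empty => simp
  | insert a s ha ih => rw [Finset.sum_insert ha, Finset.sum_insert ha, map_add_apply, ih]

theorem naturality_apply' {M N : C ⥤+ AddCommGrpCat.{w}} (f : M ⟶ N) {a b : C} (g : a ⟶ b)
    (m : M.obj.obj a) : f.hom.app b (M.obj.map g m) = N.obj.map g (f.hom.app a m) :=
  ConcreteCategory.congr_hom (f.hom.naturality g) m

end Apply

/-! ### Sections and cosections of a `ℬ`-module over a locally closed set -/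

section Sections

variable {X : Type u} [TopologicalSpace X] [Finite X]

namespace BMod

variable (N : BMod.{u} X)

/-- The action of `r` on a `ℬ`-module. -/
noncomputable def rHom {x y : X} (h : Arrow x y) :
    N.obj.obj (BCat.cl x) →+ N.obj.obj (BCat.cl y) := (N.obj.map (BCat.r h)).hom

/-- The action of `δ` on a `ℬ`-module. -/
noncomputable def δHom {x y : X} (h : Arrow x y) :
    N.obj.obj (BCat.cl y) →+ N.obj.obj (BCat.nb x) := (N.obj.map (BCat.δ h)).hom

/-- The action of `i` on a `ℬ`-module. -/
noncomputable def iHom {x y : X} (h : Arrow x y) :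
    N.obj.obj (BCat.nb x) →+ N.obj.obj (BCat.nb y) := (N.obj.map (BCat.i h)).hom

theorem sum_r_δ (x : X) (m : N.obj.obj (BCat.cl x)) :
    ∑ y : {y : X // Arrow x y}, N.δHom y.2 (N.rHom y.2 m) =
      ∑ z : {z : X // Arrow z x}, N.iHom z.2 (N.δHom z.2 m) := by
  have h := Presented.sound (BRel.rel x)
  rw [Functor.map_sum, Functor.map_sum] at h
  have h' := congrArg (fun f => N.obj.map f m) h
  simp only [map_sum_apply] at h'
  refine Eq.trans (Finset.sum_congr rfl fun y _ => ?_)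
    (h'.trans (Finset.sum_congr rfl fun z _ => ?_))
  · rw [Functor.map_comp]
    exact map_map_apply N (BCat.r y.2) (BCat.δ y.2) m
  · rw [Functor.map_comp]
    exact (map_map_apply N (BCat.δ z.2) (BCat.i z.2) m).symm

/-- The degree-one value on `Y` of the `𝒮𝒯`-module associated with `N`: compatible families
indexed by the points of `Y`, extended by zero. -/
def sections (Y : Set X) : AddSubgroup (∀ x, N.obj.obj (BCat.cl x)) where
  -- Only the source `x` of the arrow is required to lie in `Y`: for an arrow leaving `Y` the
  -- condition forces `r (m x) = 0`.
  carrier := {m | (∀ x, x ∉ Y → m x = 0) ∧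
    ∀ x y (h : Arrow x y), x ∈ Y → N.rHom h (m x) = m y}
  zero_mem' := ⟨fun _ _ => rfl, fun _ _ _ _ => map_zero _⟩
  add_mem' := by
    rintro a b ⟨h₁, h₂⟩ ⟨h₁', h₂'⟩
    refine ⟨fun x hx => ?_, fun x y h hx => ?_⟩
    · rw [Pi.add_apply, h₁ x hx, h₁' x hx, add_zero]
    · rw [Pi.add_apply, map_add, h₂ x y h hx, h₂' x y h hx, Pi.add_apply]
  neg_mem' := by
    rintro a ⟨h₁, h₂⟩
    refine ⟨fun x hx => ?_, fun x y h hx => ?_⟩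
    · rw [Pi.neg_apply, h₁ x hx, neg_zero]
    · rw [Pi.neg_apply, map_neg, h₂ x y h hx, Pi.neg_apply]

open Classical in
/-- The inclusion of a summand in the direct sum of the values at smallest neighbourhoods. -/
noncomputable def nbSingle (x : X) : N.obj.obj (BCat.nb x) →+ ∀ x, N.obj.obj (BCat.nb x) :=
  AddMonoidHom.single (fun x => (N.obj.obj (BCat.nb x) : Type u)) x

/-- The relations defining `cosections`. -/
noncomputable def cosectionRel (Y : Set X) : AddSubgroup (∀ x, N.obj.obj (BCat.nb x)) :=
  AddSubgroup.closure ({p | ∃ x, x ∉ Y ∧ ∃ n, p = N.nbSingle x n} ∪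
    -- Only the target `b` is required to lie in `Y`: for `a` outside `Y` the relation kills the
    -- image of `i` in the summand at `b`.
    {p | ∃ (a b : X) (h : Arrow a b) (n : _), b ∈ Y ∧
      p = N.nbSingle b (N.iHom h n) - N.nbSingle a n})

/-- The degree-zero value on `Y` of the `𝒮𝒯`-module associated with `N`. -/
abbrev cosections (Y : Set X) : Type u := (∀ x, N.obj.obj (BCat.nb x)) ⧸ N.cosectionRel Y

/-- The canonical map to `cosections` from the value at the smallest neighbourhood of a point. -/
noncomputable def cosec (Y : Set X) (x : X) : N.obj.obj (BCat.nb x) →+ N.cosections Y :=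
  (QuotientAddGroup.mk' (N.cosectionRel Y)).comp (N.nbSingle x)

variable {N}

theorem cosec_of_notMem {Y : Set X} {x : X} (hx : x ∉ Y) (n : N.obj.obj (BCat.nb x)) :
    N.cosec Y x n = 0 :=
  (QuotientAddGroup.eq_zero_iff (N.nbSingle x n)).2
    (AddSubgroup.subset_closure (Or.inl ⟨x, hx, n, rfl⟩))

theorem cosec_iHom {Y : Set X} {a b : X} (h : Arrow a b) (hb : b ∈ Y)
    (n : N.obj.obj (BCat.nb a)) : N.cosec Y b (N.iHom h n) = N.cosec Y a n :=
  sub_eq_zero.1 ((QuotientAddGroup.eq_zero_iff (N.nbSingle b (N.iHom h n) - N.nbSingle a n)).2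
    (AddSubgroup.subset_closure (Or.inr ⟨a, b, h, n, hb, rfl⟩)))

theorem nbSingle_same (x : X) (n : N.obj.obj (BCat.nb x)) : N.nbSingle x n x = n := by
  classical
  simp [nbSingle]

theorem nbSingle_of_ne {x y : X} (h : y ≠ x) (n : N.obj.obj (BCat.nb x)) :
    N.nbSingle x n y = 0 := by
  classical
  simp [nbSingle, Pi.single_eq_of_ne h]

theorem sum_nbSingle [Fintype X] (p : ∀ x, N.obj.obj (BCat.nb x)) :
    ∑ x, N.nbSingle x (p x) = p := by
  classical
  convert Finset.univ_sum_single p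
  simp [nbSingle]

theorem sum_comp_eval_nbSingle [Fintype X] {A : Type*} [AddCommGroup A]
    (φ : ∀ x, N.obj.obj (BCat.nb x) →+ A) (x : X) (n : N.obj.obj (BCat.nb x)) :
    (∑ x, (φ x).comp (Pi.evalAddMonoidHom (fun x => (N.obj.obj (BCat.nb x) : Type u)) x))
      (N.nbSingle x n) = φ x n := by
  rw [AddMonoidHom.finsetSum_apply, Finset.sum_eq_single x]
  · simp [nbSingle_same]
  · intro y _ hy
    simp [nbSingle_of_ne hy]
  · simp

/-- `X` is finite, so a family is the sum of its single coordinates, and the coordinates outside `Y`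
have zero class. -/
theorem cosections_induction {Y : Set X} {P : N.cosections Y → Prop} (h0 : P 0)
    (hadd : ∀ a b, P a → P b → P (a + b)) (hx : ∀ x ∈ Y, ∀ n, P (N.cosec Y x n))
    (a : N.cosections Y) : P a := by
  let S : AddSubmonoid (N.cosections Y) :=
    { carrier := {a | P a}, zero_mem' := h0, add_mem' := fun ha hb => hadd _ _ ha hb }
  have := Fintype.ofFinite X
  obtain ⟨p, rfl⟩ := QuotientAddGroup.mk'_surjective _ a
  change _ ∈ S
  rw [← sum_nbSingle p, map_sum]
  refine sum_mem fun x _ => ?_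
  by_cases h : x ∈ Y
  · exact hx x h (p x)
  · exact (congrArg (· ∈ S) (cosec_of_notMem h (p x))).mpr (zero_mem S)

theorem cosections_hom_ext {Y : Set X} {A : Type*} [AddCommGroup A] {f g : N.cosections Y →+ A}
    (h : ∀ x ∈ Y, ∀ n, f (N.cosec Y x n) = g (N.cosec Y x n)) : f = g := by
  ext a
  refine cosections_induction (P := fun a => f a = g a) ?_ (fun a b ha hb => ?_) h a
  · rw [map_zero, map_zero]
  · rw [map_add, map_add, ha, hb]

/-- The universal property of `cosections`. -/
noncomputable def cosectionsLift {Y : Set X} {A : Type*} [AddCommGroup A]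
    (φ : ∀ x, N.obj.obj (BCat.nb x) →+ A) (h0 : ∀ x, x ∉ Y → ∀ n, φ x n = 0)
    (hφ : ∀ a b (h : Arrow a b), b ∈ Y → ∀ n, φ b (N.iHom h n) = φ a n) :
    N.cosections Y →+ A := by
  letI := Fintype.ofFinite X
  refine QuotientAddGroup.lift _
    (∑ x, (φ x).comp (Pi.evalAddMonoidHom (fun x => (N.obj.obj (BCat.nb x) : Type u)) x)) ?_
  unfold cosectionRel
  rw [AddSubgroup.closure_le]
  rintro p (⟨x, hx, n, rfl⟩ | ⟨a, b, h, n, hb, rfl⟩)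
  · exact (sum_comp_eval_nbSingle φ x n).trans (h0 x hx n)
  · rw [SetLike.mem_coe, AddMonoidHom.mem_ker, map_sub, sum_comp_eval_nbSingle,
      sum_comp_eval_nbSingle, hφ a b h hb, sub_self]

@[simp]
theorem cosectionsLift_cosec {Y : Set X} {A : Type*} [AddCommGroup A]
    (φ : ∀ x, N.obj.obj (BCat.nb x) →+ A) (h0 : ∀ x, x ∉ Y → ∀ n, φ x n = 0)
    (hφ : ∀ a b (h : Arrow a b), b ∈ Y → ∀ n, φ b (N.iHom h n) = φ a n) (x : X)
    (n : N.obj.obj (BCat.nb x)) : cosectionsLift φ h0 hφ (N.cosec Y x n) = φ x n :=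
  letI := Fintype.ofFinite X
  sum_comp_eval_nbSingle φ x n

open Classical in
/-- Restriction of families to a relatively closed subset. -/
noncomputable def sectionsRes {Y C : LC X} (h : IsRelClosed C.1 Y.1) :
    N.sections Y.1 →+ N.sections C.1 where
  toFun m := ⟨fun x => if x ∈ C.1 then m.1 x else 0, by
    rw [isRelClosed_iff] at h
    refine ⟨fun x hx => if_neg hx, fun x y hxy hx => ?_⟩
    simp only [if_pos hx, m.2.2 x y hxy (h.1 hx)]
    split_ifs with hy
    · rfl
    · exact m.2.1 y fun hy' => hy (h.2 y x hxy.1.1 hx hy')⟩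
  map_zero' := by ext x; simp
  map_add' a b := by ext x; simp only [AddSubgroup.coe_add, Pi.add_apply]; split_ifs <;> simp

/-- Extension of families by zero from a relatively open subset. -/
noncomputable def sectionsExt {U Y : LC X} (h : IsRelOpen U.1 Y.1) :
    N.sections U.1 →+ N.sections Y.1 :=
  AddSubgroup.inclusion fun m hm => by
    rw [isRelOpen_iff] at h
    refine ⟨fun x hx => hm.1 x fun hx' => hx (h.1 hx'), fun x y hxy hx => ?_⟩
    by_cases hxU : x ∈ U.1
    -- For `x` in `Y` but not in `U`, an arrow `x → y` cannot end in the relatively open set `U`, so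
    -- both sides vanish in the second case.
    · exact hm.2 x y hxy hxU
    · rw [hm.1 x hxU, map_zero, hm.1 y fun hy => hxU (h.2 y x hxy.1.1 hy hx)]

open Classical in
theorem sectionsRes_apply {Y C : LC X} (h : IsRelClosed C.1 Y.1) (m : N.sections Y.1) (x : X) :
    (sectionsRes h m).1 x = if x ∈ C.1 then m.1 x else 0 := rfl

theorem sectionsExt_apply {U Y : LC X} (h : IsRelOpen U.1 Y.1) (m : N.sections U.1) (x : X) :
    (sectionsExt h m).1 x = m.1 x := rfl

/-- The map between `cosections` induced by restriction to a relatively closed subset. -/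
noncomputable def cosectionsRes {Y C : LC X} (h : IsRelClosed C.1 Y.1) :
    N.cosections Y.1 →+ N.cosections C.1 :=
  cosectionsLift (fun x => N.cosec C.1 x)
    (fun _ hx n => cosec_of_notMem (fun hx' => hx ((isRelClosed_iff.1 h).1 hx')) n) (by
    intro a b hab hb n
    by_cases hbC : b ∈ C.1
    · exact cosec_iHom hab hbC n
    · rw [cosec_of_notMem hbC, cosec_of_notMem
        fun ha => hbC ((isRelClosed_iff.1 h).2 b a hab.1.1 ha hb)])

open Classical in
/-- The map between `cosections` induced by inclusion of a relatively open subset. -/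
noncomputable def cosectionsExt {U Y : LC X} (h : IsRelOpen U.1 Y.1) :
    N.cosections U.1 →+ N.cosections Y.1 :=
  cosectionsLift (fun x => if x ∈ U.1 then N.cosec Y.1 x else 0)
    (fun _ hx n => by rw [if_neg hx]; rfl) (by
    intro a b hab hb n
    rw [isRelOpen_iff] at h
    rw [if_pos hb, cosec_iHom hab (h.1 hb)]
    split_ifs with ha
    · rfl
    · exact cosec_of_notMem (fun ha' => ha (h.2 b a hab.1.1 hb ha')) n)

theorem cosectionsRes_cosec {Y C : LC X} (h : IsRelClosed C.1 Y.1) (x : X)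
    (n : N.obj.obj (BCat.nb x)) : cosectionsRes h (N.cosec Y.1 x n) = N.cosec C.1 x n :=
  cosectionsLift_cosec _ _ _ x n

theorem cosectionsExt_cosec {U Y : LC X} (h : IsRelOpen U.1 Y.1) {x : X} (hx : x ∈ U.1)
    (n : N.obj.obj (BCat.nb x)) : cosectionsExt h (N.cosec U.1 x n) = N.cosec Y.1 x n := by
  refine (cosectionsLift_cosec _ _ _ x n).trans ?_
  rw [if_pos hx]

noncomputable instance : Fintype {p : X × X // Arrow p.1 p.2} := Fintype.ofFinite _

theorem sum_arrow_left [Fintype X] {A : Type*} [AddCommMonoid A]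
    (f : {p : X × X // Arrow p.1 p.2} → A) :
    ∑ p, f p = ∑ x : X, ∑ y : {y : X // Arrow x y}, f ⟨(x, y.1), y.2⟩ :=
  (Fintype.sum_equiv (κ := Σ x : X, {y : X // Arrow x y})
    ⟨fun p => ⟨p.1.1, p.1.2, p.2⟩, fun q => ⟨(q.1, q.2.1), q.2.2⟩, fun _ => rfl, fun _ => rfl⟩
    f (fun q => f ⟨(q.1, q.2.1), q.2.2⟩) fun _ => rfl).trans (Fintype.sum_sigma _)

theorem sum_arrow_right [Fintype X] {A : Type*} [AddCommMonoid A]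
    (f : {p : X × X // Arrow p.1 p.2} → A) :
    ∑ p, f p = ∑ x : X, ∑ z : {z : X // Arrow z x}, f ⟨(z.1, x), z.2⟩ :=
  (Fintype.sum_equiv (κ := Σ x : X, {z : X // Arrow z x})
    ⟨fun p => ⟨p.1.2, p.1.1, p.2⟩, fun q => ⟨(q.2.1, q.1), q.2.2⟩, fun _ => rfl, fun _ => rfl⟩
    f (fun q => f ⟨(q.2.1, q.1), q.2.2⟩) fun _ => rfl).trans (Fintype.sum_sigma _)

/-- The boundary map, from compatible families on `C` to `cosections` on `U`. -/
noncomputable def sectionsBoundary (C U : Set X) : N.sections C →+ N.cosections U :=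
  -- The sum runs over all arrows of `X`. Those with source outside `U` die in the cosections over
  -- `U`, and those with target outside `C` see the value zero of the family.
  ∑ p : {p : X × X // Arrow p.1 p.2}, (N.cosec U p.1.1).comp ((N.δHom p.2).comp
    ((Pi.evalAddMonoidHom (fun x => (N.obj.obj (BCat.cl x) : Type u)) p.1.2).comp
      (N.sections C).subtype))

theorem sectionsBoundary_apply (C U : Set X) (m : N.sections C) :
    sectionsBoundary C U m =
      ∑ p : {p : X × X // Arrow p.1 p.2}, N.cosec U p.1.1 (N.δHom p.2 (m.1 p.1.2)) := by
  simp [sectionsBoundary, AddMonoidHom.finsetSum_apply]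

end BMod

end Sections

/-! ### The `𝒮𝒯`-module associated with a `ℬ`-module: verification of the relations -/

section Extension

variable {X : Type u} [TopologicalSpace X] [Finite X]

namespace BMod

variable (N : BMod.{u} X)

/-- The values on objects of the `𝒮𝒯`-module associated with `N`. -/
noncomputable def extObj : STObj X → AddCommGrpCat.{u}
  | ⟨Y, 0⟩ => .of (N.cosections Y.1)
  | ⟨Y, 1⟩ => .of (N.sections Y.1)

/-- The action of `i` on the `𝒮𝒯`-module associated with `N`. -/
noncomputable def extI {U Y : LC X} (h : IsRelOpen U.1 Y.1) :
    (j : ZMod 2) → (N.extObj ⟨U, j⟩ ⟶ N.extObj ⟨Y, j⟩)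
  | 0 => AddCommGrpCat.ofHom (cosectionsExt h)
  | 1 => AddCommGrpCat.ofHom (sectionsExt h)

/-- The action of `r` on the `𝒮𝒯`-module associated with `N`. -/
noncomputable def extR {Y C : LC X} (h : IsRelClosed C.1 Y.1) :
    (j : ZMod 2) → (N.extObj ⟨Y, j⟩ ⟶ N.extObj ⟨C, j⟩)
  | 0 => AddCommGrpCat.ofHom (cosectionsRes h)
  | 1 => AddCommGrpCat.ofHom (sectionsRes h)

/-- The action of `δ` on the `𝒮𝒯`-module associated with `N`. -/
noncomputable def extδ (U C : LC X) : (j k : ZMod 2) → (N.extObj ⟨C, j⟩ ⟶ N.extObj ⟨U, k⟩)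
  | 1, 0 => AddCommGrpCat.ofHom (sectionsBoundary C.1 U.1)
  -- The boundary from degree 0 is zero by design, which makes the module real-rank-zero-like. Pairs
  -- with `j = k` carry a default value that no generator uses.
  | 0, _ => 0
  | 1, 1 => 0

/-- The assignment on generators underlying the `𝒮𝒯`-module associated with `N`. -/
noncomputable def extGen : STObj X ⥤q AddCommGrpCat.{u} where
  obj := N.extObj
  map
    | .i h j => N.extI h j
    | .r h j => N.extR h j
    | .δ (U := U) (C := C) _ (j := j) (k := k) _ => N.extδ U C j k

theorem lift_extGen_i {U Y : LC X} (h : IsRelOpen U.1 Y.1) (j : ZMod 2) :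
    (FreePreadd.lift N.extGen).map (FreeST.i h j) = N.extI h j := FreePreadd.lift_arr _ _

theorem lift_extGen_r {Y C : LC X} (h : IsRelClosed C.1 Y.1) (j : ZMod 2) :
    (FreePreadd.lift N.extGen).map (FreeST.r h j) = N.extR h j := FreePreadd.lift_arr _ _

theorem lift_extGen_δ {U C : LC X} (h : IsBoundaryPair U.1 C.1) {j k : ZMod 2} (hjk : k = j + 1) :
    (FreePreadd.lift N.extGen).map (FreeST.δ h hjk) = N.extδ U C j k := FreePreadd.lift_arr _ _

theorem zmod_two_cases {P : ZMod 2 → Prop} (h0 : P 0) (h1 : P 1) (j : ZMod 2) : P j := by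
  fin_cases j
  · exact h0
  · exact h1

variable {N}

theorem extHom_ext {A : AddCommGrpCat.{u}} {Y : LC X} {f g : N.extObj ⟨Y, 0⟩ ⟶ A}
    (h : ∀ x ∈ Y.1, ∀ n, f (N.cosec Y.1 x n) = g (N.cosec Y.1 x n)) : f = g :=
  AddCommGrpCat.hom_ext (cosections_hom_ext h)

theorem extHom_ext_one {A : AddCommGrpCat.{u}} {Y : LC X} {f g : A ⟶ N.extObj ⟨Y, 1⟩}
    (h : ∀ a x, (show N.sections Y.1 from f a).1 x = (show N.sections Y.1 from g a).1 x) : f = g :=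
  AddCommGrpCat.hom_ext (AddMonoidHom.ext fun a => Subtype.ext (funext (h a)))

theorem extI_self {Y : LC X} (h : IsRelOpen Y.1 Y.1) (j : ZMod 2) : N.extI h j = 𝟙 _ := by
  induction j using zmod_two_cases
  · exact extHom_ext fun x hx n => cosectionsExt_cosec h hx n
  · exact extHom_ext_one fun a x => rfl

theorem extR_self {Y : LC X} (h : IsRelClosed Y.1 Y.1) (j : ZMod 2) : N.extR h j = 𝟙 _ := by
  induction j using zmod_two_cases
  · exact extHom_ext fun x hx n => cosectionsRes_cosec h x n
  · refine extHom_ext_one fun a x => (sectionsRes_apply h a x).trans ?_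
    split_ifs with hx
    · rfl
    · exact (a.2.1 x hx).symm

theorem ext_biproduct {Y Z W : LC X} (hd : TopDisjoint Y.1 Z.1) (hW : W.1 = Y.1 ∪ Z.1)
    (rY : IsRelClosed Y.1 W.1) (iY : IsRelOpen Y.1 W.1)
    (rZ : IsRelClosed Z.1 W.1) (iZ : IsRelOpen Z.1 W.1) (j : ZMod 2) :
    N.extR rY j ≫ N.extI iY j + N.extR rZ j ≫ N.extI iZ j = 𝟙 _ := by
  rw [topDisjoint_iff] at hd
  have hYZ : ∀ x ∈ Y.1, x ∉ Z.1 := fun x hx hx' => (hd x hx x hx').1 (.refl x)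
  induction j using zmod_two_cases
  · refine extHom_ext fun x hx n => ?_
    change cosectionsExt iY (cosectionsRes rY (N.cosec W.1 x n)) +
      cosectionsExt iZ (cosectionsRes rZ (N.cosec W.1 x n)) = N.cosec W.1 x n
    rw [cosectionsRes_cosec, cosectionsRes_cosec]
    rw [hW] at hx
    by_cases hxY : x ∈ Y.1
    · rw [cosectionsExt_cosec iY hxY, cosec_of_notMem (hYZ x hxY), map_zero, add_zero]
    · have hxZ := hx.resolve_left hxY
      rw [cosectionsExt_cosec iZ hxZ, cosec_of_notMem hxY, map_zero, zero_add]
  · refine extHom_ext_one fun a x => ?_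
    change N.sections W.1 at a
    change (sectionsRes rY a).1 x + (sectionsRes rZ a).1 x = a.1 x
    rw [sectionsRes_apply, sectionsRes_apply]
    by_cases hxY : x ∈ Y.1
    · rw [if_pos hxY, if_neg (hYZ x hxY), add_zero]
    · rw [if_neg hxY, zero_add]
      split_ifs with hxZ
      · rfl
      · exact (a.2.1 x fun hx => (hW ▸ hx : x ∈ Y.1 ∪ Z.1).elim hxY hxZ).symm

theorem extI_extI {U V Y : LC X} (hUV : IsRelOpen U.1 V.1) (hVY : IsRelOpen V.1 Y.1)
    (hUY : IsRelOpen U.1 Y.1) (j : ZMod 2) : N.extI hUV j ≫ N.extI hVY j = N.extI hUY j := by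
  induction j using zmod_two_cases
  · refine extHom_ext fun x hx n => ?_
    change cosectionsExt hVY (cosectionsExt hUV (N.cosec U.1 x n)) =
      cosectionsExt hUY (N.cosec U.1 x n)
    rw [cosectionsExt_cosec hUV hx, cosectionsExt_cosec hUY hx,
      cosectionsExt_cosec hVY ((isRelOpen_iff.1 hUV).1 hx)]
  · exact extHom_ext_one fun a x => rfl

theorem extR_extR {C D Y : LC X} (hDY : IsRelClosed D.1 Y.1) (hCD : IsRelClosed C.1 D.1)
    (hCY : IsRelClosed C.1 Y.1) (j : ZMod 2) : N.extR hDY j ≫ N.extR hCD j = N.extR hCY j := by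
  induction j using zmod_two_cases
  · refine extHom_ext fun x hx n => ?_
    change cosectionsRes hCD (cosectionsRes hDY (N.cosec Y.1 x n)) =
      cosectionsRes hCY (N.cosec Y.1 x n)
    rw [cosectionsRes_cosec, cosectionsRes_cosec, cosectionsRes_cosec]
  · refine extHom_ext_one fun a x => ?_
    change N.sections Y.1 at a
    change (sectionsRes hCD (sectionsRes hDY a)).1 x = (sectionsRes hCY a).1 x
    rw [sectionsRes_apply, sectionsRes_apply, sectionsRes_apply]
    split_ifs with hx hx'
    · rfl
    · exact absurd ((isRelClosed_iff.1 hCD).1 hx) hx'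
    · rfl

theorem extI_extR {U C Y V : LC X} (hU : IsRelOpen U.1 Y.1) (hC : IsRelClosed C.1 Y.1)
    (hV : V.1 = U.1 ∩ C.1) (hVU : IsRelClosed V.1 U.1) (hVC : IsRelOpen V.1 C.1) (j : ZMod 2) :
    N.extI hU j ≫ N.extR hC j = N.extR hVU j ≫ N.extI hVC j := by
  induction j using zmod_two_cases
  · refine extHom_ext fun x hx n => ?_
    change cosectionsRes hC (cosectionsExt hU (N.cosec U.1 x n)) =
      cosectionsExt hVC (cosectionsRes hVU (N.cosec U.1 x n))
    rw [cosectionsRes_cosec, cosectionsExt_cosec hU hx, cosectionsRes_cosec]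
    by_cases hxC : x ∈ C.1
    · rw [cosectionsExt_cosec hVC (hV ▸ ⟨hx, hxC⟩)]
    · rw [cosec_of_notMem hxC, cosec_of_notMem (hV ▸ fun h => hxC h.2), map_zero]
  · refine extHom_ext_one fun a x => ?_
    change N.sections U.1 at a
    change (sectionsRes hC (sectionsExt hU a)).1 x = (sectionsExt hVC (sectionsRes hVU a)).1 x
    rw [sectionsExt_apply, sectionsRes_apply, sectionsRes_apply, sectionsExt_apply, hV]
    by_cases hxU : x ∈ U.1
    · by_cases hxC : x ∈ C.1 <;> simp [hxU, hxC]
    · simp [hxU, show (a.1 x = 0) from a.2.1 x hxU]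

theorem extI_extδ {U C C' : LC X} (hC' : IsRelOpen C'.1 C.1) {j k : ZMod 2} (hjk : k = j + 1) :
    N.extI hC' j ≫ N.extδ U C j k = N.extδ U C' j k := by
  subst hjk
  induction j using zmod_two_cases
  · exact Limits.comp_zero
  · refine AddCommGrpCat.hom_ext (AddMonoidHom.ext fun a => ?_)
    change N.sections C'.1 at a
    change sectionsBoundary C.1 U.1 (sectionsExt hC' a) = sectionsBoundary C'.1 U.1 a
    rw [sectionsBoundary_apply, sectionsBoundary_apply]
    rfl

theorem extδ_extR {U C U' : LC X} (hU' : IsRelClosed U'.1 U.1) {j k : ZMod 2} (hjk : k = j + 1) :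
    N.extδ U C j k ≫ N.extR hU' k = N.extδ U' C j k := by
  subst hjk
  induction j using zmod_two_cases
  · exact Limits.zero_comp
  · refine AddCommGrpCat.hom_ext (AddMonoidHom.ext fun a => ?_)
    change N.sections C.1 at a
    change cosectionsRes hU' (sectionsBoundary C.1 U.1 a) = sectionsBoundary C.1 U'.1 a
    rw [sectionsBoundary_apply, sectionsBoundary_apply, map_sum]
    simp only [cosectionsRes_cosec]

open Classical in
-- This is the relation of `ℬ` summed over the points of `S`, applied to `m x`. On arrows `x → y`
-- out of `S`, compatibility over `Y` turns `r (m x)` into `m y`; on arrows `z → x` into `S`, the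
-- relations of cosections over `Z` absorb `i`.
theorem sum_cosec_of_mem_inter {Y Z : Set X} (m : N.sections Y) (S : Set X) (hSY : S ⊆ Y)
    (hSZ : S ⊆ Z) :
    ∑ p : {p : X × X // Arrow p.1 p.2},
        (if p.1.1 ∈ S then N.cosec Z p.1.1 (N.δHom p.2 (m.1 p.1.2)) else 0) =
      ∑ p : {p : X × X // Arrow p.1 p.2},
        (if p.1.2 ∈ S then N.cosec Z p.1.1 (N.δHom p.2 (m.1 p.1.2)) else 0) := by
  let := Fintype.ofFinite X
  rw [sum_arrow_left, sum_arrow_right]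
  refine Finset.sum_congr rfl fun x _ => ?_
  dsimp only
  split_ifs with hx
  · have h := congrArg (N.cosec Z x) (N.sum_r_δ x (m.1 x))
    rw [map_sum, map_sum] at h
    refine Eq.trans (Finset.sum_congr rfl fun y _ => ?_)
      (h.trans (Finset.sum_congr rfl fun z _ => ?_))
    · rw [m.2.2 x y.1 y.2 (hSY hx)]
    · rw [cosec_iHom z.2 (hSZ hx)]
  · simp

/-- In relation 8 both sides are sums of the same terms over arrows `a → b`: on the left over `a ∈ W
\ Y`, on the right over `b ∈ W \ Z`. With `S = W ∩ Y ∩ Z`, the sum over `a ∈ S` equals the sum over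
`b ∈ S` by `sum_cosec_of_mem_inter`. Once these are added, the left side counts `a ∈ W ∩ Z` and the
right side `b ∈ W ∩ Y`, and the two conditions agree on the arrows that matter. -/
theorem extδ_extI {Y Z W A B : LC X}
    (hW : IsRelClosed W.1 (Y.1 ∪ W.1)) (hW' : IsRelOpen W.1 (Z.1 ∪ W.1))
    (hWYZ : W.1 ⊆ Y.1 ∪ Z.1) (hA : A.1 = W.1 \ Y.1) (hB : B.1 = W.1 \ Z.1)
    (hAZ : IsRelOpen A.1 Z.1) (hBY : IsRelClosed B.1 Y.1) {j k : ZMod 2} (hjk : k = j + 1) :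
    N.extδ A Y j k ≫ N.extI hAZ k = N.extR hBY j ≫ N.extδ Z B j k := by
  classical
  subst hjk
  induction j using zmod_two_cases
  · exact Limits.zero_comp.trans Limits.comp_zero.symm
  · refine AddCommGrpCat.hom_ext (AddMonoidHom.ext fun m => ?_)
    change N.sections Y.1 at m
    change cosectionsExt hAZ (sectionsBoundary Y.1 A.1 m) =
      sectionsBoundary B.1 Z.1 (sectionsRes hBY m)
    rw [sectionsBoundary_apply, sectionsBoundary_apply, map_sum]
    obtain ⟨S, hS⟩ : ∃ S : Set X, ∀ x, x ∈ S ↔ x ∈ W.1 ∧ x ∈ Y.1 ∧ x ∈ Z.1 :=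
      ⟨W.1 ∩ (Y.1 ∩ Z.1), fun _ => .rfl⟩
    have key := sum_cosec_of_mem_inter m S (Z := Z.1)
      (fun x hx => ((hS x).1 hx).2.1) (fun x hx => ((hS x).1 hx).2.2)
    -- The same quantity is added on both sides, written through sources on the left and through
    -- targets on the right, so that the identity can be checked arrow by arrow.
    refine add_left_cancel (a := ∑ p : {p : X × X // Arrow p.1 p.2}, (if p.1.1 ∈ S
      then N.cosec Z.1 p.1.1 (N.δHom p.2 (m.1 p.1.2)) else 0)) ?_
    conv_rhs => rw [key]
    rw [← Finset.sum_add_distrib, ← Finset.sum_add_distrib]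
    refine Finset.sum_congr rfl fun ⟨⟨a, b⟩, hab⟩ _ => ?_
    dsimp only
    rw [sectionsRes_apply]
    by_cases haZ : a ∈ Z.1
    · by_cases hbY : b ∈ Y.1
      -- For `a ∈ Z` and `b ∈ Y`, relative closedness of `W` in `Y ∪ W` passes membership down the
      -- arrow and relative openness in `Z ∪ W` passes it up.
      · have hW1 : a ∈ W.1 ↔ b ∈ W.1 :=
          ⟨fun h => (isRelClosed_iff.1 hW).2 b a hab.1.1 h (.inl hbY),
            fun h => (isRelOpen_iff.1 hW').2 b a hab.1.1 h (.inl haZ)⟩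
        have e1 : cosectionsExt hAZ (N.cosec A.1 a (N.δHom hab (m.1 b))) =
            if a ∈ A.1 then N.cosec Z.1 a (N.δHom hab (m.1 b)) else 0 := by
          split_ifs with ha
          · rw [cosectionsExt_cosec hAZ ha]
          · rw [cosec_of_notMem ha, map_zero]
        have e2 : N.cosec Z.1 a (N.δHom hab (if b ∈ B.1 then m.1 b else 0)) =
            if b ∈ B.1 then N.cosec Z.1 a (N.δHom hab (m.1 b)) else 0 := by
          split_ifs
          · rfl
          · rw [map_zero, map_zero]
        rw [e1, e2, hA, hB]
        simp only [hS, Set.mem_sdiff, haZ, hbY, hW1]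
        have h2 := fun h => hWYZ (a := b) h
        have h3 := fun h => hWYZ (a := a) h
        simp only [Set.mem_union] at h2 h3
        by_cases h : b ∈ W.1 <;> by_cases h' : a ∈ Y.1 <;> by_cases h'' : b ∈ Z.1 <;>
          simp [h, h', h'']
      · have hm : m.1 b = 0 := m.2.1 b hbY
        simp [hm]
    · have haA : a ∉ A.1 := fun h => haZ ((isRelOpen_iff.1 hAZ).1 h)
      rw [cosec_of_notMem haA, cosec_of_notMem haZ, cosec_of_notMem haZ]
      simp

variable (N) in
theorem extGen_rel ⦃a b : FreePreadd (STObj X)⦄ (f g : a ⟶ b) (h : STRel f g) :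
    (FreePreadd.lift N.extGen).map f = (FreePreadd.lift N.extGen).map g := by
  cases h with
  | i_self h j =>
    rw [lift_extGen_i, CategoryTheory.Functor.map_id]
    exact extI_self h j
  | r_self h j =>
    rw [lift_extGen_r, CategoryTheory.Functor.map_id]
    exact extR_self h j
  | biproduct hd hW rY iY rZ iZ j =>
    rw [Functor.map_add, Functor.map_comp, Functor.map_comp, lift_extGen_i, lift_extGen_r,
      lift_extGen_i, lift_extGen_r, CategoryTheory.Functor.map_id]
    exact ext_biproduct hd hW rY iY rZ iZ j
  | i_i hUV hVY hUY j =>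
    rw [Functor.map_comp, lift_extGen_i, lift_extGen_i, lift_extGen_i]
    exact extI_extI hUV hVY hUY j
  | r_r hDY hCD hCY j =>
    rw [Functor.map_comp, lift_extGen_r, lift_extGen_r, lift_extGen_r]
    exact extR_extR hDY hCD hCY j
  | i_r hU hC hV hVU hVC j =>
    rw [Functor.map_comp, Functor.map_comp, lift_extGen_i, lift_extGen_r, lift_extGen_i,
      lift_extGen_r]
    exact extI_extR hU hC hV hVU hVC j
  | i_δ h hC' h' hjk =>
    rw [Functor.map_comp, lift_extGen_i, lift_extGen_δ, lift_extGen_δ]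
    exact extI_extδ hC' hjk
  | δ_r h hU' h' hjk =>
    rw [Functor.map_comp, lift_extGen_r, lift_extGen_δ, lift_extGen_δ]
    exact extδ_extR hU' hjk
  | r_δ_i hYW hY hW hZW hZ hW' hWYZ hA hB hAY hAZ hBY hZB hjk =>
    rw [Functor.map_comp, Functor.map_comp, lift_extGen_i, lift_extGen_δ, lift_extGen_r,
      lift_extGen_δ]
    exact extδ_extI hW hW' hWYZ hA hB hAZ hBY hjk

variable (N)

/-- The `𝒮𝒯`-module associated with a `ℬ`-module. -/
noncomputable def ext : STMod.{u} X :=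
  ⟨Presented.lift STRel N.extGen N.extGen_rel, inferInstanceAs (Presented.lift _ _ _).Additive⟩

theorem ext_map_i {U Y : LC X} (h : IsRelOpen U.1 Y.1) (j : ZMod 2) :
    N.ext.obj.map (ST.i h j) = N.extI h j := FreePreadd.lift_arr _ _

theorem ext_map_r {Y C : LC X} (h : IsRelClosed C.1 Y.1) (j : ZMod 2) :
    N.ext.obj.map (ST.r h j) = N.extR h j := FreePreadd.lift_arr _ _

theorem ext_map_δ {U C : LC X} (h : IsBoundaryPair U.1 C.1) {j k : ZMod 2} (hjk : k = j + 1) :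
    N.ext.obj.map (ST.δ h hjk) = N.extδ U C j k := FreePreadd.lift_arr _ _

end BMod

end Extension

theorem zero_eq_one_add_one : (0 : ZMod 2) = 1 + 1 := by decide

/-! ### Open–closed decompositions and the reduction of exactness to single points -/

section Decomposition

variable {X : Type u} [TopologicalSpace X] [Finite X]

/-- `U` is relatively open in `Y`, with complement `C`. -/
structure Decomp (U Y C : LC X) : Prop where
  isRelOpen : IsRelOpen U.1 Y.1
  eq_sdiff : C.1 = Y.1 \ U.1

namespace Decomp

variable {U Y C : LC X} (h : Decomp U Y C)
include h

theorem isRelClosed : IsRelClosed C.1 Y.1 := (boundaryPair_side h.isRelOpen h.eq_sdiff).1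

theorem isBoundaryPair : IsBoundaryPair U.1 C.1 := (boundaryPair_side h.isRelOpen h.eq_sdiff).2

theorem subset : U.1 ⊆ Y.1 := (isRelOpen_iff.1 h.isRelOpen).1

theorem eq_union : Y.1 = U.1 ∪ C.1 := by
  rw [h.eq_sdiff, Set.union_sdiff_cancel h.subset]

omit [Finite X] in
theorem disjoint : Disjoint U.1 C.1 := by
  rw [h.eq_sdiff]
  exact Set.disjoint_sdiff_right

end Decomp

theorem isRelOpen_refl (Y : Set X) : IsRelOpen Y Y :=
  isRelOpen_iff.2 ⟨subset_rfl, fun _ _ _ _ h => h⟩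

theorem isRelClosed_refl (Y : Set X) : IsRelClosed Y Y :=
  isRelClosed_iff.2 ⟨subset_rfl, fun _ _ _ _ h => h⟩

theorem IsRelOpen.isLocallyClosed {U Y : Set X} (h : IsRelOpen U Y) (hY : IsLocallyClosed Y) :
    IsLocallyClosed U := by
  simp only [isRelOpen_iff, isLocallyClosed_iff_ptLE] at *
  have ht := @PtLE.trans X _
  grind

theorem IsRelClosed.isLocallyClosed {C Y : Set X} (h : IsRelClosed C Y) (hY : IsLocallyClosed Y) :
    IsLocallyClosed C := by
  simp only [isRelClosed_iff, isLocallyClosed_iff_ptLE] at *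
  have ht := @PtLE.trans X _
  grind

/-- The empty set, as a locally closed set. -/
def emptyLC : LC X := ⟨∅, isOpen_empty.isLocallyClosed⟩

namespace ST

/-- The empty set is topologically disjoint from itself, so the biproduct relation for `∅ = ∅ ∪ ∅`
reads `𝟙 + 𝟙 = 𝟙`. -/
theorem id_eq_zero {Y : LC X} (hY : Y.1 = ∅) (j : ZMod 2) : 𝟙 (obj Y j) = 0 := by
  have h := biproduct (Y := Y) (Z := Y) (W := Y) (by simp [topDisjoint_iff, hY])
    (Set.union_self _).symm (isRelClosed_refl _) (isRelOpen_refl _) (isRelClosed_refl _)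
    (isRelOpen_refl _) j
  rw [r_self, i_self, Category.comp_id] at h
  simpa using h

theorem hom_eq_zero_of_left {Y : LC X} (hY : Y.1 = ∅) {j : ZMod 2} {a : ST X}
    (f : obj Y j ⟶ a) : f = 0 := by
  rw [← Category.id_comp f, id_eq_zero hY, Limits.zero_comp]

theorem hom_eq_zero_of_right {Y : LC X} (hY : Y.1 = ∅) {j : ZMod 2} {a : ST X}
    (f : a ⟶ obj Y j) : f = 0 := by
  rw [← Category.comp_id f, id_eq_zero hY, Limits.comp_zero]

omit [Finite X] in
theorem i_r {U C Y V : LC X} (hU : IsRelOpen U.1 Y.1) (hC : IsRelClosed C.1 Y.1)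
    (hV : V.1 = U.1 ∩ C.1) (hVU : IsRelClosed V.1 U.1) (hVC : IsRelOpen V.1 C.1)
    (j : ZMod 2) : i hU j ≫ r hC j = r hVU j ≫ i hVC j :=
  (Functor.map_comp _ _ _).symm.trans ((Presented.sound (STRel.i_r hU hC hV hVU hVC j)).trans
    (Functor.map_comp _ _ _))

/-- By relation 5 the composite factors through `U ∩ C = ∅`. -/
theorem i_r_eq_zero {U Y C : LC X} (h : Decomp U Y C) (j : ZMod 2) :
    i h.isRelOpen j ≫ r h.isRelClosed j = 0 := by
  have hV : (emptyLC (X := X)).1 = U.1 ∩ C.1 := (Set.disjoint_iff_inter_eq_empty.1 h.disjoint).symm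
  have hs := h.isRelOpen.side h.isRelClosed hV
  rw [i_r h.isRelOpen h.isRelClosed hV hs.1 hs.2,
    hom_eq_zero_of_right (Y := emptyLC) rfl (r hs.1 j), Limits.zero_comp]

/-- Naturality of the boundary morphisms for a filtration of a locally closed set by two relatively
open subsets. -/
theorem δ_i_eq_r_δ {A B C AB BC Y : LC X} (hBC : Decomp B BC C) (hAB : Decomp A AB B)
    (hY : Decomp A Y BC) (hY' : Decomp AB Y C) {j k : ZMod 2} (hjk : k = j + 1) :
    δ hY.isBoundaryPair hjk ≫ i hAB.isRelOpen k = r hBC.isRelClosed j ≫ δ hY'.isBoundaryPair hjk := by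
  have h1 : BC.1 ∪ Y.1 = Y.1 := Set.union_eq_right.2 (isRelClosed_iff.1 hY.isRelClosed).1
  have h2 : AB.1 ∪ Y.1 = Y.1 := Set.union_eq_right.2 hY'.subset
  refine r_δ_i (W := Y) ?_ ?_ ?_ ?_ ?_ ?_ ?_ ?_ hY'.eq_sdiff hY.isBoundaryPair _ _
    hY'.isBoundaryPair hjk
  · rw [h1]; exact Y.2
  · rw [h1]; exact hY.isRelClosed
  · rw [h1]; exact isRelClosed_refl _
  · rw [h2]; exact Y.2
  · rw [h2]; exact hY'.isRelOpen
  · rw [h2]; exact isRelOpen_refl _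
  · rw [hY'.eq_union, hBC.eq_union]
    grind
  · rw [hY.eq_sdiff, Set.sdiff_sdiff_cancel_left hY.subset]

/-- Naturality of `δ` for the filtration `U ⊆ Y ⊆ Y`, whose last stratum is empty, factors the
composite through `∅`. -/
theorem δ_i_eq_zero {U Y C : LC X} (h : Decomp U Y C) {j k : ZMod 2} (hjk : k = j + 1) :
    δ h.isBoundaryPair hjk ≫ i h.isRelOpen k = 0 := by
  have h1 : Decomp C C emptyLC := ⟨isRelOpen_refl _, by simp [emptyLC]⟩
  have h2 : Decomp Y Y emptyLC := ⟨isRelOpen_refl _, by simp [emptyLC]⟩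
  rw [δ_i_eq_r_δ h1 h h h2 hjk, hom_eq_zero_of_right (Y := emptyLC) rfl (r _ j), Limits.zero_comp]

/-- The dual choice of filtration, `∅ ⊆ U ⊆ Y`, has empty first stratum. -/
theorem r_δ_eq_zero {U Y C : LC X} (h : Decomp U Y C) {j k : ZMod 2} (hjk : k = j + 1) :
    r h.isRelClosed j ≫ δ h.isBoundaryPair hjk = 0 := by
  have h1 : Decomp emptyLC U U := ⟨isRelOpen_iff.2 (by simp [emptyLC]), by simp [emptyLC]⟩
  have h2 : Decomp emptyLC Y Y := ⟨isRelOpen_iff.2 (by simp [emptyLC]), by simp [emptyLC]⟩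
  rw [← δ_i_eq_r_δ h h1 h2 h hjk, hom_eq_zero_of_right (Y := emptyLC) rfl (δ _ hjk),
    Limits.zero_comp]

end ST

section Lifting

variable (M : STMod.{w} X)

/-- Exactness of the six-term sequence at `M(C, 1)`, where `h` decomposes `Y` into `U` and `C`. -/
def LiftsAlong {U Y C : LC X} (h : Decomp U Y C) : Prop :=
  ∀ m : M.obj.obj (ST.obj C 1), M.obj.map (ST.δ h.isBoundaryPair (k := 0) (by decide)) m = 0 →
    ∃ m', M.obj.map (ST.r h.isRelClosed 1) m' = m

/-- Exactness of the six-term sequence at `M(U, 0)`, where `h` decomposes `Y` into `U` and `C`. -/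
def BoundsAlong {U Y C : LC X} (h : Decomp U Y C) : Prop :=
  ∀ n : M.obj.obj (ST.obj U 0), M.obj.map (ST.i h.isRelOpen 0) n = 0 →
    ∃ m, M.obj.map (ST.δ h.isBoundaryPair (j := 1) (by decide)) m = n

variable {M} {A B C AB BC Y : LC X} (hAB : Decomp A AB B) (hBC : Decomp B BC C)
  (hY : Decomp A Y BC) (hY' : Decomp AB Y C)
include hAB hBC hY hY'

/-- Here `A ⊆ AB ⊆ Y` is a filtration with strata `A`, `B`, `C`. If `n` dies in `Y`, its image in
`AB` is the boundary of some `m` on `C`. The boundary of `m` in `B` vanishes, so `m` lifts to `BC`,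
and subtracting the boundary of the lift from `n` leaves an element that dies already in `AB`, hence
a boundary from `B`. -/
theorem BoundsAlong.of_left_right (h1 : LiftsAlong M hBC) (h2 : BoundsAlong M hAB)
    (h3 : BoundsAlong M hY') : BoundsAlong M hY := by
  intro n hn
  obtain ⟨m, hm⟩ := h3 (M.obj.map (ST.i hAB.isRelOpen 0) n) (by
    rw [map_map_apply, ST.i_i _ _ hY.isRelOpen, hn])
  obtain ⟨m', rfl⟩ := h1 m (by
    rw [← ST.δ_r hY'.isBoundaryPair hAB.isRelClosed hBC.isBoundaryPair, ← map_map_apply, hm,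
      map_map_apply, ST.i_r_eq_zero hAB, map_zero_apply])
  rw [map_map_apply, ← ST.δ_i_eq_r_δ hBC hAB hY hY', ← map_map_apply] at hm
  obtain ⟨b, hb⟩ := h2 (n - M.obj.map (ST.δ hY.isBoundaryPair zero_eq_one_add_one) m') (by
    rw [map_sub, hm, sub_self])
  refine ⟨M.obj.map (ST.i hBC.isRelOpen 1) b + m', ?_⟩
  rw [map_add, map_map_apply, ST.i_δ hY.isBoundaryPair hBC.isRelOpen hAB.isBoundaryPair, hb,
    sub_add_cancel]

/-- An element on `C` with zero boundary in `AB` lifts first to `BC`. The boundary of that lift in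
`A` dies in `AB`, so it can be corrected by an element of `B`, which does not change the restriction
to `C`; the corrected lift then extends to `Y`. -/
theorem LiftsAlong.of_left_right (h1 : LiftsAlong M hBC) (h2 : BoundsAlong M hAB)
    (h3 : LiftsAlong M hY) : LiftsAlong M hY' := by
  intro m hm
  obtain ⟨m', rfl⟩ := h1 m (by
    rw [← ST.δ_r hY'.isBoundaryPair hAB.isRelClosed hBC.isBoundaryPair, ← map_map_apply, hm,
      map_zero])
  rw [map_map_apply, ← ST.δ_i_eq_r_δ hBC hAB hY hY', ← map_map_apply] at hm
  obtain ⟨b, hb⟩ := h2 _ hm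
  obtain ⟨m'', hm''⟩ := h3 (m' - M.obj.map (ST.i hBC.isRelOpen 1) b) (by
    rw [map_sub, map_map_apply, ST.i_δ hY.isBoundaryPair hBC.isRelOpen hAB.isBoundaryPair, hb,
      sub_self])
  refine ⟨m'', ?_⟩
  rw [← ST.r_r hY.isRelClosed hBC.isRelClosed, ← map_map_apply, hm'', map_sub, map_map_apply,
    ST.i_r_eq_zero hBC, map_zero_apply, sub_zero]

/-- An element `n` on `AB` that dies in `Y` restricts on `B = AB ∩ BC` to one that dies in `BC`,
hence to a boundary from `C`. Subtracting the boundary of the same class in `AB` gives an element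
coming from `A` that dies in `Y`, hence a boundary from `BC`, which naturality pushes to a boundary
from `C`. -/
theorem BoundsAlong.of_middle
    (h1 : Function.Exact (M.obj.map (ST.i hAB.isRelOpen 0)) (M.obj.map (ST.r hAB.isRelClosed 0)))
    (h2 : BoundsAlong M hBC) (h3 : BoundsAlong M hY) : BoundsAlong M hY' := by
  intro n hn
  have hV : B.1 = AB.1 ∩ BC.1 := by
    rw [hAB.eq_sdiff, hY.eq_sdiff]
    have := hY'.subset
    grind
  obtain ⟨m, hm⟩ := h2 (M.obj.map (ST.r hAB.isRelClosed 0) n) (by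
    rw [map_map_apply, ← ST.i_r hY'.isRelOpen hY.isRelClosed hV, ← map_map_apply, hn, map_zero])
  obtain ⟨k, hk⟩ := (h1 (n - M.obj.map (ST.δ hY'.isBoundaryPair zero_eq_one_add_one) m)).1 (by
    rw [map_sub, map_map_apply _ _ _ m,
      ST.δ_r hY'.isBoundaryPair hAB.isRelClosed hBC.isBoundaryPair, hm, sub_self])
  obtain ⟨m', rfl⟩ := h3 k (by
    rw [← ST.i_i hAB.isRelOpen hY'.isRelOpen, ← map_map_apply, hk, map_sub, hn, map_map_apply,
      ST.δ_i_eq_zero hY', map_zero_apply, sub_zero])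
  refine ⟨M.obj.map (ST.r hBC.isRelClosed 1) m' + m, ?_⟩
  rw [map_add, map_map_apply, ← ST.δ_i_eq_r_δ hBC hAB hY hY', ← map_map_apply, hk, sub_add_cancel]

end Lifting

theorem Decomp.ncard_left_lt {U Y C : LC X} (h : Decomp U Y C) (hC : C.1.Nonempty) :
    U.1.ncard < Y.1.ncard := by
  refine Set.ncard_lt_ncard ⟨h.subset, fun h' => ?_⟩ (Set.toFinite _)
  obtain ⟨c, hc⟩ := hC
  rw [h.eq_sdiff] at hc
  exact hc.2 (h' hc.1)

theorem Decomp.ncard_right_lt {U Y C : LC X} (h : Decomp U Y C) (hU : U.1.Nonempty) :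
    C.1.ncard < Y.1.ncard := by
  refine Set.ncard_lt_ncard ⟨h.eq_sdiff ▸ Set.sdiff_subset, fun h' => ?_⟩ (Set.toFinite _)
  obtain ⟨c, hc⟩ := hU
  have := h' (h.subset hc)
  rw [h.eq_sdiff] at this
  exact this.2 hc

/-- Two decompositions `U ⊆ Y` and `A ⊆ U` fit into a filtration by relatively open subsets. -/
theorem Decomp.exists_filtration {A AB Y BC C : LC X} (hY : Decomp A Y BC) (hY' : Decomp AB Y C)
    (hA : A.1 ⊆ AB.1) : ∃ B : LC X, Decomp A AB B ∧ Decomp B BC C := by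
  have h1 := isRelOpen_iff.1 hY.isRelOpen
  have h2 := isRelOpen_iff.1 hY'.isRelOpen
  have e1 := hY.eq_sdiff
  have e2 := hY'.eq_sdiff
  have h3 : IsRelClosed (AB.1 \ A.1) AB.1 := by
    rw [isRelClosed_iff]
    grind
  refine ⟨⟨_, h3.isLocallyClosed AB.2⟩, ⟨?_, rfl⟩, ⟨?_, ?_⟩⟩
  · rw [isRelOpen_iff]; grind
  · simp only [isRelOpen_iff]; grind
  · simp only; grind

variable [T0Space X]

theorem exists_maximal_pt {S : Set X} (hS : S.Nonempty) :
    ∃ z ∈ S, ∀ w ∈ S, PtLE z w → w = z := by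
  let po : PartialOrder X :=
    { le := PtLE
      le_refl := PtLE.refl
      le_trans := fun _ _ _ => PtLE.trans
      le_antisymm := fun _ _ => PtLE.antisymm }
  obtain ⟨z, hz⟩ := S.toFinite.exists_maximal hS
  exact ⟨z, hz.1, fun w hw h => (hz.eq_of_le hw h).symm⟩

theorem exists_minimal_pt {S : Set X} (hS : S.Nonempty) :
    ∃ z ∈ S, ∀ w ∈ S, PtLE w z → w = z := by
  let po : PartialOrder X :=
    { le := PtLE
      le_refl := PtLE.refl
      le_trans := fun _ _ _ => PtLE.trans
      le_antisymm := fun _ _ => PtLE.antisymm }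
  obtain ⟨z, hz⟩ := S.toFinite.exists_minimal hS
  exact ⟨z, hz.1, fun w hw h => (hz.eq_of_ge hw h).symm⟩

/-- A point, as a locally closed set. -/
def ptLC (x : X) : LC X := ⟨{x}, isLocallyClosed_iff_ptLE.2 fun a b c hab hbc ha hc => by
  obtain rfl : a = x := ha
  obtain rfl : c = a := hc
  exact hbc.antisymm hab⟩

theorem Decomp.of_maximal {Y : LC X} {z : X} (hz : z ∈ Y.1) (h : ∀ w ∈ Y.1, PtLE z w → w = z) :
    ∃ C : LC X, Decomp (ptLC z) Y C := by
  have h1 : IsRelOpen (ptLC z).1 Y.1 := isRelOpen_iff.2 ⟨by simpa [ptLC] using hz, by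
    rintro x y hxy rfl hy
    exact h y hy hxy⟩
  have h2 : IsRelClosed (Y.1 \ {z}) Y.1 := by
    simp only [isRelOpen_iff, isRelClosed_iff, ptLC] at *
    grind
  exact ⟨⟨_, h2.isLocallyClosed Y.2⟩, h1, rfl⟩

theorem Decomp.of_minimal {Y : LC X} {x : X} (hx : x ∈ Y.1) (h : ∀ w ∈ Y.1, PtLE w x → w = x) :
    ∃ U : LC X, Decomp U Y (ptLC x) := by
  have h1 : IsRelOpen (Y.1 \ {x}) Y.1 := isRelOpen_iff.2 ⟨Set.sdiff_subset, by
    rintro a y hxy ⟨ha, hax⟩ hy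
    exact ⟨hy, by rintro rfl; exact hax (h a ha hxy)⟩⟩
  refine ⟨⟨_, h1.isLocallyClosed Y.2⟩, h1, ?_⟩
  simpa [ptLC] using hx

/-- Induction on the size of `Y`. A maximal point `z` of `U` is maximal in `Y` because `U` is
relatively open, and a minimal point `x` of `C` is minimal in `Y`. Splitting off `z` and `x`
expresses both properties for `U ⊆ Y` through smaller sets and the two hypotheses about single
points. -/
theorem lifts_and_bounds {M : STMod.{w} X}
    (hex : ∀ {U Y C : LC X} (h : Decomp U Y C),
      Function.Exact (M.obj.map (ST.i h.isRelOpen 0)) (M.obj.map (ST.r h.isRelClosed 0)))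
    (hmax : ∀ {Y C : LC X} {z : X} (h : Decomp (ptLC z) Y C), LiftsAlong M h)
    (hmin : ∀ {Y U : LC X} {x : X} (h : Decomp U Y (ptLC x)), BoundsAlong M h)
    {U Y C : LC X} (h : Decomp U Y C) : LiftsAlong M h ∧ BoundsAlong M h := by
  generalize hn : Y.1.ncard = n
  induction n using Nat.strong_induction_on generalizing U Y C with
  | _ n ih =>
  subst hn
  rcases U.1.eq_empty_or_nonempty with hU | hU
  · constructor
    · intro m _
      obtain rfl : C = Y := Subtype.ext (by rw [h.eq_sdiff, hU, Set.sdiff_empty])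
      exact ⟨m, by rw [ST.r_self, map_id_apply]⟩
    · intro n _
      exact ⟨0, by rw [map_zero, ← map_id_apply M n, ST.id_eq_zero hU, map_zero_apply]⟩
  rcases C.1.eq_empty_or_nonempty with hC | hC
  · constructor
    · intro m _
      exact ⟨0, by rw [map_zero, ← map_id_apply M m, ST.id_eq_zero hC, map_zero_apply]⟩
    · intro n hn
      obtain rfl : U = Y := Subtype.ext (by rw [h.eq_union, hC, Set.union_empty])
      rw [ST.i_self, map_id_apply] at hn
      exact ⟨0, by rw [map_zero, hn]⟩
  obtain ⟨z, hzU, hz⟩ := exists_maximal_pt hU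
  obtain ⟨x, hxC, hx⟩ := exists_minimal_pt hC
  have hzY : z ∈ Y.1 := h.subset hzU
  have hxY : x ∈ Y.1 := (isRelClosed_iff.1 h.isRelClosed).1 hxC
  obtain ⟨Z, hZ⟩ := Decomp.of_maximal hzY fun w hw hzw =>
    hz w ((isRelOpen_iff.1 h.isRelOpen).2 z w hzw hzU hw) hzw
  obtain ⟨V, hV⟩ := Decomp.of_minimal hxY fun w hw hwx =>
    hx w ((isRelClosed_iff.1 h.isRelClosed).2 w x hwx hxC hw) hwx
  have hzV : (ptLC z).1 ⊆ V.1 := by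
    refine Set.singleton_subset_iff.2 ?_
    refine (hV.eq_union ▸ hzY).resolve_right fun (e : z = x) => ?_
    exact Set.disjoint_left.1 h.disjoint hzU (e ▸ hxC)
  obtain ⟨B, hB1, hB2⟩ := hZ.exists_filtration hV hzV
  have nz : (ptLC z).1.Nonempty := ⟨z, rfl⟩
  have nx : (ptLC x).1.Nonempty := ⟨x, rfl⟩
  -- The filtration `{z} ⊆ Y \ {x} ⊆ Y` carries the bounding property from the minimal point `x`,
  -- where it is assumed, to the maximal point `z`.
  have hZb : BoundsAlong M hZ := .of_left_right hB1 hB2 hZ hV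
    (ih _ (hZ.ncard_right_lt nz) hB2 rfl).1 (ih _ (hV.ncard_left_lt nx) hB1 rfl).2 (hmin hV)
  -- The filtration `{z} ⊆ U ⊆ Y` then carries both properties from `{z}` to `U`.
  obtain ⟨U', hU1, hU2⟩ := hZ.exists_filtration h (Set.singleton_subset_iff.2 hzU)
  exact ⟨.of_left_right hU1 hU2 hZ h (ih _ (hZ.ncard_right_lt nz) hU2 rfl).1
    (ih _ (h.ncard_left_lt hC) hU1 rfl).2 (hmax hZ),
    .of_middle hU1 hU2 hZ h (hex hU1) (ih _ (hZ.ncard_right_lt nz) hU2 rfl).2 hZb⟩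

end Decomposition

/-! ### Exactness of the associated `𝒮𝒯`-module -/

section Exactness

variable {X : Type u} [TopologicalSpace X] [Finite X]

namespace BMod

variable {N : BMod.{u} X}

theorem cosec_eq_zero_iff {Y : Set X} {x : X} {n : N.obj.obj (BCat.nb x)} :
    N.cosec Y x n = 0 ↔ N.nbSingle x n ∈ N.cosectionRel Y :=
  QuotientAddGroup.eq_zero_iff (N.nbSingle x n)

theorem sum_pi_single {x : X} (a : {a : X // Arrow a x}) (n : N.obj.obj (BCat.nb a.1))
    {A : Type*} [AddCommGroup A] (φ : ∀ a : {a : X // Arrow a x}, N.obj.obj (BCat.nb a.1) →+ A)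
    (p : ∀ a : {a : X // Arrow a x}, N.obj.obj (BCat.nb a.1)) (hp : p a = n)
    (hp' : ∀ b, b ≠ a → p b = 0) : ∑ b, φ b (p b) = φ a n := by
  rw [Finset.sum_eq_single a, hp]
  · intro b _ hb
    rw [hp' b hb, map_zero]
  · simp

theorem exists_pi_single {x : X} (a : {a : X // Arrow a x}) (n : N.obj.obj (BCat.nb a.1)) :
    ∃ p : ∀ a : {a : X // Arrow a x}, (N.obj.obj (BCat.nb a.1) : Type u), p a = n ∧
      ∀ b, b ≠ a → p b = 0 := by
  classical
  exact ⟨Function.update (fun _ => 0) a n, Function.update_self _ _ _,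
    fun b hb => Function.update_of_ne hb _ _⟩

/-- The structure of the relations in `cosections` at a minimal point `x`. -/
theorem exists_of_mem_cosectionRel {Y U : Set X} {x : X} (hx : x ∈ Y)
    (hmin : ∀ y ∈ Y, ¬ Arrow x y) (hU : U = Y \ {x}) {p : ∀ x, N.obj.obj (BCat.nb x)}
    (hp : p ∈ N.cosectionRel Y) :
    ∃ q : ∀ a : {a : X // Arrow a x}, N.obj.obj (BCat.nb a.1), p x = ∑ a, N.iHom a.2 (q a) ∧
      QuotientAddGroup.mk' (N.cosectionRel U) p = - ∑ a, N.cosec U a.1 (q a) := by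
  unfold cosectionRel at hp
  induction hp using AddSubgroup.closure_induction with
  | mem p hp =>
    rcases hp with ⟨y, hy, n, rfl⟩ | ⟨a, b, h, n, hb, rfl⟩
    · refine ⟨fun _ => 0, ?_, ?_⟩
      · rw [nbSingle_of_ne fun e : x = y => hy (e ▸ hx)]
        simp
      · simp only [map_zero, Finset.sum_const_zero, neg_zero]
        exact cosec_of_notMem (fun h => hy (hU ▸ h).1) n
    -- The only generating relations touching the coordinate `x` are those with target `x`, since by
    -- minimality no arrow starts at `x` and ends in `Y`. In the cosections over `U` the term at `x`
    -- dies and the term `-n` at `a` remains.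
    · by_cases hbx : b = x
      · subst hbx
        obtain ⟨q, hq, hq'⟩ := exists_pi_single (N := N) ⟨a, h⟩ n
        refine ⟨q, ?_, ?_⟩
        · rw [sum_pi_single ⟨a, h⟩ n (fun a => N.iHom a.2) q hq hq', Pi.sub_apply, nbSingle_same,
            nbSingle_of_ne h.1.2, sub_zero]
        · rw [sum_pi_single ⟨a, h⟩ n (fun a => N.cosec U a.1) q hq hq', map_sub]
          change N.cosec U b _ - N.cosec U a n = _
          rw [cosec_of_notMem (by simp [hU]), zero_sub]
      · have hax : a ≠ x := by rintro rfl; exact hmin b hb h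
        refine ⟨fun _ => 0, ?_, ?_⟩
        · rw [Pi.sub_apply, nbSingle_of_ne (Ne.symm hbx), nbSingle_of_ne hax.symm]
          simp
        · simp only [map_zero, Finset.sum_const_zero, neg_zero]
          rw [map_sub]
          exact sub_eq_zero.2 (cosec_iHom h (hU ▸ ⟨hb, hbx⟩) n)
  | zero => exact ⟨fun _ => 0, by simp, by simp⟩
  | add p p' _ _ h h' =>
    obtain ⟨q, hq, hq'⟩ := h
    obtain ⟨r, hr, hr'⟩ := h'
    refine ⟨fun a => q a + r a, ?_, ?_⟩
    · simp only [Pi.add_apply, hq, hr, map_add, Finset.sum_add_distrib]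
    · rw [map_add, hq', hr']
      simp only [map_add, Finset.sum_add_distrib, neg_add]
  | neg p _ h =>
    obtain ⟨q, hq, hq'⟩ := h
    refine ⟨fun a => - q a, ?_, ?_⟩
    · simp only [Pi.neg_apply, hq, map_neg, Finset.sum_neg_distrib]
    · rw [map_neg, hq']
      simp only [map_neg, Finset.sum_neg_distrib]

/-- The cosections over a single point are the cokernel of the incoming maps `i`: this is the
preceding analysis with nothing left after removing `z`. -/
theorem exists_of_cosec_singleton_eq_zero {z : X} {n : N.obj.obj (BCat.nb z)}
    (h : N.cosec {z} z n = 0) :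
    ∃ q : ∀ a : {a : X // Arrow a z}, N.obj.obj (BCat.nb a.1), n = ∑ a, N.iHom a.2 (q a) := by
  obtain ⟨q, hq, -⟩ := exists_of_mem_cosectionRel (Y := {z}) (U := ∅) rfl
    (by rintro _ rfl h; exact h.1.2 rfl) (by simp) (cosec_eq_zero_iff.1 h)
  rw [nbSingle_same] at hq
  exact ⟨q, hq⟩

open Classical in
/-- The family concentrated at a single point. -/
noncomputable def clSingle (x : X) : N.obj.obj (BCat.cl x) →+ ∀ x, N.obj.obj (BCat.cl x) :=
  AddMonoidHom.single (fun x => (N.obj.obj (BCat.cl x) : Type u)) x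

theorem clSingle_same (x : X) (n : N.obj.obj (BCat.cl x)) : N.clSingle x n x = n := by
  classical
  simp [clSingle]

theorem clSingle_of_ne {x y : X} (h : y ≠ x) (n : N.obj.obj (BCat.cl x)) :
    N.clSingle x n y = 0 := by
  classical
  simp [clSingle, Pi.single_eq_of_ne h]

theorem sectionsBoundary_singleton {C U : Set X} {z : X} (m : N.sections C)
    (h : ∀ a b, Arrow a b → a ∈ U → b ∈ C → a = z) :
    sectionsBoundary C U m = N.cosec U z (∑ y : {y : X // Arrow z y}, N.δHom y.2 (m.1 y.1)) := by
  let := Fintype.ofFinite X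
  rw [sectionsBoundary_apply, sum_arrow_left, Finset.sum_eq_single z, map_sum]
  · intro a _ ha
    refine Finset.sum_eq_zero fun b _ => ?_
    by_cases haU : a ∈ U
    · by_cases hbC : b.1 ∈ C
      · exact absurd (h a b.1 b.2 haU hbC) ha
      · rw [m.2.1 b.1 hbC, map_zero, map_zero]
    · exact cosec_of_notMem haU _
  · simp

theorem sectionsBoundary_singleton' {C U : Set X} {x : X} (m : N.sections C)
    (h : ∀ b, b ≠ x → m.1 b = 0) :
    sectionsBoundary C U m = ∑ a : {a : X // Arrow a x}, N.cosec U a.1 (N.δHom a.2 (m.1 x)) := by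
  let := Fintype.ofFinite X
  rw [sectionsBoundary_apply, sum_arrow_right, Finset.sum_eq_single x]
  · intro b _ hb
    refine Finset.sum_eq_zero fun a _ => ?_
    dsimp only
    rw [h b hb, map_zero, map_zero]
  · simp

theorem cosectionsRes_surjective {Y C : LC X} (h : IsRelClosed C.1 Y.1) :
    Function.Surjective (cosectionsRes (N := N) h) := by
  refine cosections_induction ⟨0, map_zero _⟩ ?_ fun x _ n => ⟨_, cosectionsRes_cosec h x n⟩
  rintro _ _ ⟨a, rfl⟩ ⟨b, rfl⟩
  exact ⟨a + b, map_add _ _ _⟩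

/-- Modulo the image of the cosections over `U`, the classes at points of `Y` satisfy the relations
of cosections over `C`. So the quotient map factors through restriction to `C`, and whatever
restricts to zero lies in that image. -/
theorem mem_range_of_cosectionsRes_eq_zero {U Y C : LC X} (h : Decomp U Y C) (a : N.cosections Y.1)
    (ha : cosectionsRes h.isRelClosed a = 0) : a ∈ (cosectionsExt (N := N) h.isRelOpen).range := by
  let R : AddSubgroup (N.cosections Y.1) := (cosectionsExt (N := N) h.isRelOpen).range
  let ψ := cosectionsLift (A := N.cosections Y.1 ⧸ R) (Y := C.1)
    (fun x => (QuotientAddGroup.mk' R).comp (N.cosec Y.1 x))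
      (fun x hx n => by
        refine (QuotientAddGroup.eq_zero_iff (N := R) (N.cosec Y.1 x n)).2 ?_
        by_cases hxU : x ∈ U.1
        · exact ⟨_, cosectionsExt_cosec h.isRelOpen hxU n⟩
        · rw [cosec_of_notMem fun hx' => (h.eq_union ▸ hx' : x ∈ U.1 ∪ C.1).elim hxU hx]
          exact zero_mem _)
      (fun a b hab hb n => by
        have := (isRelClosed_iff.1 h.isRelClosed).1 hb
        simp only [AddMonoidHom.comp_apply, cosec_iHom hab this])
  have hψ : ψ.comp (cosectionsRes h.isRelClosed) = QuotientAddGroup.mk' R :=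
    cosections_hom_ext fun x _ n => by
      rw [AddMonoidHom.comp_apply, cosectionsRes_cosec]
      exact cosectionsLift_cosec _ _ _ x n
  refine (QuotientAddGroup.eq_zero_iff (N := R) a).1 ?_
  refine (DFunLike.congr_fun hψ a).symm.trans ?_
  rw [AddMonoidHom.comp_apply, ha, map_zero]

theorem sectionsExt_injective {U Y : LC X} (h : IsRelOpen U.1 Y.1) :
    Function.Injective (sectionsExt (N := N) h) :=
  AddSubgroup.inclusion_injective _

theorem exists_sectionsExt_eq {U Y C : LC X} (h : Decomp U Y C) (m : N.sections Y.1)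
    (hm : sectionsRes h.isRelClosed m = 0) : ∃ m', sectionsExt h.isRelOpen m' = m := by
  have h0 : ∀ x ∈ C.1, m.1 x = 0 := fun x hx => by
    have := congrArg (fun f => f.1 x) hm
    simpa [sectionsRes_apply, hx] using this
  refine ⟨⟨m.1, fun x hx => ?_, fun x y hxy hx => m.2.2 x y hxy (h.subset hx)⟩, rfl⟩
  by_cases hxY : x ∈ Y.1
  · exact h0 x ((h.eq_union ▸ hxY : x ∈ U.1 ∪ C.1).resolve_left hx)
  · exact m.2.1 x hxY

/-- To extend a family from `C` to the additional maximal point `z`, one needs a value at `z` with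
prescribed images under all `r` out of `z`. Vanishing of the boundary is solvability of this problem
up to the images of the maps `i` into `nb z`, and exactness at `z` provides the value. -/
theorem exists_sectionsRes_eq (hN : BExact N) {Y C : LC X} {z : X} [T0Space X]
    (h : Decomp (ptLC z) Y C) (m : N.sections C.1)
    (hm : sectionsBoundary C.1 (ptLC z).1 m = 0) : ∃ m', sectionsRes h.isRelClosed m' = m := by
  have hzC : z ∉ C.1 := Set.disjoint_left.1 h.disjoint rfl
  change sectionsBoundary C.1 {z} m = 0 at hm
  rw [sectionsBoundary_singleton (U := {z}) (z := z) m fun a b _ ha _ => ha] at hm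
  obtain ⟨q, hq⟩ := exists_of_cosec_singleton_eq_zero hm
  -- The sum of the `δ (m y)` equals the sum of the `i (q a)`, so the second component needs the
  -- sign.
  obtain ⟨m₀, hm₀⟩ := (hN z (fun y => m.1 y.1, fun a => - q a)).1 (by
    change (∑ y : {y : X // Arrow z y}, N.δHom y.2 (m.1 y.1)) + ∑ a, N.iHom a.2 (- q a) = 0
    simp only [hq, map_neg, Finset.sum_neg_distrib, add_neg_cancel])
  have hr : ∀ y (hy : Arrow z y), N.rHom hy m₀ = m.1 y := fun y hy =>
    congrFun (congrArg Prod.fst hm₀) ⟨y, hy⟩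
  refine ⟨⟨m.1 + N.clSingle z m₀, fun x hx => ?_, fun x y hxy hx => ?_⟩, ?_⟩
  · have hxz : x ≠ z := by rintro rfl; exact hx (h.subset rfl)
    rw [Pi.add_apply, clSingle_of_ne hxz, add_zero]
    exact m.2.1 x fun hx' => hx ((isRelClosed_iff.1 h.isRelClosed).1 hx')
  · have hyz : y ≠ z := by
      rintro rfl
      have hxz : x = y := (isRelOpen_iff.1 h.isRelOpen).2 y x hxy.1.1 rfl hx
      exact hxy.1.2 hxz.symm
    rw [Pi.add_apply, Pi.add_apply, clSingle_of_ne hyz, add_zero]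
    by_cases hxz : x = z
    · subst hxz
      rw [clSingle_same, m.2.1 x hzC, zero_add, hr]
    · rw [clSingle_of_ne hxz, add_zero]
      exact m.2.2 x y hxy ((h.eq_union ▸ hx : x ∈ (ptLC z).1 ∪ C.1).resolve_left hxz)
  · refine Subtype.ext (funext fun x => ?_)
    rw [sectionsRes_apply]
    split_ifs with hx
    · have hxz : x ≠ z := by rintro rfl; exact hzC hx
      simp [clSingle_of_ne hxz]
    · exact (m.2.1 x hx).symm

/-- A cosection over `U` that dies after the minimal point `x` is added does so through relations
with target `x`. These are described by a family `q` with `∑ i (q a) = 0`, and exactness at `x`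
shows that `q` comes from an element of `N(cl x)`. -/
theorem exists_sectionsBoundary_eq (hN : BExact N) {U Y : LC X} {x : X} [T0Space X]
    (h : Decomp U Y (ptLC x)) (n : N.cosections U.1)
    (hn : cosectionsExt h.isRelOpen n = 0) : ∃ m, sectionsBoundary (ptLC x).1 U.1 m = n := by
  have hxU : x ∉ U.1 := fun hx => Set.disjoint_left.1 h.disjoint hx rfl
  have hxY : x ∈ Y.1 := (isRelClosed_iff.1 h.isRelClosed).1 rfl
  have hUY : U.1 = Y.1 \ {x} := by
    have h1 : (ptLC x).1 = {x} := rfl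
    rw [← h1, h.eq_sdiff, Set.sdiff_sdiff_cancel_left h.subset]
  -- A representative vanishing at `x` represents both `n` and its image over `Y`; the coordinate at
  -- `x` is not seen over `U` but matters over `Y`.
  obtain ⟨p, hpx, hp, hp'⟩ : ∃ p : ∀ x, N.obj.obj (BCat.nb x), p x = 0 ∧
      QuotientAddGroup.mk' (N.cosectionRel U.1) p = n ∧
      QuotientAddGroup.mk' (N.cosectionRel Y.1) p = cosectionsExt h.isRelOpen n := by
    clear hn
    revert n
    refine cosections_induction ⟨0, rfl, map_zero _, ?_⟩ ?_ fun y hy n => ⟨N.nbSingle y n, ?_⟩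
    · rw [map_zero, map_zero]
    · rintro a b ⟨p, hp, hp', hp''⟩ ⟨q, hq, hq', hq''⟩
      refine ⟨p + q, ?_, ?_, ?_⟩
      · rw [Pi.add_apply, hp, hq, add_zero]
      · rw [map_add, hp', hq']
      · rw [map_add, hp'', hq'', map_add]
    · refine ⟨nbSingle_of_ne (fun e : x = y => hxU (e ▸ hy)) n, rfl, ?_⟩
      exact (cosectionsExt_cosec h.isRelOpen hy n).symm
  rw [hn] at hp'
  obtain ⟨q, hq, hq'⟩ := exists_of_mem_cosectionRel hxY (fun y hy hxy => by
    obtain rfl : y = x := (isRelClosed_iff.1 h.isRelClosed).2 y x hxy.1.1 rfl hy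
    exact hxy.1.2 rfl) hUY ((QuotientAddGroup.eq_zero_iff p).1 hp')
  rw [hpx] at hq
  -- The component `0` makes `r m = 0`, so that `m` is a section over the point `x`; the component
  -- `q = -δ m` makes its boundary equal to `n`.
  obtain ⟨m, hm⟩ := (hN x (fun _ => 0, q)).1 (by
    change (∑ y : {y : X // Arrow x y}, N.δHom y.2 0) + ∑ a, N.iHom a.2 (q a) = 0
    simp [← hq])
  have hr : ∀ y (hy : Arrow x y), N.rHom hy m = 0 := fun y hy =>
    congrFun (congrArg Prod.fst hm) ⟨y, hy⟩
  have hd : ∀ a (ha : Arrow a x), - N.δHom ha m = q ⟨a, ha⟩ := fun a ha =>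
    congrFun (congrArg Prod.snd hm) ⟨a, ha⟩
  have hs : N.clSingle x m ∈ N.sections (ptLC x).1 := by
    refine ⟨fun y (hy : y ≠ x) => clSingle_of_ne hy m, ?_⟩
    rintro y z hyz (rfl : y = x)
    rw [clSingle_same, clSingle_of_ne hyz.1.2, hr]
  refine ⟨⟨_, hs⟩, ?_⟩
  rw [sectionsBoundary_singleton' (x := x) ⟨_, hs⟩ fun b hb => clSingle_of_ne hb m]
  rw [← hp, hq', ← Finset.sum_neg_distrib]
  refine Finset.sum_congr rfl fun a _ => ?_
  rw [← hd, map_neg, neg_neg]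
  simp only [clSingle_same]

variable (N) in
theorem ext_exact_zero {U Y C : LC X} (h : Decomp U Y C) :
    Function.Exact (N.ext.obj.map (ST.i h.isRelOpen 0)) (N.ext.obj.map (ST.r h.isRelClosed 0)) := by
  refine fun a => ⟨fun ha => ?_, ?_⟩
  · rw [ext_map_r] at ha
    rw [ext_map_i]
    exact mem_range_of_cosectionsRes_eq_zero h a ha
  · rintro ⟨b, rfl⟩
    rw [map_map_apply, ST.i_r_eq_zero h, map_zero_apply]

variable [T0Space X]

theorem ext_lifts_and_bounds (hN : BExact N) {U Y C : LC X} (h : Decomp U Y C) :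
    LiftsAlong N.ext h ∧ BoundsAlong N.ext h := by
  refine lifts_and_bounds (ext_exact_zero N) (fun h m hm => ?_) (fun h n hn => ?_) h
  · rw [ext_map_δ] at hm
    rw [ext_map_r]
    exact exists_sectionsRes_eq hN h m hm
  · rw [ext_map_i] at hn
    rw [ext_map_δ]
    exact exists_sectionsBoundary_eq hN h n hn

omit [T0Space X] in
theorem ext_realRankZeroLike : STRealRankZeroLike N.ext := fun _ _ h => ext_map_δ N h _

/-- The composites vanish already in `𝒮𝒯`. Since `δ` from degree 0 is zero, the two positions next
to it say that `r` is surjective in degree 0 and `i` injective in degree 1. The middle positions are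
right exactness of cosections and left exactness of sections, and the remaining two are
`ext_lifts_and_bounds`. -/
theorem ext_stExact (hN : BExact N) : STExact N.ext := by
  intro U Y C hU hC hUC hCU j k hjk
  have h : Decomp U Y C := ⟨hU, hCU⟩
  subst hjk
  have e1 := ST.i_r_eq_zero h j
  have e2 := ST.r_δ_eq_zero h (j := j) rfl
  have e3 := ST.δ_i_eq_zero h (j := j) rfl
  obtain ⟨hl, hb⟩ := ext_lifts_and_bounds hN h
  refine ⟨fun a => ⟨fun ha => ?_, ?_⟩, fun a => ⟨fun ha => ?_, ?_⟩, fun a => ⟨fun ha => ?_, ?_⟩⟩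
  rotate_left
  · rintro ⟨b, rfl⟩
    rw [map_map_apply, e1, map_zero_apply]
  rotate_left
  · rintro ⟨b, rfl⟩
    rw [map_map_apply, e2, map_zero_apply]
  rotate_left
  · rintro ⟨b, rfl⟩
    rw [map_map_apply, e3, map_zero_apply]
  · induction j using zmod_two_cases
    · exact (ext_exact_zero N h a).1 ha
    · rw [ext_map_r] at ha
      rw [ext_map_i]
      exact exists_sectionsExt_eq h a ha
  · induction j using zmod_two_cases
    · rw [ext_map_r]
      exact cosectionsRes_surjective hC a
    · exact hl a ha
  · induction j using zmod_two_cases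
    · refine ⟨0, (map_zero _).trans ?_⟩
      rw [ext_map_i] at ha
      exact ((injective_iff_map_eq_zero _).1 (sectionsExt_injective hU) a ha).symm
    · exact hb a ha

end BMod

end Exactness

/-! ### Restricting the associated `𝒮𝒯`-module recovers the `ℬ`-module -/

section Restriction

variable {X : Type u} [TopologicalSpace X] [Finite X] [T0Space X]

omit [Finite X] in
theorem PtLT.trans {x y z : X} (h : PtLT x y) (h' : PtLT y z) : PtLT x z :=
  ⟨h.1.trans h'.1, fun e => h.2 (h.1.antisymm (e ▸ h'.1))⟩

theorem ptLT_induction {P : X → Prop} (h : ∀ x, (∀ y, PtLT y x → P y) → P x) (x : X) : P x := by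
  have : IsTrans X PtLT := ⟨fun _ _ _ => PtLT.trans⟩
  have : Std.Irrefl (PtLT (X := X)) := ⟨fun a h => h.2 rfl⟩
  exact (Finite.wellFounded_of_trans_of_irrefl (PtLT (X := X))).induction x h

theorem ptGT_induction {P : X → Prop} (h : ∀ x, (∀ y, PtLT x y → P y) → P x) (x : X) : P x := by
  have : IsTrans X (fun x y : X => PtLT y x) := ⟨fun _ _ _ h h' => PtLT.trans h' h⟩
  have : Std.Irrefl (fun x y : X => PtLT y x) := ⟨fun a h => h.2 rfl⟩
  exact (Finite.wellFounded_of_trans_of_irrefl (fun x y : X => PtLT y x)).induction x h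

omit [Finite X] in
theorem Arrow.not_ptLE {x y : X} (h : Arrow x y) : ¬ PtLE x y := fun h' =>
  h.1.2 (h.1.1.antisymm h')

theorem UniquePath.eq_of_ptLE_of_ptLE (hX : UniquePath X) {x y y' a : X} (h : Arrow x y)
    (h' : Arrow x y') (ha : PtLE a y) (ha' : PtLE a y') : y = y' := by
  by_contra hne
  exact (topDisjoint_iff.1 (hX.topDisjoint_cl h h' hne) a (mem_closure_pt.2 ha) a
    (mem_closure_pt.2 ha')).1 (.refl a)

theorem UniquePath.eq_of_ptLE_of_ptLE' (hX : UniquePath X) {x z z' a : X} (h : Arrow z x)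
    (h' : Arrow z' x) (ha : PtLE z a) (ha' : PtLE z' a) : z = z' := by
  by_contra hne
  exact (topDisjoint_iff.1 (hX.topDisjoint_nb h h' hne) a (mem_nhdsKer_pt.2 ha) a
    (mem_nhdsKer_pt.2 ha')).1 (.refl a)

omit [Finite X] in
-- Both `x` and `y` lie between `b` and `a`, where an arrow leaves no room. Hence `x → y` is the
-- only arrow from the smallest neighbourhood of `x` to the closure of `y`.
theorem Arrow.eq_and_eq {x y a b : X} (hxy : Arrow x y) (hab : Arrow a b) (ha : PtLE x a)
    (hb : PtLE b y) : a = x ∧ b = y := by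
  have h1 := hab.eq_or_eq hb (hxy.1.1.trans ha)
  have h2 := hab.eq_or_eq (hb.trans hxy.1.1) ha
  rcases h2 with rfl | rfl
  · exact absurd hb hxy.not_ptLE
  · rcases h1 with rfl | rfl
    · exact ⟨rfl, rfl⟩
    · exact absurd rfl hxy.1.2

namespace BMod

variable {N : BMod.{u} X}

/-- Every point strictly below `x` is the target of an arrow starting in the closure of `x`, so
values propagate down from `x`. -/
theorem sections_closure_eq_zero {x : X} (m : N.sections (closure {x})) (hm : m.1 x = 0) :
    m = 0 := by
  refine Subtype.ext (funext fun y => ?_)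
  induction y using ptGT_induction with
  | _ y ih =>
  by_cases hy : PtLE y x
  · by_cases hyx : y = x
    · subst hyx; exact hm
    · obtain ⟨z, hz, hzx⟩ := exists_arrow_left ⟨hy, hyx⟩
      rw [← m.2.2 z y hz (mem_closure_pt.2 hzx), ih z hz.1]
      exact map_zero _
  · exact m.2.1 y fun h => hy (mem_closure_pt.1 h)

/-- By induction each `r n` extends to a section over the closure of its `y`, for `x → y`. These
closures are disjoint and fill the closure of `x` except for `x`, so the extensions add up, together
with `n` at `x`, to a compatible family. -/
theorem exists_sections_closure (hX : UniquePath X) (x : X) (n : N.obj.obj (BCat.cl x)) :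
    ∃ m : N.sections (closure {x}), m.1 x = n := by
  induction x using ptLT_induction with
  | _ x ih =>
  choose f hf using fun y : {y : X // Arrow x y} => ih y.1 y.2.1 (N.rHom y.2 n)
  have hfx : ∀ y z, ¬ PtLE z y.1 → (f y).1 z = 0 := fun y z h =>
    (f y).2.1 z fun h' => h (mem_closure_pt.1 h')
  have happ : ∀ z, (N.clSingle x n + ∑ y, (f y).1) z = N.clSingle x n z + ∑ y, (f y).1 z := by
    intro z
    rw [Pi.add_apply, Finset.sum_apply]
  refine ⟨⟨N.clSingle x n + ∑ y, (f y).1, fun z hz => ?_, fun a b hab ha => ?_⟩, ?_⟩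
  · rw [mem_closure_pt] at hz
    rw [happ, clSingle_of_ne (by rintro rfl; exact hz (.refl _)), zero_add]
    exact Finset.sum_eq_zero fun y _ => hfx y z fun h => hz (h.trans y.2.1.1)
  · rw [mem_closure_pt] at ha
    have hbx : b ≠ x := by rintro rfl; exact hab.not_ptLE ha
    rw [happ, happ, clSingle_of_ne hbx, zero_add]
    by_cases hax : a = x
    · subst hax
      rw [clSingle_same, Finset.sum_eq_zero fun y _ => hfx y a y.2.not_ptLE, add_zero,
        Finset.sum_eq_single ⟨b, hab⟩, hf]
      · exact fun y _ hy => hfx y b fun h => hy (Subtype.ext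
          (hX.eq_of_ptLE_of_ptLE y.2 hab h (.refl b)))
      · simp
    · rw [clSingle_of_ne hax, zero_add, map_sum]
      refine Finset.sum_congr rfl fun y _ => ?_
      by_cases hay : PtLE a y.1
      · exact (f y).2.2 a b hab (mem_closure_pt.2 hay)
      -- Here `a` lies under another point `z` with `x → z`, hence so does `b`; thus `b` is not
      -- under `y` and both terms vanish.
      · obtain ⟨z, hz, haz⟩ := exists_arrow_right ⟨ha, hax⟩
        rw [hfx y a hay, map_zero, hfx y b]
        intro hby
        have := hX.eq_of_ptLE_of_ptLE y.2 hz hby (hab.1.1.trans haz)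
        exact hay (this ▸ haz)
  · change (N.clSingle x n + ∑ y, (f y).1) x = n
    rw [happ, clSingle_same, Finset.sum_eq_zero fun y _ => hfx y x y.2.not_ptLE, add_zero]

variable (N) in
/-- Evaluation identifies the compatible families on the closure of a point with the value
there. -/
noncomputable def sectionsClosureEquiv (hX : UniquePath X) (x : X) :
    N.sections (closure {x}) ≃+ N.obj.obj (BCat.cl x) :=
  AddEquiv.ofBijective ((Pi.evalAddMonoidHom (fun x => (N.obj.obj (BCat.cl x) : Type u)) x).comp
    (N.sections _).subtype) ⟨(injective_iff_map_eq_zero _).2 sections_closure_eq_zero,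
      exists_sections_closure hX x⟩

/-- A class at a point above `x` moves down to `x` along arrows, through the relations given by `i`.
-/
theorem cosec_nhdsKer_surjective (x : X) : Function.Surjective (N.cosec (nhdsKer {x}) x) := by
  intro a
  change a ∈ (N.cosec (nhdsKer {x}) x).range
  refine cosections_induction (zero_mem _) (fun _ _ => add_mem) (fun y hy n => ?_) a
  induction y using ptLT_induction with
  | _ y ih =>
  rw [mem_nhdsKer_pt] at hy
  by_cases hyx : x = y
  · subst hyx; exact ⟨n, rfl⟩
  · obtain ⟨z, hz, hxz⟩ := exists_arrow_right ⟨hy, hyx⟩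
    rw [← cosec_iHom hz (mem_nhdsKer_pt.2 hxz)]
    exact ih z hz.1 (mem_nhdsKer_pt.2 hxz) _

/-- The map `φ a` is the composite of the maps `i` along the unique path from `a` to `x`, and zero
if there is none. It is built by splitting off the last arrow `z → x` of the path. These maps define
a left inverse of `cosec` on the smallest neighbourhood of `x`. -/
theorem exists_retraction (hX : UniquePath X) (x : X) :
    ∃ φ : ∀ a, N.obj.obj (BCat.nb a) →+ N.obj.obj (BCat.nb x), (∀ n, φ x n = n) ∧
      (∀ a, ¬ PtLE x a → ∀ n, φ a n = 0) ∧
      ∀ a b (h : Arrow a b), PtLE x b → ∀ n, φ b (N.iHom h n) = φ a n := by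
  classical
  induction x using ptGT_induction with
  | _ x ih =>
  choose f hf hf' hf'' using fun z : {z : X // Arrow z x} => ih z.1 z.2.1
  have h1 : ∀ a, a ≠ x → Function.update (fun a => ∑ z, (N.iHom z.2).comp (f z a)) x
      (AddMonoidHom.id _) a = ∑ z, (N.iHom z.2).comp (f z a) := fun a ha =>
    Function.update_of_ne ha _ _
  refine ⟨Function.update (fun a => ∑ z, (N.iHom z.2).comp (f z a)) x (AddMonoidHom.id _),
    fun n => by rw [Function.update_self]; rfl, fun a ha n => ?_, fun a b hab hb n => ?_⟩
  · rw [h1 a (by rintro rfl; exact ha (.refl _)), AddMonoidHom.finsetSum_apply]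
    refine Finset.sum_eq_zero fun z _ => ?_
    rw [AddMonoidHom.comp_apply, hf' z a fun h => ha (z.2.1.1.trans h), map_zero]
  · have hax : a ≠ x := by rintro rfl; exact hab.not_ptLE hb
    rw [h1 a hax, AddMonoidHom.finsetSum_apply]
    by_cases hbx : b = x
    · subst hbx
      rw [Function.update_self, Finset.sum_eq_single ⟨a, hab⟩, AddMonoidHom.comp_apply, hf]
      · rfl
      · intro z _ hz
        rw [AddMonoidHom.comp_apply, hf' z a, map_zero]
        exact fun h => hz (Subtype.ext (hX.eq_of_ptLE_of_ptLE' z.2 hab h (.refl a)))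
      · simp
    · rw [h1 b hbx, AddMonoidHom.finsetSum_apply]
      refine Finset.sum_congr rfl fun z _ => ?_
      rw [AddMonoidHom.comp_apply, AddMonoidHom.comp_apply]
      by_cases hbz : PtLE z.1 b
      · rw [hf'' z a b hab hbz]
      · obtain ⟨y, hy, hyb⟩ := exists_arrow_left ⟨hb, Ne.symm hbx⟩
        rw [hf' z b hbz, hf' z a]
        intro haz
        exact hbz (hX.eq_of_ptLE_of_ptLE' z.2 hy haz (hyb.trans hab.1.1) ▸ hyb)

theorem cosec_nhdsKer_injective (hX : UniquePath X) (x : X) :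
    Function.Injective (N.cosec (nhdsKer {x}) x) := by
  obtain ⟨φ, h1, h2, h3⟩ := exists_retraction (N := N) hX x
  refine Function.LeftInverse.injective (g := cosectionsLift φ
    (fun a ha => h2 a fun h => ha (mem_nhdsKer_pt.2 h))
    (fun a b h hb => h3 a b h (mem_nhdsKer_pt.1 hb))) fun n => ?_
  rw [cosectionsLift_cosec, h1]

variable (N) in
/-- The value at the smallest neighbourhood of a point is identified with `cosections` there. -/
noncomputable def cosectionsNhdsKerEquiv (hX : UniquePath X) (x : X) :
    N.obj.obj (BCat.nb x) ≃+ N.cosections (nhdsKer {x}) :=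
  AddEquiv.ofBijective (N.cosec (nhdsKer {x}) x)
    ⟨cosec_nhdsKer_injective hX x, cosec_nhdsKer_surjective x⟩

theorem sectionsBoundary_arrow {x y : X} (h : Arrow x y) (m : N.sections (closure {y})) :
    sectionsBoundary (closure {y}) (nhdsKer {x}) m =
      N.cosec (nhdsKer {x}) x (N.δHom h (m.1 y)) := by
  rw [sectionsBoundary_apply, Finset.sum_eq_single ⟨(x, y), h⟩]
  · rintro ⟨⟨a, b⟩, hab⟩ _ hne
    dsimp only at hab ⊢
    by_cases ha : PtLE x a
    · by_cases hb : PtLE b y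
      · obtain ⟨rfl, rfl⟩ := h.eq_and_eq hab ha hb
        exact absurd rfl hne
      · rw [m.2.1 b fun h => hb (mem_closure_pt.1 h), map_zero, map_zero]
    · exact cosec_of_notMem (fun h => ha (mem_nhdsKer_pt.1 h)) _
  · simp

variable (N) in
/-- The components of `restrictExtIso`. -/
noncomputable def restrictExtApp (hX : UniquePath X) : (a : BObj X) →
    (((restrictToBase hX).obj N.ext).obj.obj (Presented.obj BRel a) ≅
      N.obj.obj (Presented.obj BRel a))
  | .cl x => (N.sectionsClosureEquiv hX x).toAddCommGrpIso
  | .nb x => (N.cosectionsNhdsKerEquiv hX x).symm.toAddCommGrpIso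

variable (N) in
/-- Restricting the `𝒮𝒯`-module associated with a `ℬ`-module recovers the `ℬ`-module. -/
noncomputable def restrictExtIso (hX : UniquePath X) : (restrictToBase hX).obj N.ext ≅ N := by
  refine ObjectProperty.isoMk _ (Presented.natIso _ _ (N.restrictExtApp hX) ?_)
  intro a b e
  change BGen a b at e
  cases e with
  | @r x y h =>
    have e1 : ((restrictToBase hX).obj N.ext).obj.map (BCat.r h) = N.extR (clLC_rel h) 1 :=
      (congrArg N.ext.obj.map (baseFunctor_map_r hX h)).trans (N.ext_map_r (clLC_rel h) 1)
    refine Eq.trans (congrArg (· ≫ _) e1) (AddCommGrpCat.hom_ext (AddMonoidHom.ext fun m => ?_))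
    change N.sections (closure {x}) at m
    change (sectionsRes (clLC_rel h) m).1 y = N.rHom h (m.1 x)
    exact (sectionsRes_apply (clLC_rel h) m y).trans ((if_pos (mem_closure_pt.2 (.refl y))).trans
      (m.2.2 x y h (mem_closure_pt.2 (.refl x))).symm)
  | @δ x y h =>
    have e1 : ((restrictToBase hX).obj N.ext).obj.map (BCat.δ h) =
        N.extδ (nbLC x) (clLC y) 1 0 :=
      (congrArg N.ext.obj.map (baseFunctor_map_δ hX h)).trans (N.ext_map_δ _ _)
    refine Eq.trans (congrArg (· ≫ _) e1) (AddCommGrpCat.hom_ext (AddMonoidHom.ext fun m => ?_))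
    change N.sections (closure {y}) at m
    exact (AddEquiv.symm_apply_eq (N.cosectionsNhdsKerEquiv hX x)).2 (sectionsBoundary_arrow h m)
  | @i x y h =>
    have e1 : ((restrictToBase hX).obj N.ext).obj.map (BCat.i h) = N.extI (nbLC_rel h) 0 :=
      (congrArg N.ext.obj.map (baseFunctor_map_i hX h)).trans (N.ext_map_i (nbLC_rel h) 0)
    refine Eq.trans (congrArg (· ≫ _) e1) (AddCommGrpCat.hom_ext (AddMonoidHom.ext fun m => ?_))
    obtain ⟨n, rfl⟩ := (N.cosectionsNhdsKerEquiv hX x).surjective m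
    refine (AddEquiv.symm_apply_eq (N.cosectionsNhdsKerEquiv hX y)).2 ?_
    change cosectionsExt (nbLC_rel h) (N.cosec (nhdsKer {x}) x n) = N.cosec (nhdsKer {y}) y
      (N.iHom h ((N.cosectionsNhdsKerEquiv hX x).symm (N.cosectionsNhdsKerEquiv hX x n)))
    rw [AddEquiv.symm_apply_apply]
    exact (cosectionsExt_cosec (nbLC_rel h) (mem_nhdsKer_pt.2 (.refl x)) n).trans
      (cosec_iHom h (mem_nhdsKer_pt.2 (.refl y)) n).symm

end BMod

end Restriction

/-! ### In an EBP space every boundary map is a sum over arrows -/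

section BoundaryDecomposition

variable {X : Type u} [TopologicalSpace X] [Finite X]

theorem mem_closure_iff_ptLE {S : Set X} {x : X} : x ∈ closure S ↔ ∃ y ∈ S, PtLE x y := by
  constructor
  · refine fun h => closure_minimal (t := {x | ∃ y ∈ S, PtLE x y}) (fun y hy => ⟨y, hy, .refl y⟩)
      (isClosed_iff_ptLE.2 ?_) h
    rintro x y hxy ⟨z, hz, hyz⟩
    exact ⟨z, hz, hxy.trans hyz⟩
  · rintro ⟨y, hy, hxy⟩
    exact closure_mono (Set.singleton_subset_iff.2 hy) (mem_closure_pt.2 hxy)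

omit [Finite X] in
theorem mem_nhdsKer_iff_ptLE {S : Set X} {x : X} : x ∈ nhdsKer S ↔ ∃ y ∈ S, PtLE y x := by
  simp only [mem_nhdsKer_iff_specializes, ptLE_iff]

namespace ST

/-- Relation 8 with `Y = C`, `Z = U` and `W = U' ∪ C`. The hypothesis that all points of `U` above
points of `C` lie in `U'` is what makes `W` relatively open in `U ∪ C`. -/
theorem δ_i {U U' C : LC X} (h : IsBoundaryPair U.1 C.1) (hU' : IsRelOpen U'.1 U.1)
    (h' : IsBoundaryPair U'.1 C.1) (hUC : ∀ a ∈ U.1, ∀ b ∈ C.1, PtLE b a → a ∈ U'.1)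
    {j k : ZMod 2} (hjk : k = j + 1) : δ h' hjk ≫ i hU' k = δ h hjk := by
  have hb := isBoundaryPair_iff.1 h
  have hb' := isBoundaryPair_iff.1 h'
  have ho := isRelOpen_iff.1 hU'
  have hd := Set.disjoint_left.1 hb.2.1
  let W : LC X := ⟨U'.1 ∪ C.1, hb'.1⟩
  have h1 : C.1 ∪ W.1 = W.1 := Set.union_eq_right.2 Set.subset_union_right
  have h2 : U.1 ∪ W.1 = U.1 ∪ C.1 := by
    simp only [W]
    grind
  have key := r_δ_i (Y := C) (Z := U) (W := W) (A := U') (B := C) (by rw [h1]; exact W.2)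
    (by rw [h1, isRelClosed_iff]; simp only [W]; grind) (by rw [h1]; exact isRelClosed_refl _)
    (by rw [h2]; exact hb.1) (by rw [h2, isRelOpen_iff]; grind)
    (by rw [h2, isRelOpen_iff]; simp only [W]; grind) (by simp only [W]; grind)
    (by simp only [W]; grind) (by simp only [W]; grind) h' hU' (isRelClosed_refl _) h hjk
  rw [key, r_self, Category.id_comp]

/-- Dually, relation 8 with `Y = C`, `Z = U` and `W = U ∪ C'`, which the hypothesis makes relatively
closed in `U ∪ C`. -/
theorem r_δ {U C C' : LC X} (h : IsBoundaryPair U.1 C.1) (hC' : IsRelClosed C'.1 C.1)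
    (h' : IsBoundaryPair U.1 C'.1) (hUC : ∀ a ∈ U.1, ∀ b ∈ C.1, PtLE b a → b ∈ C'.1)
    {j k : ZMod 2} (hjk : k = j + 1) : r hC' j ≫ δ h' hjk = δ h hjk := by
  have hb := isBoundaryPair_iff.1 h
  have hb' := isBoundaryPair_iff.1 h'
  have ho := isRelClosed_iff.1 hC'
  have hd := Set.disjoint_left.1 hb.2.1
  let W : LC X := ⟨U.1 ∪ C'.1, hb'.1⟩
  have h1 : U.1 ∪ W.1 = W.1 := Set.union_eq_right.2 Set.subset_union_left
  have h2 : C.1 ∪ W.1 = U.1 ∪ C.1 := by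
    simp only [W]
    grind
  have key := r_δ_i (Y := C) (Z := U) (W := W) (A := U) (B := C') (by rw [h2]; exact hb.1)
    (by rw [h2, isRelClosed_iff]; grind) (by rw [h2, isRelClosed_iff]; simp only [W]; grind)
    (by rw [h1]; exact W.2) (by rw [h1, isRelOpen_iff]; simp only [W]; grind)
    (by rw [h1]; exact isRelOpen_refl _) (by simp only [W]; grind)
    (by simp only [W]; grind) (by simp only [W]; grind) h (isRelOpen_refl _) hC' h' hjk
  rw [← key, i_self, Category.comp_id]

end ST

/-- The intersection of a locally closed set with the closure of a point. -/
def capCl (C : LC X) (y : X) : LC X :=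
  ⟨C.1 ∩ closure {y}, C.2.inter isClosed_closure.isLocallyClosed⟩

/-- The intersection of a locally closed set with the smallest neighbourhood of a point. -/
def capNb (U : LC X) (x : X) : LC X :=
  ⟨U.1 ∩ nhdsKer {x}, U.2.inter isOpen_nhdsKer.isLocallyClosed⟩

omit [Finite X] in
theorem capCl_isRelClosed (C : LC X) (y : X) : IsRelClosed (capCl C y).1 C.1 :=
  ⟨closure {y}, isClosed_closure, Set.inter_comm _ _⟩

theorem capNb_isRelOpen (U : LC X) (x : X) : IsRelOpen (capNb U x).1 U.1 :=
  ⟨nhdsKer {x}, isOpen_nhdsKer, Set.inter_comm _ _⟩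

/-- A locally closed set contains every point between two of its points; here the upper one is `y`.
-/
theorem capCl_isRelOpen {C : LC X} {y : X} (hy : y ∈ C.1) :
    IsRelOpen (capCl C y).1 (clLC y).1 :=
  isRelOpen_iff.2 ⟨Set.inter_subset_right, fun a b hab ha hb =>
    ⟨isLocallyClosed_iff_ptLE.1 C.2 a b y hab (mem_closure_pt.1 hb) ha.1 hy, hb⟩⟩

theorem capNb_isRelClosed {U : LC X} {x : X} (hx : x ∈ U.1) :
    IsRelClosed (capNb U x).1 (nbLC x).1 :=
  isRelClosed_iff.2 ⟨Set.inter_subset_right, fun a b hab hb ha =>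
    ⟨isLocallyClosed_iff_ptLE.1 U.2 x a b (mem_nhdsKer_pt.1 ha) hab hx hb.1, ha⟩⟩

namespace ST

open Classical in
/-- The morphism from `C` to the closure of one of its points. -/
noncomputable def toCl (C : LC X) (y : X) (j : ZMod 2) : obj C j ⟶ obj (clLC y) j :=
  if h : y ∈ C.1 then r (capCl_isRelClosed C y) j ≫ i (capCl_isRelOpen h) j else 0

open Classical in
/-- The morphism from the smallest neighbourhood of a point of `U` to `U`. -/
noncomputable def fromNb (x : X) (U : LC X) (j : ZMod 2) : obj (nbLC x) j ⟶ obj U j :=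
  if h : x ∈ U.1 then r (capNb_isRelClosed h) j ≫ i (capNb_isRelOpen U x) j else 0

theorem toCl_of_notMem {C : LC X} {y : X} (hy : y ∉ C.1) (j : ZMod 2) : toCl C y j = 0 :=
  dif_neg hy

theorem fromNb_of_notMem {U : LC X} {x : X} (hx : x ∉ U.1) (j : ZMod 2) : fromNb x U j = 0 :=
  dif_neg hx

theorem toCl_eq {C V : LC X} {y : X} (hy : y ∈ C.1) (hV : V.1 = C.1 ∩ closure {y})
    (hr : IsRelClosed V.1 C.1) (hi : IsRelOpen V.1 (clLC y).1) (j : ZMod 2) :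
    toCl C y j = r hr j ≫ i hi j := by
  obtain rfl : V = capCl C y := Subtype.ext hV
  exact dif_pos hy

theorem fromNb_eq {U V : LC X} {x : X} (hx : x ∈ U.1) (hV : V.1 = U.1 ∩ nhdsKer {x})
    (hr : IsRelClosed V.1 (nbLC x).1) (hi : IsRelOpen V.1 U.1) (j : ZMod 2) :
    fromNb x U j = r hr j ≫ i hi j := by
  obtain rfl : V = capNb U x := Subtype.ext hV
  exact dif_pos hx

theorem toCl_self (y : X) (j : ZMod 2) : toCl (clLC y) y j = 𝟙 _ := by
  rw [toCl_eq (V := clLC y) (mem_closure_pt.2 (.refl y)) (Set.inter_self _).symm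
    (isRelClosed_refl _) (isRelOpen_refl _), r_self, i_self, Category.comp_id]

theorem fromNb_self (x : X) (j : ZMod 2) : fromNb x (nbLC x) j = 𝟙 _ := by
  rw [fromNb_eq (V := nbLC x) (mem_nhdsKer_pt.2 (.refl x)) (Set.inter_self _).symm
    (isRelClosed_refl _) (isRelOpen_refl _), r_self, i_self, Category.comp_id]

/-- For `y` in `C` but not in `C'`, the intersection of `C'` with the closure of `y` is empty
because `C'` is relatively open in `C`. So the value zero assigned to `toCl` outside the set is the
correct one. -/
theorem i_toCl {C C' : LC X} (h : IsRelOpen C'.1 C.1) (y : X) (j : ZMod 2) :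
    i h j ≫ toCl C y j = toCl C' y j := by
  have h' := isRelOpen_iff.1 h
  by_cases hy : y ∈ C.1
  · have hV : (capCl C' y).1 = C'.1 ∩ (capCl C y).1 := by
      change C'.1 ∩ _ = C'.1 ∩ (C.1 ∩ _)
      rw [← Set.inter_assoc, Set.inter_eq_left.2 h'.1]
    have hs := h.side (capCl_isRelClosed C y) hV
    have h1 : IsRelOpen (capCl C' y).1 (clLC y).1 := hs.2.trans (capCl_isRelOpen hy)
    have e : i h j ≫ toCl C y j = r (capCl_isRelClosed C' y) j ≫ i h1 j := by
      rw [toCl_eq hy rfl (capCl_isRelClosed C y) (capCl_isRelOpen hy), ← Category.assoc,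
        i_r h (capCl_isRelClosed C y) hV hs.1 hs.2, Category.assoc,
        i_i hs.2 (capCl_isRelOpen hy) h1]
    rw [e]
    by_cases hy' : y ∈ C'.1
    · rw [toCl_eq (V := capCl C' y) hy' rfl (capCl_isRelClosed C' y) h1]
    · rw [toCl_of_notMem hy', hom_eq_zero_of_left (Y := capCl C' y) ?_ (i _ j), Limits.comp_zero]
      refine Set.eq_empty_of_forall_notMem fun a ha => hy' ?_
      exact h'.2 a y (mem_closure_pt.1 ha.2) ha.1 hy
  · rw [toCl_of_notMem hy, toCl_of_notMem fun hy' => hy (h'.1 hy'), Limits.comp_zero]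

theorem fromNb_r {U U' : LC X} (h : IsRelClosed U'.1 U.1) (x : X) (j : ZMod 2) :
    fromNb x U j ≫ r h j = fromNb x U' j := by
  have h' := isRelClosed_iff.1 h
  by_cases hx : x ∈ U.1
  · have hV : (capNb U' x).1 = (capNb U x).1 ∩ U'.1 := by
      change U'.1 ∩ _ = (U.1 ∩ _) ∩ U'.1
      rw [Set.inter_right_comm, Set.inter_eq_right.2 h'.1]
    have hs := (capNb_isRelOpen U x).side h hV
    have h1 : IsRelClosed (capNb U' x).1 (nbLC x).1 := hs.1.trans (capNb_isRelClosed hx)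
    have e : fromNb x U j ≫ r h j = r h1 j ≫ i (capNb_isRelOpen U' x) j := by
      rw [fromNb_eq hx rfl (capNb_isRelClosed hx) (capNb_isRelOpen U x), Category.assoc,
        i_r (capNb_isRelOpen U x) h hV hs.1 hs.2, ← Category.assoc,
        r_r (capNb_isRelClosed hx) hs.1 h1]
    rw [e]
    by_cases hx' : x ∈ U'.1
    · rw [fromNb_eq (V := capNb U' x) hx' rfl h1 (capNb_isRelOpen U' x)]
    · rw [fromNb_of_notMem hx', hom_eq_zero_of_right (Y := capNb U' x) ?_ (r _ j),
        Limits.zero_comp]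
      refine Set.eq_empty_of_forall_notMem fun a ha => hx' ?_
      exact h'.2 x a (mem_nhdsKer_pt.1 ha.2) ha.1 hx
  · rw [fromNb_of_notMem hx, fromNb_of_notMem fun hx' => hx (h'.1 hx'), Limits.zero_comp]

theorem r_toCl {C C' : LC X} (h : IsRelClosed C'.1 C.1) {y : X} (hy : y ∈ C'.1) (j : ZMod 2) :
    r h j ≫ toCl C' y j = toCl C y j := by
  have h' := isRelClosed_iff.1 h
  have hV : (capCl C' y).1 = C.1 ∩ closure {y} := by
    refine subset_antisymm (Set.inter_subset_inter_left _ h'.1) fun a ha => ⟨?_, ha.2⟩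
    exact h'.2 a y (mem_closure_pt.1 ha.2) hy ha.1
  have h1 : IsRelClosed (capCl C' y).1 C.1 := (capCl_isRelClosed C' y).trans h
  rw [toCl_eq hy rfl (capCl_isRelClosed C' y) (capCl_isRelOpen hy), ← Category.assoc,
    r_r h (capCl_isRelClosed C' y) h1, toCl_eq (h'.1 hy) hV]

theorem fromNb_i {U U' : LC X} (h : IsRelOpen U'.1 U.1) {x : X} (hx : x ∈ U'.1) (j : ZMod 2) :
    fromNb x U' j ≫ i h j = fromNb x U j := by
  have h' := isRelOpen_iff.1 h
  have hV : (capNb U' x).1 = U.1 ∩ nhdsKer {x} := by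
    refine subset_antisymm (Set.inter_subset_inter_left _ h'.1) fun a ha => ⟨?_, ha.2⟩
    exact h'.2 x a (mem_nhdsKer_pt.1 ha.2) hx ha.1
  have h1 : IsRelOpen (capNb U' x).1 U.1 := (capNb_isRelOpen U' x).trans h
  rw [fromNb_eq hx rfl (capNb_isRelClosed hx) (capNb_isRelOpen U' x), Category.assoc,
    i_i (capNb_isRelOpen U' x) h h1, fromNb_eq (h'.1 hx) hV]

variable [T0Space X] (hX : UniquePath X)

/-- The sum over all arrows of the boundary morphisms from `C` to `U` that factor through the
category `ℬ`. -/
noncomputable def baseδ (U C : LC X) {j k : ZMod 2} (hjk : k = j + 1) : obj C j ⟶ obj U k :=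
  ∑ p : {p : X × X // Arrow p.1 p.2}, toCl C p.1.2 j ≫
    δ (U := nbLC p.1.1) (C := clLC p.1.2) (hX.boundaryPair p.2) hjk ≫ fromNb p.1.1 U k

variable {U C : LC X} {j k : ZMod 2} (hjk : k = j + 1)

theorem i_baseδ {C' : LC X} (h : IsRelOpen C'.1 C.1) :
    i h j ≫ baseδ hX U C hjk = baseδ hX U C' hjk := by
  simp only [baseδ, Preadditive.comp_sum]
  simp only [← Category.assoc, i_toCl]

theorem baseδ_r {U' : LC X} (h : IsRelClosed U'.1 U.1) :
    baseδ hX U C hjk ≫ r h k = baseδ hX U' C hjk := by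
  simp only [baseδ, Preadditive.sum_comp, Category.assoc, fromNb_r]

/-- The analogue of `r_δ`: an arrow from `U` to `C` ends in `C'` by hypothesis, so the omitted
points contribute nothing. -/
theorem r_baseδ {C' : LC X} (h : IsRelClosed C'.1 C.1)
    (hUC : ∀ a ∈ U.1, ∀ b ∈ C.1, PtLE b a → b ∈ C'.1) :
    r h j ≫ baseδ hX U C' hjk = baseδ hX U C hjk := by
  simp only [baseδ, Preadditive.comp_sum]
  refine Finset.sum_congr rfl fun p _ => ?_
  by_cases hU : p.1.1 ∈ U.1
  · by_cases hC : p.1.2 ∈ C'.1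
    · rw [← Category.assoc, r_toCl h hC]
    · rw [toCl_of_notMem hC, toCl_of_notMem fun hC' => hC (hUC _ hU _ hC' p.2.1.1)]
      simp
  · rw [fromNb_of_notMem hU]
    simp

theorem baseδ_i {U' : LC X} (h : IsRelOpen U'.1 U.1)
    (hUC : ∀ a ∈ U.1, ∀ b ∈ C.1, PtLE b a → a ∈ U'.1) :
    baseδ hX U' C hjk ≫ i h k = baseδ hX U C hjk := by
  simp only [baseδ, Preadditive.sum_comp, Category.assoc]
  refine Finset.sum_congr rfl fun p _ => ?_
  by_cases hC : p.1.2 ∈ C.1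
  · by_cases hU : p.1.1 ∈ U'.1
    · rw [fromNb_i h hU]
    · rw [fromNb_of_notMem hU, fromNb_of_notMem fun hU' => hU (hUC _ hU' _ hC p.2.1.1)]
      simp
  · rw [toCl_of_notMem hC]
    simp

theorem baseδ_arrow {x y : X} (h : Arrow x y) :
    baseδ hX (nbLC x) (clLC y) hjk =
      δ (U := nbLC x) (C := clLC y) (hX.boundaryPair h) hjk := by
  unfold baseδ
  rw [Finset.sum_eq_single ⟨(x, y), h⟩]
  · rw [toCl_self, fromNb_self, Category.id_comp, Category.comp_id]
  · rintro ⟨⟨a, b⟩, hab⟩ _ hne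
    dsimp only at hab ⊢
    by_cases ha : PtLE x a
    · by_cases hb : PtLE b y
      · obtain ⟨rfl, rfl⟩ := h.eq_and_eq hab ha hb
        exact absurd rfl hne
      · rw [toCl_of_notMem fun h => hb (mem_closure_pt.1 h), Limits.zero_comp]
    · rw [fromNb_of_notMem fun h => ha (mem_nhdsKer_pt.1 h), Limits.comp_zero, Limits.comp_zero]
  · simp

theorem δ_eq_baseδ_of_union_left {U' U'' : LC X} (hd : TopDisjoint U'.1 U''.1)
    (hU : U.1 = U'.1 ∪ U''.1) (h : IsBoundaryPair U.1 C.1)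
    (h' : ∀ h' : IsBoundaryPair U'.1 C.1, δ h' hjk = baseδ hX U' C hjk)
    (h'' : ∀ h'' : IsBoundaryPair U''.1 C.1, δ h'' hjk = baseδ hX U'' C hjk) :
    δ h hjk = baseδ hX U C hjk := by
  obtain ⟨s1, s2, s3, s4⟩ := hd.side hU
  have e := biproduct hd hU s1 s2 s3 s4 k
  rw [← Category.comp_id (δ h hjk), ← Category.comp_id (baseδ hX U C hjk), ← e,
    Preadditive.comp_add, Preadditive.comp_add, ← Category.assoc, ← Category.assoc,
    ← Category.assoc, ← Category.assoc, baseδ_r, baseδ_r, δ_r h s1 (h.side_right s1),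
    δ_r h s3 (h.side_right s3), h', h'']

theorem δ_eq_baseδ_of_union_right {C' C'' : LC X} (hd : TopDisjoint C'.1 C''.1)
    (hC : C.1 = C'.1 ∪ C''.1) (h : IsBoundaryPair U.1 C.1)
    (h' : ∀ h' : IsBoundaryPair U.1 C'.1, δ h' hjk = baseδ hX U C' hjk)
    (h'' : ∀ h'' : IsBoundaryPair U.1 C''.1, δ h'' hjk = baseδ hX U C'' hjk) :
    δ h hjk = baseδ hX U C hjk := by
  obtain ⟨s1, s2, s3, s4⟩ := hd.side hC
  have e := biproduct hd hC s1 s2 s3 s4 j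
  rw [← Category.id_comp (δ h hjk), ← Category.id_comp (baseδ hX U C hjk), ← e,
    Preadditive.add_comp, Preadditive.add_comp, Category.assoc, Category.assoc,
    Category.assoc, Category.assoc, i_baseδ, i_baseδ, i_δ h s2 (h.side_left s2),
    i_δ h s4 (h.side_left s4), h', h'']

/-- Induction on the total size of `U` and `C`. Both sides are compatible with discarding points of
`U` not above `C` and points of `C` not below `U`, and with splitting `U` or `C` into topologically
disjoint parts. If no such reduction applies and neither set is empty, the pair is elementary, so it
comes from an arrow and only that arrow contributes to the sum. -/
theorem δ_eq_baseδ_of_isOpen_of_isClosed (hE : IsEBP X) (hU : IsOpen U.1) (hC : IsClosed C.1)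
    (h : IsBoundaryPair U.1 C.1) : δ h hjk = baseδ hE.uniquePath U C hjk := by
  generalize hn : U.1.ncard + C.1.ncard = n
  induction n using Nat.strong_induction_on generalizing U C with
  | _ n ih =>
  subst hn
  have hlt : ∀ {S T : Set X}, S ⊆ T → S ≠ T → S.ncard < T.ncard := fun h h' =>
    Set.ncard_lt_ncard (h.ssubset_of_ne h') (Set.toFinite _)
  rcases U.1.eq_empty_or_nonempty with hU0 | hU0
  · rw [hom_eq_zero_of_right hU0 (δ h hjk), hom_eq_zero_of_right hU0 (baseδ _ U C hjk)]
  rcases C.1.eq_empty_or_nonempty with hC0 | hC0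
  · rw [hom_eq_zero_of_left hC0 (δ h hjk), hom_eq_zero_of_left hC0 (baseδ _ U C hjk)]
  -- Otherwise `U` can be replaced by its points above `C`.
  by_cases h1 : U.1 ⊆ nhdsKer C.1
  swap
  · have hO : IsOpen (U.1 ∩ nhdsKer C.1) := hU.inter isOpen_nhdsKer
    let U' : LC X := ⟨_, hO.isLocallyClosed⟩
    have hU' : IsRelOpen U'.1 U.1 := ⟨nhdsKer C.1, isOpen_nhdsKer, Set.inter_comm _ _⟩
    have hUC : ∀ a ∈ U.1, ∀ b ∈ C.1, PtLE b a → a ∈ U'.1 := fun a ha b hb hab =>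
      ⟨ha, mem_nhdsKer_iff_ptLE.2 ⟨b, hb, hab⟩⟩
    have h' : IsBoundaryPair U'.1 C.1 := by
      rw [isBoundaryPair_iff] at h ⊢
      refine ⟨?_, h.2.1.mono_left Set.inter_subset_left, fun x y hxy hx => h.2.2 x y hxy hx.1⟩
      have hl := isLocallyClosed_iff_ptLE.1 h.1
      rw [isLocallyClosed_iff_ptLE]
      intro a b c hab hbc ha hc
      have hb := hl a b c hab hbc (ha.imp_left And.left) (hc.imp_left And.left)
      refine hb.imp_left fun hb => ?_
      rcases ha with ha | ha
      · exact isOpen_iff_ptLE.1 hO a b hab ha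
      · exact hUC b hb a ha hab
    rw [← δ_i h hU' h' hUC, ← baseδ_i _ _ hU' hUC, ih _ ?_ hO hC h' rfl]
    have := hlt (S := U'.1) Set.inter_subset_left fun e => h1 (Set.inter_eq_left.1 e)
    lia
  by_cases h2 : C.1 ⊆ closure U.1
  swap
  · have hO : IsClosed (C.1 ∩ closure U.1) := hC.inter isClosed_closure
    let C' : LC X := ⟨_, hO.isLocallyClosed⟩
    have hC' : IsRelClosed C'.1 C.1 := ⟨closure U.1, isClosed_closure, Set.inter_comm _ _⟩
    have hUC : ∀ a ∈ U.1, ∀ b ∈ C.1, PtLE b a → b ∈ C'.1 := fun a ha b hb hab =>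
      ⟨hb, mem_closure_iff_ptLE.2 ⟨a, ha, hab⟩⟩
    have h' : IsBoundaryPair U.1 C'.1 := by
      rw [isBoundaryPair_iff] at h ⊢
      refine ⟨?_, h.2.1.mono_right Set.inter_subset_left, fun x y hxy hx hy => h.2.2 x y hxy hx hy.1⟩
      have hl := isLocallyClosed_iff_ptLE.1 h.1
      rw [isLocallyClosed_iff_ptLE]
      intro a b c hab hbc ha hc
      have hb := hl a b c hab hbc (ha.imp_right And.left) (hc.imp_right And.left)
      refine hb.imp_right fun hb => ?_
      rcases hc with hc | hc
      · exact hUC c hc b hb hbc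
      · exact isClosed_iff_ptLE.1 hO b c hbc hc
    rw [← r_δ h hC' h' hUC, ← r_baseδ _ _ hC' hUC, ih _ ?_ hU hO h' rfl]
    have := hlt (S := C'.1) Set.inter_subset_left fun e => h2 (Set.inter_eq_left.1 e)
    lia
  -- Otherwise a separation of the open set `U` consists of two smaller open sets, which are
  -- topologically disjoint.
  by_cases h3 : IsPreconnected U.1
  swap
  · rw [isPreconnected_iff_subset_of_disjoint] at h3
    push Not at h3
    obtain ⟨u, v, hu, hv, huv, hd, hnu, hnv⟩ := h3
    let U' : LC X := ⟨U.1 ∩ u, (hU.inter hu).isLocallyClosed⟩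
    let U'' : LC X := ⟨U.1 ∩ v, (hU.inter hv).isLocallyClosed⟩
    have hne : ∀ a ∈ U'.1, a ∉ U''.1 := fun a ha ha' =>
      Set.eq_empty_iff_forall_notMem.1 hd a ⟨ha.1, ha.2, ha'.2⟩
    refine δ_eq_baseδ_of_union_left _ _ (U' := U') (U'' := U'') ?_ ?_ h
      (fun h' => ih _ ?_ (hU.inter hu) hC h' rfl) (fun h' => ih _ ?_ (hU.inter hv) hC h' rfl)
    · rw [topDisjoint_iff]
      exact fun a ha b hb => ⟨fun hab => hne b (isOpen_iff_ptLE.1 (hU.inter hu) a b hab ha) hb,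
        fun hba => hne a ha (isOpen_iff_ptLE.1 (hU.inter hv) b a hba hb)⟩
    · change U.1 = (U.1 ∩ u) ∪ (U.1 ∩ v)
      rw [← Set.inter_union_distrib_left, Set.inter_eq_left.2 huv]
    · have := hlt (S := U'.1) Set.inter_subset_left fun e => hnu (Set.inter_eq_left.1 e)
      lia
    · have := hlt (S := U''.1) Set.inter_subset_left fun e => hnv (Set.inter_eq_left.1 e)
      lia
  by_cases h4 : IsPreconnected C.1
  swap
  · rw [isPreconnected_iff_subset_of_disjoint_closed] at h4
    push Not at h4
    obtain ⟨u, v, hu, hv, huv, hd, hnu, hnv⟩ := h4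
    let C' : LC X := ⟨C.1 ∩ u, (hC.inter hu).isLocallyClosed⟩
    let C'' : LC X := ⟨C.1 ∩ v, (hC.inter hv).isLocallyClosed⟩
    have hne : ∀ a ∈ C'.1, a ∉ C''.1 := fun a ha ha' =>
      Set.eq_empty_iff_forall_notMem.1 hd a ⟨ha.1, ha.2, ha'.2⟩
    refine δ_eq_baseδ_of_union_right _ _ (C' := C') (C'' := C'') ?_ ?_ h
      (fun h' => ih _ ?_ hU (hC.inter hu) h' rfl) (fun h' => ih _ ?_ hU (hC.inter hv) h' rfl)
    · rw [topDisjoint_iff]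
      exact fun a ha b hb => ⟨fun hab => hne a ha (isClosed_iff_ptLE.1 (hC.inter hv) a b hab hb),
        fun hba => hne b (isClosed_iff_ptLE.1 (hC.inter hu) b a hba ha) hb⟩
    · change C.1 = (C.1 ∩ u) ∪ (C.1 ∩ v)
      rw [← Set.inter_union_distrib_left, Set.inter_eq_left.2 huv]
    · have := hlt (S := C'.1) Set.inter_subset_left fun e => hnu (Set.inter_eq_left.1 e)
      lia
    · have := hlt (S := C''.1) Set.inter_subset_left fun e => hnv (Set.inter_eq_left.1 e)
      lia
  obtain ⟨x, y, hxy, hUx, hCy⟩ := hE.elementary U.1 C.1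
    ⟨h, ⟨hU0, h3⟩, ⟨hC0, h4⟩, hU, hC, h1, h2⟩
  obtain rfl : U = nbLC x := Subtype.ext hUx
  obtain rfl : C = clLC y := Subtype.ext hCy
  exact (baseδ_arrow _ hjk hxy).symm

/-- In an EBP space, every boundary morphism is a sum of boundary morphisms that factor through the
category `ℬ`. -/
theorem δ_eq_baseδ (hE : IsEBP X) (h : IsBoundaryPair U.1 C.1) :
    δ h hjk = baseδ hE.uniquePath U C hjk := by
  have hb := isBoundaryPair_iff.1 h
  have hl := isLocallyClosed_iff_ptLE.1 hb.1
  have hlC := isLocallyClosed_iff_ptLE.1 C.2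
  -- The pair is enlarged to `U'` open and `C'` closed, with `U` relatively closed in `U'` and `C`
  -- relatively open in `C'`. Relations 6 and 7 recover the given boundary map from the enlarged
  -- one, and `baseδ` behaves in the same way.
  have hO : IsOpen (nhdsKer (U.1 ∪ C.1) \ closure C.1) := isOpen_nhdsKer.sdiff isClosed_closure
  let U' : LC X := ⟨_, hO.isLocallyClosed⟩
  have hO' : IsClosed (closure (U'.1 ∪ C.1) \ U'.1) := isClosed_closure.sdiff hO
  let C' : LC X := ⟨_, hO'.isLocallyClosed⟩
  have hUC' : IsBoundaryPair U'.1 C'.1 := by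
    refine ⟨closure (U'.1 ∪ C.1), isClosed_closure.isLocallyClosed, ⟨U'.1, hO, ?_⟩, rfl⟩
    exact (Set.inter_eq_left.2 (Set.subset_union_left.trans subset_closure)).symm
  have mU : ∀ a, a ∈ U'.1 ↔ (∃ b ∈ U.1 ∪ C.1, PtLE b a) ∧ ¬ ∃ b ∈ C.1, PtLE a b := fun a => by
    rw [← mem_nhdsKer_iff_ptLE, ← mem_closure_iff_ptLE]; rfl
  have mC : ∀ a, a ∈ C'.1 ↔ (∃ b ∈ U'.1 ∪ C.1, PtLE a b) ∧ a ∉ U'.1 := fun a => by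
    rw [← mem_closure_iff_ptLE]; rfl
  have hU : IsRelClosed U.1 U'.1 := by
    refine isRelClosed_iff.2 ⟨fun a ha => (mU a).2 ⟨⟨a, .inl ha, .refl a⟩, ?_⟩, ?_⟩
    · rintro ⟨b, hb', hab⟩
      exact hb.2.2 a b hab ha hb'
    · intro a b hab hbU ha
      obtain ⟨⟨c, hc, hca⟩, hn⟩ := (mU a).1 ha
      exact (hl c a b hca hab hc (.inl hbU)).resolve_right fun h => hn ⟨a, h, .refl a⟩
  have hC : IsRelOpen C.1 C'.1 := by
    refine isRelOpen_iff.2 ⟨fun a ha => (mC a).2 ⟨⟨a, .inr ha, .refl a⟩, ?_⟩, ?_⟩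
    · exact fun h => ((mU a).1 h).2 ⟨a, ha, .refl a⟩
    · intro a b hab haC hb'
      obtain ⟨⟨c, hc, hbc⟩, hn⟩ := (mC b).1 hb'
      rcases hc with hc | hc
      · by_contra hbC
        refine hn ((mU b).2 ⟨⟨a, .inr haC, hab⟩, ?_⟩)
        rintro ⟨d, hd, hbd⟩
        exact hbC (hlC a b d hab hbd haC hd)
      · exact hlC a b c hab hbc haC hc
  have h' : IsBoundaryPair U'.1 C.1 := hUC'.side_left hC
  rw [← δ_r h' hU h, ← i_δ hUC' hC h', δ_eq_baseδ_of_isOpen_of_isClosed hjk hE hO hO' hUC',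
    i_baseδ, baseδ_r]

end ST

end BoundaryDecomposition

/-! ### Points comparable to a given point, and the biproducts above and below it -/

section Star

variable {X : Type u} [TopologicalSpace X] [Finite X]

namespace ST

theorem i_r_self {U Y : LC X} (hU : IsRelOpen U.1 Y.1) (hC : IsRelClosed U.1 Y.1) (j : ZMod 2) :
    i hU j ≫ r hC j = 𝟙 _ := by
  rw [i_r hU hC (V := U) (Set.inter_self _).symm (isRelClosed_refl _) (isRelOpen_refl _), r_self,
    i_self, Category.comp_id]

theorem i_r_disjoint {U C Y : LC X} (hU : IsRelOpen U.1 Y.1) (hC : IsRelClosed C.1 Y.1)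
    (h : U.1 ∩ C.1 = ∅) (j : ZMod 2) : i hU j ≫ r hC j = 0 := by
  have hs := hU.side hC (V := emptyLC) h.symm
  rw [i_r hU hC h.symm hs.1 hs.2, hom_eq_zero_of_right (Y := emptyLC) rfl (r hs.1 j),
    Limits.zero_comp]

/-- If the arrow leaves `C`, then `C` does not meet the closure of `y`: a common point would lie
below `y`, and `C` would contain `y`, which is between it and `x`. This matches the condition on
sections at arrows leaving the set. -/
theorem toCl_r {C : LC X} {x y : X} (h : Arrow x y) (hx : x ∈ C.1) (j : ZMod 2) :
    toCl C x j ≫ r (clLC_rel h) j = toCl C y j := by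
  have hle : closure {y} ⊆ closure {x} := h.1.1
  have hV : (capCl C y).1 = (capCl C x).1 ∩ (clLC y).1 := by
    change C.1 ∩ _ = (C.1 ∩ _) ∩ closure {y}
    rw [Set.inter_assoc, Set.inter_eq_right.2 hle]
  have hs := (capCl_isRelOpen hx).side (clLC_rel h) hV
  have e : toCl C x j ≫ r (clLC_rel h) j = r (capCl_isRelClosed C y) j ≫ i hs.2 j := by
    rw [toCl_eq hx rfl (capCl_isRelClosed C x) (capCl_isRelOpen hx), Category.assoc,
      i_r (capCl_isRelOpen hx) (clLC_rel h) hV hs.1 hs.2, ← Category.assoc,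
      r_r (capCl_isRelClosed C x) hs.1 (capCl_isRelClosed C y)]
  rw [e]
  by_cases hy : y ∈ C.1
  · rw [toCl_eq (V := capCl C y) hy rfl (capCl_isRelClosed C y) hs.2]
  · rw [toCl_of_notMem hy, hom_eq_zero_of_left (Y := capCl C y) ?_ (i _ j), Limits.comp_zero]
    refine Set.eq_empty_of_forall_notMem fun a ha => hy ?_
    exact isLocallyClosed_iff_ptLE.1 C.2 a y x (mem_closure_pt.1 ha.2) h.1.1 ha.1 hx

theorem i_fromNb {U : LC X} {x y : X} (h : Arrow x y) (hy : y ∈ U.1) (j : ZMod 2) :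
    i (nbLC_rel h) j ≫ fromNb y U j = fromNb x U j := by
  have hle : nhdsKer {x} ⊆ nhdsKer {y} := fun a ha =>
    mem_nhdsKer_pt.2 (h.1.1.trans (mem_nhdsKer_pt.1 ha))
  have hV : (capNb U x).1 = (nbLC x).1 ∩ (capNb U y).1 := by
    change U.1 ∩ _ = nhdsKer {x} ∩ (U.1 ∩ nhdsKer {y})
    rw [Set.inter_left_comm, Set.inter_eq_left.2 hle]
  have hs := (nbLC_rel h).side (capNb_isRelClosed hy) hV
  have e : i (nbLC_rel h) j ≫ fromNb y U j = r hs.1 j ≫ i (capNb_isRelOpen U x) j := by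
    rw [fromNb_eq hy rfl (capNb_isRelClosed hy) (capNb_isRelOpen U y), ← Category.assoc,
      i_r (nbLC_rel h) (capNb_isRelClosed hy) hV hs.1 hs.2, Category.assoc,
      i_i hs.2 (capNb_isRelOpen U y) (capNb_isRelOpen U x)]
  rw [e]
  by_cases hx : x ∈ U.1
  · rw [fromNb_eq (V := capNb U x) hx rfl hs.1 (capNb_isRelOpen U x)]
  · rw [fromNb_of_notMem hx, hom_eq_zero_of_right (Y := capNb U x) ?_ (r _ j), Limits.zero_comp]
    refine Set.eq_empty_of_forall_notMem fun a ha => hx ?_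
    exact isLocallyClosed_iff_ptLE.1 U.2 y x a h.1.1 (mem_nhdsKer_pt.1 ha.2) hy ha.1

end ST

variable [T0Space X]

theorem clDiff_isRelClosed (x : X) : IsRelClosed (closure {x} \ {x}) (clLC x).1 := by
  refine isRelClosed_iff.2 ⟨Set.sdiff_subset, fun a b hab hb ha => ⟨ha, ?_⟩⟩
  rintro rfl
  exact hb.2 ((mem_closure_pt.1 hb.1).antisymm hab)

theorem nbDiff_isRelOpen (x : X) : IsRelOpen (nhdsKer {x} \ {x}) (nbLC x).1 := by
  refine isRelOpen_iff.2 ⟨Set.sdiff_subset, fun a b hab ha hb => ⟨hb, ?_⟩⟩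
  rintro rfl
  exact ha.2 (hab.antisymm (mem_nhdsKer_pt.1 ha.1))

/-- The points strictly below `x`. -/
def clDiff (x : X) : LC X := ⟨closure {x} \ {x}, (clDiff_isRelClosed x).isLocallyClosed (clLC x).2⟩

/-- The points strictly above `x`. -/
def nbDiff (x : X) : LC X := ⟨nhdsKer {x} \ {x}, (nbDiff_isRelOpen x).isLocallyClosed (nbLC x).2⟩

theorem decomp_cl (x : X) : Decomp (ptLC x) (clLC x) (clDiff x) := by
  refine ⟨isRelOpen_iff.2 ⟨?_, ?_⟩, rfl⟩
  · rintro _ rfl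
    exact mem_closure_pt.2 (.refl _)
  · rintro a b hab rfl hb
    exact (mem_closure_pt.1 hb).antisymm hab

theorem decomp_nb (x : X) : Decomp (nbDiff x) (nbLC x) (ptLC x) := by
  refine ⟨nbDiff_isRelOpen x, ?_⟩
  have h : {x} ⊆ nhdsKer {x} := subset_nhdsKer
  exact (Set.sdiff_sdiff_cancel_left h).symm

/-- The set of points comparable to `x`. -/
def starLC (hX : UniquePath X) (x : X) : LC X := ⟨nhdsKer {x} ∪ closure {x}, hX.lc_star x⟩

theorem decomp_star_nb (hX : UniquePath X) (x : X) :
    Decomp (nbLC x) (starLC hX x) (clDiff x) := by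
  refine ⟨⟨nhdsKer {x}, isOpen_nhdsKer, (Set.inter_eq_left.2 Set.subset_union_left).symm⟩, ?_⟩
  ext a
  simp only [clDiff, starLC, nbLC, Set.mem_sdiff, Set.mem_union, mem_closure_pt, mem_nhdsKer_pt,
    Set.mem_singleton_iff]
  constructor
  · exact fun h => ⟨.inr h.1, fun h' => h.2 (h.1.antisymm h')⟩
  · rintro ⟨h | h, h'⟩
    · exact absurd h h'
    · exact ⟨h, fun e => h' (e ▸ .refl _)⟩

theorem decomp_star_cl (hX : UniquePath X) (x : X) :
    Decomp (nbDiff x) (starLC hX x) (clLC x) := by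
  have h : ∀ a, a ∈ (nbDiff x).1 ↔ a ∈ (starLC hX x).1 ∧ a ∉ (clLC x).1 := fun a => by
    simp only [nbDiff, starLC, clLC, Set.mem_sdiff, Set.mem_union, mem_closure_pt, mem_nhdsKer_pt,
      Set.mem_singleton_iff]
    constructor
    · exact fun h => ⟨.inl h.1, fun h' => h.2 (h'.antisymm h.1)⟩
    · rintro ⟨h | h, h'⟩
      · exact ⟨h, fun e => h' (e ▸ .refl _)⟩
      · exact absurd h h'
  refine ⟨isRelOpen_iff.2 ⟨fun a ha => ((h a).1 ha).1, fun a b hab ha hb => ?_⟩, ?_⟩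
  · exact (h b).2 ⟨hb, fun hb' => ((h a).1 ha).2
      (mem_closure_pt.2 (hab.trans (mem_closure_pt.1 hb')))⟩
  · ext a
    rw [Set.mem_sdiff, h]
    have : a ∈ (clLC x).1 → a ∈ (starLC hX x).1 := fun h => .inr h
    tauto

theorem clLC_isRelClosed_clDiff {x y : X} (h : Arrow x y) :
    IsRelClosed (clLC y).1 (clDiff x).1 := by
  have hs : (clLC y).1 ⊆ (clDiff x).1 := fun a ha => ⟨h.1.1 ha, ?_⟩
  · exact ⟨closure {y}, isClosed_closure, (Set.inter_eq_left.2 hs).symm⟩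
  rintro rfl
  exact h.not_ptLE (mem_closure_pt.1 ha)

theorem nbLC_isRelOpen_nbDiff {x z : X} (h : Arrow z x) : IsRelOpen (nbLC z).1 (nbDiff x).1 := by
  have hs : (nbLC z).1 ⊆ (nbDiff x).1 := fun a ha =>
    ⟨mem_nhdsKer_pt.2 (h.1.1.trans (mem_nhdsKer_pt.1 ha)), ?_⟩
  · exact ⟨nhdsKer {z}, isOpen_nhdsKer, (Set.inter_eq_left.2 hs).symm⟩
  · rintro rfl
    exact h.not_ptLE (mem_nhdsKer_pt.1 ha)

theorem clLC_isRelOpen_clDiff (hX : UniquePath X) {x y : X} (h : Arrow x y) :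
    IsRelOpen (clLC y).1 (clDiff x).1 := by
  refine isRelOpen_iff.2 ⟨(isRelClosed_iff.1 (clLC_isRelClosed_clDiff h)).1,
    fun a b hab ha hb => ?_⟩
  obtain ⟨y', hy', hb'⟩ := exists_arrow_right ⟨mem_closure_pt.1 hb.1, hb.2⟩
  obtain rfl := hX.eq_of_ptLE_of_ptLE h hy' (mem_closure_pt.1 ha) (hab.trans hb')
  exact mem_closure_pt.2 hb'

theorem nbLC_isRelClosed_nbDiff (hX : UniquePath X) {x z : X} (h : Arrow z x) :
    IsRelClosed (nbLC z).1 (nbDiff x).1 := by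
  refine isRelClosed_iff.2 ⟨(isRelOpen_iff.1 (nbLC_isRelOpen_nbDiff h)).1,
    fun a b hab hb ha => ?_⟩
  obtain ⟨z', hz', ha'⟩ := exists_arrow_left ⟨mem_nhdsKer_pt.1 ha.1, fun e => ha.2 e.symm⟩
  obtain rfl := hX.eq_of_ptLE_of_ptLE' h hz' (mem_nhdsKer_pt.1 hb) (ha'.trans hab)
  exact mem_nhdsKer_pt.2 ha'

theorem ST.sum_r_i_clDiff (hX : UniquePath X) (x : X) (j : ZMod 2) :
    ∑ y : {y : X // Arrow x y}, ST.r (clLC_isRelClosed_clDiff y.2) j ≫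
      ST.i (clLC_isRelOpen_clDiff hX y.2) j = 𝟙 (ST.obj (clDiff x) j) :=
  ST.sum_r_i (fun y : {y : X // Arrow x y} => clLC y.1) (clDiff x)
    (fun y y' h => hX.topDisjoint_cl y.2 y'.2 fun e => h (Subtype.ext e))
    (diff_singleton_eq_iUnion_cl x) _ _ j

theorem ST.sum_r_i_nbDiff (hX : UniquePath X) (x : X) (j : ZMod 2) :
    ∑ z : {z : X // Arrow z x}, ST.r (nbLC_isRelClosed_nbDiff hX z.2) j ≫
      ST.i (nbLC_isRelOpen_nbDiff z.2) j = 𝟙 (ST.obj (nbDiff x) j) :=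
  ST.sum_r_i (fun z : {z : X // Arrow z x} => nbLC z.1) (nbDiff x)
    (fun z z' h => hX.topDisjoint_nb z.2 z'.2 fun e => h (Subtype.ext e))
    (diff_singleton_eq_iUnion_nb x) _ _ j

end Star

/-! ### Restrictions of exact `𝒮𝒯`-modules are exact -/

section RestrictionExact

variable {X : Type u} [TopologicalSpace X] [Finite X] {M : STMod.{w} X}

/-- A Mayer–Vietoris argument. The boundary maps send the six-term sequence of `B ⊆ BC` to that of
`A ⊆ AB`, and the two share the terms at `B`. The hypothesis gives a lift of `p` to `BC`; its
boundary in `A` differs from `-n` by an element that dies in `AB`, hence by a boundary from `B`, and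
correcting the lift by that element of `B` leaves its restriction to `C` unchanged. -/
theorem exists_of_δ_add_i_eq_zero {A B C AB BC Y : LC X} (hAB : Decomp A AB B)
    (hBC : Decomp B BC C) (hY : Decomp A Y BC) (hY' : Decomp AB Y C)
    (h1 : LiftsAlong M hBC) (h2 : BoundsAlong M hAB) (p : M.obj.obj (ST.obj C 1))
    (n : M.obj.obj (ST.obj A 0))
    (hpn : M.obj.map (ST.δ hY'.isBoundaryPair zero_eq_one_add_one) p +
      M.obj.map (ST.i hAB.isRelOpen 0) n = 0) :
    ∃ m, M.obj.map (ST.r hBC.isRelClosed 1) m = p ∧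
      M.obj.map (ST.δ hY.isBoundaryPair zero_eq_one_add_one) m = - n := by
  obtain ⟨m, rfl⟩ := h1 p (by
    have := congrArg (M.obj.map (ST.r hAB.isRelClosed 0)) hpn
    rwa [map_add, map_map_apply, map_map_apply, ST.i_r_eq_zero hAB, map_zero_apply, add_zero,
      map_zero, ST.δ_r hY'.isBoundaryPair hAB.isRelClosed hBC.isBoundaryPair] at this)
  rw [map_map_apply, ← ST.δ_i_eq_r_δ hBC hAB hY hY', ← map_map_apply, ← map_add] at hpn
  obtain ⟨q, hq⟩ := h2 _ hpn
  refine ⟨m - M.obj.map (ST.i hBC.isRelOpen 1) q, ?_, ?_⟩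
  · rw [map_sub, map_map_apply M (ST.i _ _), ST.i_r_eq_zero hBC, map_zero_apply, sub_zero]
  · rw [map_sub, map_map_apply M (ST.i _ _),
      ST.i_δ hY.isBoundaryPair hBC.isRelOpen hAB.isBoundaryPair, hq]
    abel

theorem STExact.liftsAlong (hM : STExact M) {U Y C : LC X} (h : Decomp U Y C) :
    LiftsAlong M h := fun m hm =>
  ((hM U Y C h.isRelOpen h.isRelClosed h.isBoundaryPair h.eq_sdiff 1 0 (by decide)).2.1 m).1 hm

theorem STExact.boundsAlong (hM : STExact M) {U Y C : LC X} (h : Decomp U Y C) :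
    BoundsAlong M h := fun m hm =>
  ((hM U Y C h.isRelOpen h.isRelClosed h.isBoundaryPair h.eq_sdiff 1 0 (by decide)).2.2 m).1 hm

variable [T0Space X] (hX : UniquePath X)

theorem restrict_map_r {x y : X} (h : Arrow x y) (m : M.obj.obj (ST.obj (clLC x) 1)) :
    ((restrictToBase hX).obj M).obj.map (BCat.r h) m = M.obj.map (ST.r (clLC_rel h) 1) m :=
  congrArg (fun f => M.obj.map f m) (baseFunctor_map_r hX h)

theorem restrict_map_δ {x y : X} (h : Arrow x y) (m : M.obj.obj (ST.obj (clLC y) 1)) :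
    ((restrictToBase hX).obj M).obj.map (BCat.δ h) m =
      M.obj.map (ST.δ (U := nbLC x) (C := clLC y) (hX.boundaryPair h) zero_eq_one_add_one) m :=
  congrArg (fun f => M.obj.map f m) (baseFunctor_map_δ hX h)

theorem restrict_map_i {x y : X} (h : Arrow x y) (m : M.obj.obj (ST.obj (nbLC x) 0)) :
    ((restrictToBase hX).obj M).obj.map (BCat.i h) m = M.obj.map (ST.i (nbLC_rel h) 0) m :=
  congrArg (fun f => M.obj.map f m) (baseFunctor_map_i hX h)

theorem map_r_sum_cl {x : X} (p : ∀ y : {y : X // Arrow x y}, M.obj.obj (ST.obj (clLC y.1) 1))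
    (y : {y : X // Arrow x y}) :
    M.obj.map (ST.r (clLC_isRelClosed_clDiff y.2) 1)
      (∑ y, M.obj.map (ST.i (clLC_isRelOpen_clDiff hX y.2) 1) (p y)) = p y := by
  rw [map_sum, Finset.sum_eq_single y, map_map_apply, ST.i_r_self, map_id_apply]
  · intro y' _ hy
    rw [map_map_apply, ST.i_r_disjoint, map_zero_apply]
    refine Set.eq_empty_of_forall_notMem fun a ha => hy (Subtype.ext ?_)
    exact hX.eq_of_ptLE_of_ptLE y'.2 y.2 (mem_closure_pt.1 ha.1) (mem_closure_pt.1 ha.2)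
  · simp

theorem map_r_sum_nb {x : X} (p : ∀ z : {z : X // Arrow z x}, M.obj.obj (ST.obj (nbLC z.1) 0))
    (z : {z : X // Arrow z x}) :
    M.obj.map (ST.r (nbLC_isRelClosed_nbDiff hX z.2) 0)
      (∑ z, M.obj.map (ST.i (nbLC_isRelOpen_nbDiff z.2) 0) (p z)) = p z := by
  rw [map_sum, Finset.sum_eq_single z, map_map_apply, ST.i_r_self, map_id_apply]
  · intro z' _ hz
    rw [map_map_apply, ST.i_r_disjoint, map_zero_apply]
    refine Set.eq_empty_of_forall_notMem fun a ha => hz (Subtype.ext ?_)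
    exact hX.eq_of_ptLE_of_ptLE' z'.2 z.2 (mem_nhdsKer_pt.1 ha.1) (mem_nhdsKer_pt.1 ha.2)
  · simp

/-- The restriction of an exact `𝒮𝒯`-module is an exact `ℬ`-module. -/
theorem restrict_bExact {M : STMod.{u} X} (hM : STExact M) :
    BExact ((restrictToBase hX).obj M) := by
  intro x p
  constructor
  · intro hp
    obtain ⟨p, n⟩ := p
    change ∀ y : {y : X // Arrow x y}, M.obj.obj (ST.obj (clLC y.1) 1) at p
    change ∀ z : {z : X // Arrow z x}, M.obj.obj (ST.obj (nbLC z.1) 0) at n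
    have hp' : ∑ y : {y : X // Arrow x y}, M.obj.map
        (ST.δ (U := nbLC x) (C := clLC y.1) (hX.boundaryPair y.2) zero_eq_one_add_one) (p y) +
        ∑ z : {z : X // Arrow z x}, M.obj.map (ST.i (nbLC_rel z.2) 0) (n z) = 0 :=
      (congrArg₂ (· + ·)
        (Finset.sum_congr rfl fun y _ => (restrict_map_δ hX y.2 (p y)).symm)
        (Finset.sum_congr rfl fun z _ => (restrict_map_i hX z.2 (n z)).symm)).trans hp
    -- The strata are the points strictly above `x`, the point `x` and the points strictly below
    -- `x`. The first and last are topologically disjoint unions over the arrows at `x`, so the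
    -- families `n` and `p` assemble into single elements there.
    obtain ⟨m, hm, hm'⟩ := exists_of_δ_add_i_eq_zero (decomp_nb x) (decomp_cl x)
      (decomp_star_cl hX x) (decomp_star_nb hX x) (hM.liftsAlong _) (hM.boundsAlong _)
      (∑ y : {y : X // Arrow x y}, M.obj.map (ST.i (clLC_isRelOpen_clDiff hX y.2) 1) (p y))
      (∑ z : {z : X // Arrow z x}, M.obj.map (ST.i (nbLC_isRelOpen_nbDiff z.2) 0) (n z)) (by
        rw [← hp', map_sum, map_sum]
        refine congrArg₂ (· + ·) (Finset.sum_congr rfl fun y _ => ?_)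
          (Finset.sum_congr rfl fun z _ => ?_)
        · rw [map_map_apply, ST.i_δ _ _ (hX.boundaryPair y.2)]
        · rw [map_map_apply, ST.i_i _ _ (nbLC_rel z.2)])
    refine ⟨m, Prod.ext (funext fun y => ?_) (funext fun z => ?_)⟩
    · refine (restrict_map_r hX y.2 m).trans ?_
      rw [← ST.r_r (decomp_cl x).isRelClosed (clLC_isRelClosed_clDiff y.2), ← map_map_apply, hm]
      exact map_r_sum_cl hX p y
    · refine (congrArg Neg.neg (restrict_map_δ hX z.2 m)).trans ?_
      refine (congrArg (fun f => - M.obj.map f m) (ST.δ_r (decomp_star_cl hX x).isBoundaryPair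
        (nbLC_isRelClosed_nbDiff hX z.2) (hX.boundaryPair z.2) zero_eq_one_add_one).symm).trans ?_
      dsimp only
      rw [← map_map_apply, hm', map_neg, neg_neg]
      exact map_r_sum_nb hX n z
  · rintro ⟨m, rfl⟩
    change ∑ y : {y : X // Arrow x y}, BMod.δHom _ y.2 (BMod.rHom _ y.2 m) +
      ∑ z : {z : X // Arrow z x}, BMod.iHom _ z.2 (- BMod.δHom _ z.2 m) = 0
    rw [BMod.sum_r_δ]
    simp only [map_neg, Finset.sum_neg_distrib, add_neg_cancel]

end RestrictionExact

/-! ### Comparison of an `𝒮𝒯`-module with the extension of its restriction -/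

section Comparison

variable {X : Type u} [TopologicalSpace X] [Finite X] [T0Space X] (hX : UniquePath X)
  (M : STMod.{u} X)

/-- The comparison map from the degree-one values of an `𝒮𝒯`-module to compatible families of its
restriction. -/
noncomputable def toSections (Y : LC X) :
    M.obj.obj (ST.obj Y 1) →+ ((restrictToBase hX).obj M).sections Y.1 where
  toFun m := ⟨fun x => M.obj.map (ST.toCl Y x 1) m, fun x hx => by
      change M.obj.map (ST.toCl Y x 1) m = 0
      rw [ST.toCl_of_notMem hx, map_zero_apply], fun x y h hx => by
      refine (restrict_map_r hX h (M.obj.map (ST.toCl Y x 1) m)).trans ?_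
      rw [map_map_apply, ST.toCl_r h hx]⟩
  map_zero' := Subtype.ext (funext fun _ => map_zero _)
  map_add' _ _ := Subtype.ext (funext fun _ => map_add _ _ _)

/-- The comparison map from `cosections` of the restriction of an `𝒮𝒯`-module to its degree-zero
values. -/
noncomputable def ofCosections (Y : LC X) :
    ((restrictToBase hX).obj M).cosections Y.1 →+ M.obj.obj (ST.obj Y 0) :=
  BMod.cosectionsLift (fun x => (M.obj.map (ST.fromNb x Y 0)).hom)
    (fun x hx n => by
      change M.obj.obj (ST.obj (nbLC x) 0) at n
      change M.obj.map (ST.fromNb x Y 0) n = 0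
      rw [ST.fromNb_of_notMem hx, map_zero_apply])
    (fun a b h hb n => by
      change M.obj.obj (ST.obj (nbLC a) 0) at n
      refine (congrArg (M.obj.map (ST.fromNb b Y 0)) (restrict_map_i hX h n)).trans ?_
      refine (map_map_apply M _ _ n).trans ?_
      rw [ST.i_fromNb h hb]
      rfl)

variable {M}

theorem ofCosections_cosec (Y : LC X) (x : X) (n : M.obj.obj (ST.obj (nbLC x) 0)) :
    ofCosections hX M Y (BMod.cosec _ Y.1 x n) = M.obj.map (ST.fromNb x Y 0) n :=
  BMod.cosectionsLift_cosec (N := (restrictToBase hX).obj M) (A := M.obj.obj (ST.obj Y 0))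
    (fun x => (M.obj.map (ST.fromNb x Y 0)).hom) _ _ x n

theorem toSections_apply (Y : LC X) (m : M.obj.obj (ST.obj Y 1)) (x : X) :
    (toSections hX M Y m).1 x = M.obj.map (ST.toCl Y x 1) m := rfl

theorem toSections_i {U Y : LC X} (h : IsRelOpen U.1 Y.1) (m : M.obj.obj (ST.obj U 1)) :
    toSections hX M Y (M.obj.map (ST.i h 1) m) = BMod.sectionsExt h (toSections hX M U m) := by
  refine Subtype.ext (funext fun x => ?_)
  rw [BMod.sectionsExt_apply, toSections_apply, toSections_apply, map_map_apply, ST.i_toCl]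

theorem toSections_r {Y C : LC X} (h : IsRelClosed C.1 Y.1) (m : M.obj.obj (ST.obj Y 1)) :
    toSections hX M C (M.obj.map (ST.r h 1) m) = BMod.sectionsRes h (toSections hX M Y m) := by
  refine Subtype.ext (funext fun x => ?_)
  rw [BMod.sectionsRes_apply]
  split_ifs with hx
  · rw [toSections_apply, toSections_apply, map_map_apply, ST.r_toCl h hx]
  · exact (toSections hX M C _).2.1 x hx

theorem ofCosections_i {U Y : LC X} (h : IsRelOpen U.1 Y.1)
    (a : ((restrictToBase hX).obj M).cosections U.1) :
    ofCosections hX M Y (BMod.cosectionsExt h a) =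
      M.obj.map (ST.i h 0) (ofCosections hX M U a) := by
  refine DFunLike.congr_fun (f := (ofCosections hX M Y).comp (BMod.cosectionsExt h))
    (g := (M.obj.map (ST.i h 0)).hom.comp (ofCosections hX M U))
    (BMod.cosections_hom_ext fun x hx n => ?_) a
  change ofCosections hX M Y (BMod.cosectionsExt h (BMod.cosec _ U.1 x n)) =
    M.obj.map (ST.i h 0) (ofCosections hX M U (BMod.cosec _ U.1 x n))
  rw [BMod.cosectionsExt_cosec h hx]
  change M.obj.obj (ST.obj (nbLC x) 0) at n
  refine (ofCosections_cosec hX Y x n).trans (Eq.trans ?_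
    (congrArg (M.obj.map (ST.i h 0)) (ofCosections_cosec hX U x n).symm))
  rw [map_map_apply, ST.fromNb_i h hx]

theorem ofCosections_r {Y C : LC X} (h : IsRelClosed C.1 Y.1)
    (a : ((restrictToBase hX).obj M).cosections Y.1) :
    ofCosections hX M C (BMod.cosectionsRes h a) =
      M.obj.map (ST.r h 0) (ofCosections hX M Y a) := by
  refine DFunLike.congr_fun (f := (ofCosections hX M C).comp (BMod.cosectionsRes h))
    (g := (M.obj.map (ST.r h 0)).hom.comp (ofCosections hX M Y))
    (BMod.cosections_hom_ext fun x hx n => ?_) a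
  change ofCosections hX M C (BMod.cosectionsRes h (BMod.cosec _ Y.1 x n)) =
    M.obj.map (ST.r h 0) (ofCosections hX M Y (BMod.cosec _ Y.1 x n))
  rw [BMod.cosectionsRes_cosec h]
  change M.obj.obj (ST.obj (nbLC x) 0) at n
  refine (ofCosections_cosec hX C x n).trans (Eq.trans ?_
    (congrArg (M.obj.map (ST.r h 0)) (ofCosections_cosec hX Y x n).symm))
  rw [map_map_apply, ST.fromNb_r h]

/-- Once `δ` is written as `baseδ`, the two sides agree arrow by arrow. This is where the EBP
condition is needed. -/
theorem ofCosections_sectionsBoundary (hE : IsEBP X) {U C : LC X} (h : IsBoundaryPair U.1 C.1)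
    (m : M.obj.obj (ST.obj C 1)) :
    ofCosections hE.uniquePath M U
        (BMod.sectionsBoundary C.1 U.1 (toSections hE.uniquePath M C m)) =
      M.obj.map (ST.δ h zero_eq_one_add_one) m := by
  rw [ST.δ_eq_baseδ zero_eq_one_add_one hE h, BMod.sectionsBoundary_apply, map_sum]
  refine Eq.trans (Finset.sum_congr rfl fun p _ => ?_)
    (map_sum_apply M Finset.univ _ m).symm
  refine (ofCosections_cosec hE.uniquePath U p.1.1 _).trans ?_
  refine (congrArg (M.obj.map (ST.fromNb p.1.1 U 0))
    (restrict_map_δ hE.uniquePath p.2 (M.obj.map (ST.toCl C p.1.2 1) m))).trans ?_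
  rw [map_map_apply, map_map_apply]

end Comparison

/-! ### Consequences of exactness and of the vanishing of `δ` from degree 0 -/

section Exactness

variable {X : Type u} [TopologicalSpace X] [Finite X] {M : STMod.{w} X}

theorem STExact.exists_i_eq (hM : STExact M) {U Y C : LC X} (h : Decomp U Y C) {j : ZMod 2}
    {m : M.obj.obj (ST.obj Y j)} (hm : M.obj.map (ST.r h.isRelClosed j) m = 0) :
    ∃ m', M.obj.map (ST.i h.isRelOpen j) m' = m :=
  ((hM U Y C h.isRelOpen h.isRelClosed h.isBoundaryPair h.eq_sdiff j (j + 1) rfl).1 m).1 hm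

theorem STExact.map_i_injective (hM : STExact M) (hR : STRealRankZeroLike M) {U Y C : LC X}
    (h : Decomp U Y C) : Function.Injective (M.obj.map (ST.i h.isRelOpen 1)) := by
  refine (injective_iff_map_eq_zero _).2 fun m hm => ?_
  obtain ⟨m', rfl⟩ := ((hM U Y C h.isRelOpen h.isRelClosed h.isBoundaryPair h.eq_sdiff 0 1
    (by decide)).2.2 m).1 hm
  rw [hR]
  rfl

theorem STExact.map_r_surjective (hM : STExact M) (hR : STRealRankZeroLike M) {U Y C : LC X}
    (h : Decomp U Y C) : Function.Surjective (M.obj.map (ST.r h.isRelClosed 0)) := by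
  intro m
  refine ((hM U Y C h.isRelOpen h.isRelClosed h.isBoundaryPair h.eq_sdiff 0 1
    (by decide)).2.1 m).1 ?_
  rw [hR]
  rfl

end Exactness

/-! ### Vanishing composites with the boundary of sections -/

section Boundary

variable {X : Type u} [TopologicalSpace X] [Finite X] {N : BMod.{u} X} {U Y C : LC X}
  (h : Decomp U Y C)

/-- The composite `r ≫ δ` is zero in `𝒮𝒯`, and `N.ext` is an `𝒮𝒯`-module for every `N`. -/
theorem BMod.sectionsBoundary_sectionsRes (m : N.sections Y.1) :
    sectionsBoundary C.1 U.1 (sectionsRes h.isRelClosed m) = 0 := by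
  have e := congrArg N.ext.obj.map (ST.r_δ_eq_zero h zero_eq_one_add_one)
  rw [Functor.map_comp, Functor.map_zero, ext_map_r, ext_map_δ] at e
  exact ConcreteCategory.congr_hom e m

theorem BMod.cosectionsExt_sectionsBoundary (m : N.sections C.1) :
    cosectionsExt h.isRelOpen (sectionsBoundary C.1 U.1 m) = 0 := by
  have e := congrArg N.ext.obj.map (ST.δ_i_eq_zero h zero_eq_one_add_one)
  rw [Functor.map_comp, Functor.map_zero, ext_map_i, ext_map_δ] at e
  exact ConcreteCategory.congr_hom e m

end Boundary

/-! ### Bijectivity of the comparison maps -/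

section Bijectivity

variable {X : Type u} [TopologicalSpace X] [Finite X] [T0Space X] (hX : UniquePath X)
  {M : STMod.{u} X}

variable (M) in
/-- Both comparison maps at `Y` are bijective. -/
def ComparisonBijective (Y : LC X) : Prop :=
  Function.Bijective (toSections hX M Y) ∧ Function.Bijective (ofCosections hX M Y)

theorem comparisonBijective_of_eq_empty {Y : LC X} (hY : Y.1 = ∅) :
    ComparisonBijective hX M Y := by
  have h0 : ∀ j (m : M.obj.obj (ST.obj Y j)), m = 0 := fun j m => by
    rw [← map_id_apply M m, ST.id_eq_zero hY, map_zero_apply]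
  refine ⟨⟨fun a b _ => (h0 1 a).trans (h0 1 b).symm, fun s => ⟨0, ?_⟩⟩, fun a b _ => ?_,
    fun m => ⟨0, (map_zero _).trans (h0 0 m).symm⟩⟩
  · rw [map_zero]
    exact Subtype.ext (funext fun x => (s.2.1 x (by simp [hY])).symm)
  · have h0' : ∀ a : ((restrictToBase hX).obj M).cosections Y.1, a = 0 :=
      BMod.cosections_induction rfl (fun a b ha hb => by rw [ha, hb, add_zero])
        (fun x hx => by simp [hY] at hx)
    exact (h0' a).trans (h0' b).symm

theorem toCl_ptLC (x : X) (j : ZMod 2) :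
    ST.toCl (ptLC x) x j = ST.i (decomp_cl x).isRelOpen j := by
  have hV : (ptLC x).1 = (ptLC x).1 ∩ closure {x} :=
    (Set.inter_eq_left.2 subset_closure).symm
  rw [ST.toCl_eq (V := ptLC x) rfl hV (isRelClosed_refl _) (decomp_cl x).isRelOpen, ST.r_self,
    Category.id_comp]

theorem fromNb_ptLC (x : X) (j : ZMod 2) :
    ST.fromNb x (ptLC x) j = ST.r (decomp_nb x).isRelClosed j := by
  have hV : (ptLC x).1 = (ptLC x).1 ∩ nhdsKer {x} :=
    (Set.inter_eq_left.2 subset_nhdsKer).symm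
  rw [ST.fromNb_eq (V := ptLC x) rfl hV (decomp_nb x).isRelClosed (isRelOpen_refl _), ST.i_self,
    Category.comp_id]

/-- In degree 1, `M` at the point `x` is the kernel of restriction from the closure of `x` to the
points strictly below; injectivity of `i` uses the vanishing of `δ`. The points strictly below form
the biproduct of the closures of the `y` with `x → y`, so this kernel is the group of elements
killed by every `r`, which are the sections over `{x}`. -/
theorem toSections_ptLC_bijective (hM : STExact M) (hR : STRealRankZeroLike M) (x : X) :
    Function.Bijective (toSections hX M (ptLC x)) := by
  refine ⟨(injective_iff_map_eq_zero _).2 fun m hm => ?_, fun s => ?_⟩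
  · have h : (toSections hX M (ptLC x) m).1 x = 0 := congrArg (fun s => s.1 x) hm
    rw [toSections_apply, toCl_ptLC] at h
    exact (injective_iff_map_eq_zero _).1 (hM.map_i_injective hR (decomp_cl x)) m h
  · let n : M.obj.obj (ST.obj (clLC x) 1) := s.1 x
    have hn : M.obj.map (ST.r (decomp_cl x).isRelClosed 1) n = 0 := by
      rw [← map_id_apply M (M.obj.map (ST.r (decomp_cl x).isRelClosed 1) n),
        ← ST.sum_r_i_clDiff hX x 1, map_sum_apply]
      refine Finset.sum_eq_zero fun y _ => ?_
      rw [← map_map_apply, map_map_apply M (ST.r (decomp_cl x).isRelClosed 1),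
        ST.r_r _ _ (clLC_rel y.2)]
      have h : M.obj.map (ST.r (clLC_rel y.2) 1) n = 0 :=
        (restrict_map_r hX y.2 n).symm.trans ((s.2.2 x y.1 y.2 rfl).trans
          (s.2.1 y.1 fun h => y.2.1.2 (h : y.1 = x)))
      rw [h, map_zero]
    obtain ⟨m, hm⟩ := hM.exists_i_eq (decomp_cl x) hn
    refine ⟨m, Subtype.ext (funext fun y => ?_)⟩
    by_cases hy : y = x
    · subst hy
      rw [toSections_apply, toCl_ptLC, hm]
    · exact ((toSections hX M (ptLC x) m).2.1 y hy).trans (s.2.1 y hy).symm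

/-- Dually, in degree 0, `M` at the point `x` is the cokernel of the map from the points strictly
above `x` to the smallest neighbourhood of `x`. The biproduct over the arrows `z → x` identifies the
image of that map with the sum of the images of the `i`, and these die in the cosections over `{x}`.
-/
theorem ofCosections_ptLC_bijective (hM : STExact M) (hR : STRealRankZeroLike M) (x : X) :
    Function.Bijective (ofCosections hX M (ptLC x)) := by
  refine ⟨(injective_iff_map_eq_zero _).2 fun a ha => ?_, fun m => ?_⟩
  · obtain ⟨n, rfl⟩ : ∃ n, ((restrictToBase hX).obj M).cosec (ptLC x).1 x n = a := by
      change a ∈ (((restrictToBase hX).obj M).cosec (ptLC x).1 x).range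
      refine BMod.cosections_induction (zero_mem _) (fun _ _ => add_mem) (fun y hy n => ?_) a
      obtain rfl : y = x := hy
      exact ⟨n, rfl⟩
    have hn : M.obj.map (ST.r (decomp_nb x).isRelClosed 0) n = 0 :=
      (congrArg (fun f => M.obj.map f n) (fromNb_ptLC x 0)).symm.trans
        ((ofCosections_cosec hX (ptLC x) x n).symm.trans ha)
    obtain ⟨n', hn'⟩ := hM.exists_i_eq (decomp_nb x) hn
    have key : (n : ((restrictToBase hX).obj M).obj.obj (BCat.nb x)) =
        ∑ z : {z : X // Arrow z x}, BMod.iHom ((restrictToBase hX).obj M) z.2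
          (M.obj.map (ST.r (nbLC_isRelClosed_nbDiff hX z.2) 0) n') := by
      refine Eq.trans (hn'.symm.trans ?_) (Finset.sum_congr rfl fun z _ =>
        (restrict_map_i hX z.2 (M.obj.map (ST.r (nbLC_isRelClosed_nbDiff hX z.2) 0) n')).symm)
      rw [← Category.id_comp (ST.i (decomp_nb x).isRelOpen 0), ← ST.sum_r_i_nbDiff hX x 0,
        Preadditive.sum_comp]
      refine (map_sum_apply M _ _ n').trans (Finset.sum_congr rfl fun z _ => ?_)
      rw [Category.assoc, ST.i_i _ _ (nbLC_rel z.2), map_map_apply]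
    rw [key, map_sum]
    refine Finset.sum_eq_zero fun z _ => ?_
    refine (BMod.cosec_iHom (N := (restrictToBase hX).obj M) (Y := (ptLC x).1) z.2 rfl _).trans ?_
    exact BMod.cosec_of_notMem (Y := (ptLC x).1) (fun h => z.2.1.2 (h : z.1 = x).symm) _
  · obtain ⟨n, rfl⟩ := hM.map_r_surjective hR (decomp_nb x) m
    refine ⟨BMod.cosec _ _ x n, (ofCosections_cosec hX (ptLC x) x n).trans ?_⟩
    rw [fromNb_ptLC]

/-- A five-lemma chase between the six-term sequence of `M` and that of sections and cosections of
its restriction. -/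
theorem ComparisonBijective.of_decomp (hE : IsEBP X) (hM : STExact M)
    {U Y C : LC X} (h : Decomp U Y C) (hU : ComparisonBijective hE.uniquePath M U)
    (hC : ComparisonBijective hE.uniquePath M C) : ComparisonBijective hE.uniquePath M Y := by
  obtain ⟨⟨hU1, hU2⟩, hU3, hU4⟩ := hU
  obtain ⟨⟨hC1, hC2⟩, hC3, hC4⟩ := hC
  rw [injective_iff_map_eq_zero] at hU1 hC1 hU3 hC3
  refine ⟨⟨(injective_iff_map_eq_zero _).2 fun m hm => ?_, fun s => ?_⟩,
    (injective_iff_map_eq_zero _).2 fun s hs => ?_, fun m => ?_⟩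
  · obtain ⟨u, rfl⟩ := hM.exists_i_eq h (hC1 _ (by rw [toSections_r, hm, map_zero]))
    rw [toSections_i] at hm
    rw [hU1 u ((injective_iff_map_eq_zero _).1 (BMod.sectionsExt_injective h.isRelOpen) _ hm),
      map_zero]
  · obtain ⟨c, hc⟩ := hC2 (BMod.sectionsRes h.isRelClosed s)
    -- The boundary of `c` corresponds to the boundary of the restriction to `C` of a section over
    -- `Y`, which is zero.
    obtain ⟨m, rfl⟩ := hM.liftsAlong h c (by
      refine (ofCosections_sectionsBoundary hE h.isBoundaryPair c).symm.trans ?_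
      rw [hc, BMod.sectionsBoundary_sectionsRes h, map_zero])
    obtain ⟨t, ht⟩ := BMod.exists_sectionsExt_eq h (s - toSections hE.uniquePath M Y m) (by
      rw [map_sub, ← hc, toSections_r, sub_self])
    obtain ⟨u, rfl⟩ := hU2 t
    refine ⟨m + M.obj.map (ST.i h.isRelOpen 1) u, ?_⟩
    rw [map_add, toSections_i, ht, add_sub_cancel]
  · obtain ⟨t, rfl⟩ := BMod.mem_range_of_cosectionsRes_eq_zero h s
      (hC3 _ (by rw [ofCosections_r, hs, map_zero]))
    rw [ofCosections_i] at hs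
    obtain ⟨c, hc⟩ := hM.boundsAlong h _ hs
    -- By injectivity over `U`, the cosection `t` is itself the boundary of a section over `C`, so
    -- it dies over `Y`.
    rw [← ofCosections_sectionsBoundary hE h.isBoundaryPair, ← sub_eq_zero, ← map_sub] at hc
    rw [← sub_eq_zero.1 (hU3 _ hc), BMod.cosectionsExt_sectionsBoundary h]
  · obtain ⟨c, hc⟩ := hC4 (M.obj.map (ST.r h.isRelClosed 0) m)
    obtain ⟨s, rfl⟩ := BMod.cosectionsRes_surjective h.isRelClosed c
    rw [ofCosections_r] at hc
    obtain ⟨u, hu⟩ := hM.exists_i_eq h (m := m - ofCosections hE.uniquePath M Y s) (by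
      rw [map_sub, hc, sub_self])
    obtain ⟨t, rfl⟩ := hU4 u
    refine ⟨s + BMod.cosectionsExt h.isRelOpen t, ?_⟩
    rw [map_add, ofCosections_i, hu, add_sub_cancel]

theorem comparisonBijective (hE : IsEBP X) (hM : STExact M) (hR : STRealRankZeroLike M)
    (Y : LC X) : ComparisonBijective hE.uniquePath M Y := by
  induction hn : Y.1.ncard using Nat.strong_induction_on generalizing Y with
  | _ n ih =>
  subst hn
  rcases Y.1.eq_empty_or_nonempty with hY | hY
  · exact comparisonBijective_of_eq_empty _ hY
  obtain ⟨z, hz, hz'⟩ := exists_maximal_pt hY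
  obtain ⟨C, h⟩ := Decomp.of_maximal hz hz'
  have hp : ComparisonBijective hE.uniquePath M (ptLC z) :=
    ⟨toSections_ptLC_bijective _ hM hR z, ofCosections_ptLC_bijective _ hM hR z⟩
  exact .of_decomp hE hM h hp (ih _ (h.ncard_right_lt ⟨z, rfl⟩) C rfl)

end Bijectivity

/-! ### Functoriality of the extension -/

section Functoriality

variable {X : Type u} [TopologicalSpace X] [Finite X]

namespace BMod

variable {N N' N'' : BMod.{u} X} (f : N ⟶ N')

/-- The component of a homomorphism of `ℬ`-modules at the closure of a point. -/
noncomputable def clApp (x : X) : N.obj.obj (BCat.cl x) →+ N'.obj.obj (BCat.cl x) :=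
  (f.hom.app (BCat.cl x)).hom

/-- The component of a homomorphism of `ℬ`-modules at the smallest neighbourhood of a point. -/
noncomputable def nbApp (x : X) : N.obj.obj (BCat.nb x) →+ N'.obj.obj (BCat.nb x) :=
  (f.hom.app (BCat.nb x)).hom

theorem clApp_rHom {x y : X} (h : Arrow x y) (n : N.obj.obj (BCat.cl x)) :
    clApp f y (N.rHom h n) = N'.rHom h (clApp f x n) := naturality_apply' f (BCat.r h) n

theorem nbApp_δHom {x y : X} (h : Arrow x y) (n : N.obj.obj (BCat.cl y)) :
    nbApp f x (N.δHom h n) = N'.δHom h (clApp f y n) := naturality_apply' f (BCat.δ h) n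

theorem nbApp_iHom {x y : X} (h : Arrow x y) (n : N.obj.obj (BCat.nb x)) :
    nbApp f y (N.iHom h n) = N'.iHom h (nbApp f x n) := naturality_apply' f (BCat.i h) n

/-- Functoriality of `sections`. -/
noncomputable def sectionsMap (Y : Set X) : N.sections Y →+ N'.sections Y where
  toFun m := ⟨fun x => clApp f x (m.1 x), fun x hx => (congrArg (clApp f x) (m.2.1 x hx)).trans
    (map_zero _), fun x y h hx => by rw [← clApp_rHom, m.2.2 x y h hx]⟩
  map_zero' := Subtype.ext (funext fun _ => map_zero _)
  map_add' _ _ := Subtype.ext (funext fun _ => map_add _ _ _)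

/-- Functoriality of `cosections`. -/
noncomputable def cosectionsMap (Y : Set X) : N.cosections Y →+ N'.cosections Y :=
  cosectionsLift (fun x => (N'.cosec Y x).comp (nbApp f x))
    (fun _ hx _ => cosec_of_notMem hx _)
    (fun a b h hb n => by
      rw [AddMonoidHom.comp_apply, nbApp_iHom, cosec_iHom h hb]
      rfl)

theorem cosectionsMap_cosec (Y : Set X) (x : X) (n : N.obj.obj (BCat.nb x)) :
    cosectionsMap f Y (N.cosec Y x n) = N'.cosec Y x (nbApp f x n) := cosectionsLift_cosec _ _ _ x n

/-- The components of `extMap`. -/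
noncomputable def extApp : (a : STObj X) → (N.extObj a ⟶ N'.extObj a)
  | ⟨Y, 0⟩ => AddCommGrpCat.ofHom (cosectionsMap f Y.1)
  | ⟨Y, 1⟩ => AddCommGrpCat.ofHom (sectionsMap f Y.1)

theorem extI_extApp {U Y : LC X} (h : IsRelOpen U.1 Y.1) (j : ZMod 2) :
    N.extI h j ≫ extApp f ⟨Y, j⟩ = extApp f ⟨U, j⟩ ≫ N'.extI h j := by
  induction j using zmod_two_cases
  · refine extHom_ext fun x hx n => ?_
    change cosectionsMap f Y.1 (cosectionsExt h (N.cosec U.1 x n)) =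
      cosectionsExt h (cosectionsMap f U.1 (N.cosec U.1 x n))
    rw [cosectionsExt_cosec h hx, cosectionsMap_cosec, cosectionsMap_cosec,
      cosectionsExt_cosec h hx]
  · rfl

theorem extR_extApp {Y C : LC X} (h : IsRelClosed C.1 Y.1) (j : ZMod 2) :
    N.extR h j ≫ extApp f ⟨C, j⟩ = extApp f ⟨Y, j⟩ ≫ N'.extR h j := by
  induction j using zmod_two_cases
  · refine extHom_ext fun x hx n => ?_
    change cosectionsMap f C.1 (cosectionsRes h (N.cosec Y.1 x n)) =
      cosectionsRes h (cosectionsMap f Y.1 (N.cosec Y.1 x n))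
    rw [cosectionsRes_cosec, cosectionsMap_cosec, cosectionsMap_cosec, cosectionsRes_cosec]
  · refine extHom_ext_one fun m x => ?_
    change N.sections Y.1 at m
    change clApp f x ((sectionsRes h m).1 x) = (sectionsRes h (sectionsMap f Y.1 m)).1 x
    rw [sectionsRes_apply, sectionsRes_apply]
    split_ifs with hx
    · rfl
    · exact map_zero _

theorem extδ_extApp {U C : LC X} {j k : ZMod 2} (hjk : k = j + 1) :
    N.extδ U C j k ≫ extApp f ⟨U, k⟩ = extApp f ⟨C, j⟩ ≫ N'.extδ U C j k := by
  subst hjk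
  induction j using zmod_two_cases
  · exact Limits.zero_comp.trans Limits.comp_zero.symm
  · refine AddCommGrpCat.hom_ext (AddMonoidHom.ext fun m => ?_)
    change N.sections C.1 at m
    change cosectionsMap f U.1 (sectionsBoundary C.1 U.1 m) =
      sectionsBoundary C.1 U.1 (sectionsMap f C.1 m)
    rw [sectionsBoundary_apply, sectionsBoundary_apply, map_sum]
    refine Finset.sum_congr rfl fun p _ => ?_
    rw [cosectionsMap_cosec, nbApp_δHom]
    rfl

/-- The homomorphism of `𝒮𝒯`-modules associated with a homomorphism of `ℬ`-modules. -/
noncomputable def extMap : N.ext ⟶ N'.ext :=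
  ObjectProperty.homMk (Presented.natTrans N.ext.obj N'.ext.obj (extApp f) (by
    intro a b e
    change STGen a b at e
    cases e with
    | i h j =>
      exact (congrArg (· ≫ _) (N.ext_map_i h j)).trans ((extI_extApp f h j).trans
        (congrArg (_ ≫ ·) (N'.ext_map_i h j).symm))
    | r h j =>
      exact (congrArg (· ≫ _) (N.ext_map_r h j)).trans ((extR_extApp f h j).trans
        (congrArg (_ ≫ ·) (N'.ext_map_r h j).symm))
    | δ h hjk =>
      exact (congrArg (· ≫ _) (N.ext_map_δ h hjk)).trans ((extδ_extApp f hjk).trans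
        (congrArg (_ ≫ ·) (N'.ext_map_δ h hjk).symm))))

theorem extApp_id (a : STObj X) : extApp (𝟙 N) a = 𝟙 _ := by
  obtain ⟨Y, j⟩ := a
  induction j using zmod_two_cases
  · exact extHom_ext fun x _ n => cosectionsMap_cosec _ _ _ _
  · rfl

theorem extApp_comp (g : N' ⟶ N'') (a : STObj X) : extApp (f ≫ g) a = extApp f a ≫ extApp g a := by
  obtain ⟨Y, j⟩ := a
  induction j using zmod_two_cases
  · refine extHom_ext fun x _ n => ?_
    change cosectionsMap (f ≫ g) Y.1 (N.cosec Y.1 x n) =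
      cosectionsMap g Y.1 (cosectionsMap f Y.1 (N.cosec Y.1 x n))
    rw [cosectionsMap_cosec, cosectionsMap_cosec, cosectionsMap_cosec]
    rfl
  · rfl

variable (X) in
/-- The functor from `ℬ`-modules to `𝒮𝒯`-modules. -/
noncomputable def extFunctor : BMod.{u} X ⥤ STMod.{u} X where
  obj := ext
  map := extMap
  map_id _ := ObjectProperty.hom_ext _ (NatTrans.ext (funext fun a => extApp_id a.as.vertex))
  map_comp f g := ObjectProperty.hom_ext _
    (NatTrans.ext (funext fun a => extApp_comp f g a.as.vertex))

variable [T0Space X]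

theorem restrictExtIso_naturality (hX : UniquePath X) :
    (restrictToBase hX).map (extMap f) ≫ (N'.restrictExtIso hX).hom =
      (N.restrictExtIso hX).hom ≫ f := by
  refine ObjectProperty.hom_ext _ (NatTrans.ext (funext fun a => ?_))
  obtain ⟨⟨a⟩⟩ := a
  cases a with
  | cl x => rfl
  | nb x =>
    refine AddCommGrpCat.hom_ext (AddMonoidHom.ext fun m => ?_)
    obtain ⟨n, rfl⟩ := (N.cosectionsNhdsKerEquiv hX x).surjective m
    change (N'.cosectionsNhdsKerEquiv hX x).symm (cosectionsMap f (nhdsKer {x})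
      (N.cosec (nhdsKer {x}) x n)) = nbApp f x ((N.cosectionsNhdsKerEquiv hX x).symm
        (N.cosectionsNhdsKerEquiv hX x n))
    rw [cosectionsMap_cosec, AddEquiv.symm_apply_apply]
    exact (N'.cosectionsNhdsKerEquiv hX x).symm_apply_apply _

end BMod

end Functoriality

/-! ### The equivalence of categories -/

section Equivalence

variable {X : Type u} [TopologicalSpace X] [Finite X] [T0Space X] (hE : IsEBP X)
  {M M' : STMod.{u} X} (hM : STExactRRZ X M) (hM' : STExactRRZ X M')

/-- The comparison map in degree zero, as an isomorphism. -/
noncomputable def ofCosectionsEquiv (Y : LC X) :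
    ((restrictToBase hE.uniquePath).obj M).cosections Y.1 ≃+ M.obj.obj (ST.obj Y 0) :=
  AddEquiv.ofBijective _ (comparisonBijective hE hM.1 hM.2 Y).2

/-- The components of `extRestrictIso`. -/
noncomputable def extRestrictApp : (a : STObj X) →
    (M.obj.obj (Presented.obj STRel a) ≅
      (((restrictToBase hE.uniquePath).obj M).ext.obj.obj (Presented.obj STRel a)))
  | ⟨Y, 0⟩ => (ofCosectionsEquiv hE hM Y).symm.toAddCommGrpIso
  | ⟨Y, 1⟩ => (AddEquiv.ofBijective (toSections hE.uniquePath M Y)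
      (comparisonBijective hE hM.1 hM.2 Y).1).toAddCommGrpIso

theorem symm_apply_of_comm {A A' B B' : Type*} [AddGroup A] [AddGroup A'] [AddGroup B] [AddGroup B']
    (e : A ≃+ A') (e' : B ≃+ B') (f : A →+ B) (g : A' →+ B') (h : ∀ a, e' (f a) = g (e a))
    (a' : A') : e'.symm (g a') = f (e.symm a') := by
  rw [AddEquiv.symm_apply_eq, h, AddEquiv.apply_symm_apply]

/-- An exact real-rank-zero-like `𝒮𝒯`-module is determined by its restriction. -/
noncomputable def extRestrictIso : M ≅ ((restrictToBase hE.uniquePath).obj M).ext := by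
  let N := (restrictToBase hE.uniquePath).obj M
  refine ObjectProperty.isoMk _ (Presented.natIso _ _ (extRestrictApp hE hM) ?_)
  intro a b e
  change STGen a b at e
  cases e with
  | @i U Y h j =>
    refine Eq.trans ?_ (congrArg (_ ≫ ·) (N.ext_map_i h j).symm)
    induction j using BMod.zmod_two_cases
    · exact AddCommGrpCat.hom_ext (AddMonoidHom.ext fun m => symm_apply_of_comm
        (ofCosectionsEquiv hE hM U) (ofCosectionsEquiv hE hM Y) (BMod.cosectionsExt h)
        (M.obj.map (ST.i h 0)).hom (ofCosections_i hE.uniquePath h) m)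
    · exact AddCommGrpCat.hom_ext (AddMonoidHom.ext fun m => toSections_i hE.uniquePath h m)
  | @r Y C h j =>
    refine Eq.trans ?_ (congrArg (_ ≫ ·) (N.ext_map_r h j).symm)
    induction j using BMod.zmod_two_cases
    · exact AddCommGrpCat.hom_ext (AddMonoidHom.ext fun m => symm_apply_of_comm
        (ofCosectionsEquiv hE hM Y) (ofCosectionsEquiv hE hM C) (BMod.cosectionsRes h)
        (M.obj.map (ST.r h 0)).hom (ofCosections_r hE.uniquePath h) m)
    · exact AddCommGrpCat.hom_ext (AddMonoidHom.ext fun m => toSections_r hE.uniquePath h m)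
  | @δ U C h j k hjk =>
    refine Eq.trans ?_ (congrArg (_ ≫ ·) (N.ext_map_δ h hjk).symm)
    subst hjk
    induction j using BMod.zmod_two_cases
    · exact (congrArg (· ≫ _) (hM.2 U C h)).trans (Limits.zero_comp.trans Limits.comp_zero.symm)
    · exact AddCommGrpCat.hom_ext (AddMonoidHom.ext fun m => (AddEquiv.symm_apply_eq
        (ofCosectionsEquiv hE hM U)).2 (ofCosections_sectionsBoundary hE h m).symm)

/-- The comparison maps are assembled from the actions of the morphisms `ST.toCl` and `ST.fromNb` of
`𝒮𝒯`, with which `f` commutes. -/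
theorem extRestrictIso_naturality (f : M ⟶ M') :
    f ≫ (extRestrictIso hE hM').hom = (extRestrictIso hE hM).hom ≫
      BMod.extMap ((restrictToBase hE.uniquePath).map f) := by
  refine ObjectProperty.hom_ext _ (NatTrans.ext (funext fun a => ?_))
  obtain ⟨⟨Y, j⟩⟩ := a
  induction j using BMod.zmod_two_cases
  · refine AddCommGrpCat.hom_ext (AddMonoidHom.ext fun m => symm_apply_of_comm
      (ofCosectionsEquiv hE hM Y) (ofCosectionsEquiv hE hM' Y)
      (BMod.cosectionsMap ((restrictToBase hE.uniquePath).map f) Y.1)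
      (f.hom.app (ST.obj Y 0)).hom (fun a => ?_) m)
    refine DFunLike.congr_fun (f := (ofCosections hE.uniquePath M' Y).comp
        (BMod.cosectionsMap ((restrictToBase hE.uniquePath).map f) Y.1))
      (g := (f.hom.app (ST.obj Y 0)).hom.comp (ofCosections hE.uniquePath M Y))
      (BMod.cosections_hom_ext fun x hx n => ?_) a
    refine (congrArg (ofCosections hE.uniquePath M' Y)
      (BMod.cosectionsMap_cosec _ Y.1 x n)).trans ?_
    refine (ofCosections_cosec hE.uniquePath Y x _).trans ?_
    refine Eq.trans ?_ (congrArg (f.hom.app (ST.obj Y 0))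
      (ofCosections_cosec hE.uniquePath Y x n).symm)
    exact (naturality_apply' f (ST.fromNb x Y 0) n).symm
  · refine AddCommGrpCat.hom_ext (AddMonoidHom.ext fun m => Subtype.ext (funext fun x => ?_))
    exact (naturality_apply' f (ST.toCl Y x 1) m).symm

/-- The functor from exact `ℬ`-modules to exact real-rank-zero-like `𝒮𝒯`-modules. -/
noncomputable def extExact : (BExactMod.{u} X).FullSubcategory ⥤ (STExactRRZ.{u} X).FullSubcategory :=
  (STExactRRZ X).lift ((BExactMod X).ι ⋙ BMod.extFunctor X)
    fun N => ⟨BMod.ext_stExact N.property, BMod.ext_realRankZeroLike⟩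

/-- The quasi-inverse is `extExact`; the unit is given by the comparison maps and the counit by
evaluation on closures and smallest neighbourhoods of points. -/
theorem restrict_isEquivalence (h : ∀ M : STMod.{u} X, STExactRRZ X M →
      BExactMod X ((restrictToBase hE.uniquePath).obj M)) :
    ((BExactMod.{u} X).lift ((STExactRRZ.{u} X).ι ⋙ restrictToBase hE.uniquePath)
      (fun M => h M.obj M.property)).IsEquivalence :=
  Functor.IsEquivalence.mk' extExact
    (NatIso.ofComponents (fun M => ObjectProperty.isoMk _ (extRestrictIso hE M.property))
      fun f => ObjectProperty.hom_ext _ (extRestrictIso_naturality hE _ _ f.hom))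
    (NatIso.ofComponents (fun N => ObjectProperty.isoMk _ (N.obj.restrictExtIso hE.uniquePath))
      fun f => ObjectProperty.hom_ext _ (BMod.restrictExtIso_naturality f.hom hE.uniquePath))

end Equivalence

end FilteredK

theorem mainTheorem3 (X : Type u) [TopologicalSpace X] [Finite X] [T0Space X]
    (hX : FilteredK.IsEBP X) :
    ∃ h : ∀ M : FilteredK.STMod.{u} X, FilteredK.STExactRRZ X M →
        FilteredK.BExactMod X ((FilteredK.restrictToBase hX.uniquePath).obj M),
      ((FilteredK.BExactMod.{u} X).lift
        ((FilteredK.STExactRRZ.{u} X).ι ⋙ FilteredK.restrictToBase hX.uniquePath)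
        (fun M => h M.obj M.property)).IsEquivalence :=
  have h := fun (M : FilteredK.STMod.{u} X) (hM : FilteredK.STExactRRZ X M) =>
    FilteredK.restrict_bExact hX.uniquePath hM.1
  ⟨h, FilteredK.restrict_isEquivalence hX h⟩
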